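/- For $n\ge 1$ let $\mathbb H^n=\{w\in\mathbb R^n: w_n>0\}$ be the half-space model of hyperbolic space, with volume $d\mu(w)=w_n^{-n}\,dw_1\cdots dw_n$ and distance $\rho(w,w')\ge 0$ given by $\cosh^2(\rho(w,w')/2)=\frac{|w-w'|^2}{4w_nw_n'}+1$, and let $$\mathcal L_n=w_n^2\,\Delta_{\mathbb R^n}+(2-n)\,w_n\frac{\partial}{\partial w_n}+\frac{(n-1)^2}{4}$$ be the shifted Laplace–Beltrami operator. On $C_c^\infty(\mathbb H^n)$ it is essentially self-adjoint in $L^2(\mathbb H^n,d\mu)$, and its closure, again written $\mathcal L_n$, satisfies $-\mathcal L_n\ge 0$; so the heat semigroup $e^{t\mathcal L_n}$ and the Poisson semigroup $e^{-y\sqrt{-\mathcal L_n}}$ ($t,y>0$) are defined by the functional calculus of $-\mathcal L_n$. For every $t>0$ there is a function $K_n^{\mathbb H}(t,\cdot)$, continuous on $[0,\infty)$, such that for every $f\in C_c^\infty(\mathbb H^n)$ and almost every $w$, $$e^{t\mathcal L_n}f(w)=\int_{\mathbb H^n}K_n^{\mathbb H}(t,\rho(w,w'))\,f(w')\,d\mu(w').$$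 Moreover, for every $n\ge 1$: (i) The operator-valued function $p=y^2\mapsto \frac{\sqrt\pi\, e^{-y\sqrt{-\mathcal L_n}}}{y}$, $p>0$, has an inverse Laplace transform $L^{-1}_{y^2}[\cdot]$ in operator norm, that is, a continuous function $g$ from $(0,\infty)$ to the bounded operators on $L^2(\mathbb H^n,d\mu)$ whose Laplace transform $\int_0^\infty e^{-pu}g(u)\,du$ converges absolutely to it for all $p>0$, and $$e^{t\mathcal L_n}=(4t)^{-1/2}\,L^{-1}_{y^2}\!\left[\frac{\sqrt\pi\, e^{-y\sqrt{-\mathcal L_n}}}{y}\right]\!\left(\frac1{4t}\right)\qquad(t>0).$$ (ii) For all $t>0$ and $\rho>0$, $K_n^{\mathbb H}(t,\cdot)$ is differentiable at $\rho$ and $$-\frac{1}{2\pi\sinh\rho}\frac{\partial}{\partial\rho}K_n^{\mathbb H}(t,\rho)=K_{n+2}^{\mathbb H}(t,\rho).$$ (iii) For all $t>0$ and $r\ge 0$ the following integral converges absolutely and $$\int_r^\infty\frac{K_{n+1}^{\mathbb H}(t,\rho)}{\sqrt{\cosh^2(\rho/2)-\cosh^2(r/2)}}\,\sinh\rho\,d\rho=K_n^{\mathbb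 H}(t,r).$$ -/

import Mathlib

open MeasureTheory Set

open scoped ContDiff

noncomputable section

namespace HypHeat

/-- The index of the last coordinate `x_n` of `ℝⁿ`, for `n ≥ 1`. -/
def lastIdx (n : ℕ) [NeZero n] : Fin n :=
  ⟨n - 1, Nat.sub_lt (Nat.pos_of_ne_zero (NeZero.ne n)) Nat.one_pos⟩

/-- The upper half space `x_n > 0`, the model of the hyperbolic space `ℍⁿ`. -/
def halfSpace (n : ℕ) [NeZero n] : Set (EuclideanSpace ℝ (Fin n)) :=
  {w | 0 < w (lastIdx n)}

/-- The hyperbolic volume `dx₁ ⋯ dx_n / x_nⁿ` on the half space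
(extended by zero to the rest of `ℝⁿ`). -/
def hypVolume (n : ℕ) [NeZero n] : Measure (EuclideanSpace ℝ (Fin n)) :=
  (volume.restrict (halfSpace n)).withDensity
    (fun w => ENNReal.ofReal ((w (lastIdx n) ^ n)⁻¹))

/-- The hyperbolic distance: `sinh (ρ/2) = |w - w'| / (2 √(x_n x_n'))`, equivalently
`cosh² (ρ/2) = |w - w'|² / (4 x_n x_n') + 1`. -/
def hypDist {n : ℕ} [NeZero n] (w w' : EuclideanSpace ℝ (Fin n)) : ℝ :=
  2 * Real.arsinh (‖w - w'‖ / (2 * √(w (lastIdx n) * w' (lastIdx n))))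

theorem cosh_sq_half_hypDist {n : ℕ} [NeZero n] {w w' : EuclideanSpace ℝ (Fin n)}
    (hw : w ∈ halfSpace n) (hw' : w' ∈ halfSpace n) :
    Real.cosh (hypDist w w' / 2) ^ 2 =
      ‖w - w'‖ ^ 2 / (4 * w (lastIdx n) * w' (lastIdx n)) + 1 := by
  have h : 0 < w (lastIdx n) * w' (lastIdx n) := mul_pos hw hw'
  have h2 : hypDist w w' / 2 =
      Real.arsinh (‖w - w'‖ / (2 * √(w (lastIdx n) * w' (lastIdx n)))) := by
    unfold hypDist; ring
  rw [Real.cosh_sq, h2, Real.sinh_arsinh, div_pow, mul_pow, Real.sq_sqrt h.le]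
  congr 2
  ring

/-- Test functions `C_c^∞(ℍⁿ)`. -/
def IsTest (n : ℕ) [NeZero n] (φ : EuclideanSpace ℝ (Fin n) → ℂ) : Prop :=
  ContDiff ℝ ∞ φ ∧ HasCompactSupport φ ∧ tsupport φ ⊆ halfSpace n

/-- The differential expression
`𝓛_n = x_n² Δ + (2 - n) x_n ∂/∂x_n + (n - 1)² / 4`, with `Δ` the Euclidean Laplacian:
the shifted Laplace–Beltrami operator of `ℍⁿ`. -/
def hypLap (n : ℕ) [NeZero n] (φ : EuclideanSpace ℝ (Fin n) → ℂ)
    (w : EuclideanSpace ℝ (Fin n)) : ℂ :=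
  ((w (lastIdx n) ^ 2 : ℝ) : ℂ) * Laplacian.laplacian φ w
    + (((2 - n) * w (lastIdx n) : ℝ) : ℂ) *
        fderiv ℝ φ w (EuclideanSpace.single (lastIdx n) 1)
    + (((n - 1) ^ 2 / 4 : ℝ) : ℂ) * φ w

/-- The Hilbert space `L²(ℍⁿ, dμ)`. -/
abbrev L2 (n : ℕ) [NeZero n] : Type := Lp ℂ 2 (hypVolume n)

/-- The graph in `L² × L²` of `𝓛_n` with domain `C_c^∞(ℍⁿ)`. -/
def lapGraph (n : ℕ) [NeZero n] : Set (L2 n × L2 n) :=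
  {p | ∃ φ, IsTest n φ ∧ p.1 =ᵐ[hypVolume n] φ ∧ p.2 =ᵐ[hypVolume n] hypLap n φ}

/-- `R = (1 - 𝓛_n)⁻¹`, where `𝓛_n` now stands for the closure in `L²` of the operator on
`C_c^∞(ℍⁿ)`: `R f = u` if and only if `u` is in the domain and `u - 𝓛_n u = f`. -/
def IsResolvent (n : ℕ) [NeZero n] (R : L2 n →L[ℂ] L2 n) : Prop :=
  ∀ f u, R f = u ↔ (u, u - f) ∈ closure (lapGraph n)

open Classical in
/-- The resolvent `(1 - 𝓛_n)⁻¹` (zero if there were none). -/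
def resolvent (n : ℕ) [NeZero n] : L2 n →L[ℂ] L2 n :=
  if h : ∃ R, IsResolvent n R then h.choose else 0

/-- The functional calculus `g(A)` of a nonnegative self-adjoint operator `A` on a Hilbert space,
for `g : [0, ∞) → ℝ` continuous and vanishing at infinity, in terms of `R = (1 + A)⁻¹`.
It is the continuous functional calculus of the bounded operator `R`: the spectral
value `l` of `A` corresponds to `r = 1 / (1 + l)`, and `l = ∞` to `r = 0`. -/
def calculus {H : Type*} [NormedAddCommGroup H] [InnerProductSpace ℂ H] [CompleteSpace H]
    (R : H →L[ℂ] H) (g : ℝ → ℝ) : H →L[ℂ] H :=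
  cfc (fun r : ℝ => if r = 0 then 0 else g (1 / r - 1)) R

/-- The heat semigroup `e^{t 𝓛_n}`, `t > 0`. -/
def heatSemigroup (n : ℕ) [NeZero n] (t : ℝ) : L2 n →L[ℂ] L2 n :=
  calculus (resolvent n) (fun l => Real.exp (-t * l))

/-- The Poisson semigroup `e^{-y √(-𝓛_n)}`, `y > 0`. -/
def poissonSemigroup (n : ℕ) [NeZero n] (y : ℝ) : L2 n →L[ℂ] L2 n :=
  calculus (resolvent n) (fun l => Real.exp (-y * √l))

/-- `k`, as a function of the hyperbolic distance, is the integral kernel of `e^{t 𝓛_n}` with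
respect to the hyperbolic volume. -/
def IsHeatKernel (n : ℕ) [NeZero n] (t : ℝ) (k : ℝ → ℝ) : Prop :=
  ContinuousOn k (Ici 0) ∧
    ∀ (φ : EuclideanSpace ℝ (Fin n) → ℂ) (f : L2 n), IsTest n φ → f =ᵐ[hypVolume n] φ →
      heatSemigroup n t f =ᵐ[hypVolume n]
        fun w => ∫ w', (k (hypDist w w') : ℂ) * φ w' ∂(hypVolume n)

open Classical in
/-- The heat kernel `K_n(t, ρ)` of `ℍⁿ`, as a function of the distance `ρ ≥ 0`. -/
def heatKernel (n : ℕ) [NeZero n] (t : ℝ) : ℝ → ℝ :=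
  if h : ∃ k, IsHeatKernel n t k then h.choose else 0

/-- `g`, continuous on `(0, ∞)`, has the Laplace transform `F` on `(0, ∞)`. -/
def HasLaplace {E : Type*} [NormedAddCommGroup E] [NormedSpace ℂ E] (g F : ℝ → E) : Prop :=
  ContinuousOn g (Ioi 0) ∧
    ∀ p > 0, IntegrableOn (fun u => Real.exp (-p * u) • g u) (Ioi 0) ∧
      ∫ u in Ioi (0 : ℝ), Real.exp (-p * u) • g u = F p

open Classical in
/-- The inverse Laplace transform `L⁻¹[F]` (unique on `(0, ∞)` where it exists). -/
def inverseLaplace {E : Type*} [NormedAddCommGroup E] [NormedSpace ℂ E] (F : ℝ → E) : ℝ → E :=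
  if h : ∃ g, HasLaplace g F then h.choose else 0

end HypHeat

end

/-! In the variable z = cosh ρ, (ii) reads K_{n+2} = -(2π)⁻¹ ∂K_n/∂z, and the substitution u² =
2(cosh ρ - cosh r) turns (iii) into the Abel transform K_n(z) = ∫_ℝ K_{n+1}(z + u²/2) du. So the
kernels are defined by these relations: `radialKernel` is, for odd n, an iterated z-derivative of
the Gaussian of the line and, for even n, one Abel transform of an odd kernel. The relations are
consistent because in polar coordinates two Abel transforms invert -(2π)⁻¹ ∂/∂z
(`HeatTower.abel_abel`). Both operations carry the radial heat equation of one dimension to that of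
another (`heat_ndz`, `HeatTower.abel_heat`); the shift (n-1)²/4 is exactly what leaves no
zeroth-order remainder.

Regularity on the diagonal ρ = 0 comes from continuing ρ² analytically to all z > 0 by means of ρ /
sinh ρ = ∫₀^∞ du / (u² + 2uz + 1). This integral has bounded derivatives of alternating sign, so the
kernels are smooth across z = 1, nonnegative and under Gaussian control.

It remains to identify `radialKernel` with the kernel of the semigroup defined by functional
calculus. On test functions 𝓛_n is symmetric (Green) and nonpositive (Hardy). The function K_t(w, ·)
lies in the domain of the closure, where 𝓛_n acts on it as ∂/∂t (`heatVec_mem_closure`). The kernel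
also preserves the ground state h = w_n^((n-1)/2), a positive solution of 𝓛_n h = 0
(`lintegral_radialKernel_mul_groundState`): each horizontal integration is an Abel transform, and
the vertical one is a Gaussian of mass one. Hence the kernel operator P_t is a contraction for the
sup norm relative to h and for L¹(h dμ), and P_t ψ stays bounded in L² for every test function ψ.

Essential self-adjointness follows (`eq_zero_of_inner_range`): if v is orthogonal to the range of 1
- 𝓛_n, then ⟨P_t ψ, v⟩ is a multiple of e^t and bounded, hence zero, and t → 0 gives v = 0. The
semigroup is then recognised by the Duhamel argument (`heatSemigroup_test`): ⟨K_r(w, ·),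
e^{(τ-r)𝓛_n} f⟩ does not depend on r. A continuous kernel depending on the distance alone is unique
(`IsHeatKernel.eqOn`), so the chosen `heatKernel` is `radialKernel` at cosh ρ, and (ii) and (iii)
are read off.

Part (i) is the subordination formula √(π/p) e^{-√(pl)} = ∫₀^∞ e^{-pu} u^{-1/2} e^{-l/(4u)} du,
passed through the functional calculus, together with uniqueness for vector-valued Laplace
transforms. -/

noncomputable section

namespace HypHeat

open Filter Topology Real

/-! ### Analytic continuation of ρ² and ρ / sinh ρ in the variable cosh ρ -/

section

/-- The derivatives, up to sign, of `ρ / sinh ρ` as a function of `z = cosh ρ`. -/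
def stieltjes (i : ℕ) (z : ℝ) : ℝ :=
  ∫ u in Ioi (0 : ℝ), (i.factorial : ℝ) * (2 * u) ^ i / (u ^ 2 + 2 * u * z + 1) ^ (i + 1)

theorem stieltjes_integrand_nonneg (i : ℕ) {z u : ℝ} (hz : 0 < z) (hu : 0 < u) :
    0 ≤ (i.factorial : ℝ) * (2 * u) ^ i / (u ^ 2 + 2 * u * z + 1) ^ (i + 1) := by
  positivity

/-- One factor of the denominator dominates 1 + u² and each of the other i dominates 2u. The bound
does not involve z, so it serves as the dominating function for differentiation under the integral
on all of z > 0. -/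
theorem stieltjes_integrand_le (i : ℕ) {z u : ℝ} (hz : 0 < z) (hu : 0 < u) :
    (i.factorial : ℝ) * (2 * u) ^ i / (u ^ 2 + 2 * u * z + 1) ^ (i + 1) ≤
      i.factorial * (1 + u ^ 2)⁻¹ := by
  have h1 : (2 * u) ≤ u ^ 2 + 2 * u * z + 1 := by nlinarith [sq_nonneg (u - 1), mul_pos hu hz]
  have h2 : 1 + u ^ 2 ≤ u ^ 2 + 2 * u * z + 1 := by nlinarith [mul_pos hu hz]
  rw [mul_div_assoc]
  refine mul_le_mul_of_nonneg_left ?_ (by positivity)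
  rw [div_le_iff₀ (by positivity), pow_succ, inv_mul_eq_div, le_div_iff₀ (by positivity)]
  exact mul_le_mul (pow_le_pow_left₀ (by positivity) h1 i) h2 (by positivity)
    (pow_nonneg (by linarith) i)

theorem integrableOn_stieltjes (i : ℕ) {z : ℝ} (hz : 0 < z) :
    IntegrableOn (fun u : ℝ => (i.factorial : ℝ) * (2 * u) ^ i / (u ^ 2 + 2 * u * z + 1) ^ (i + 1))
      (Ioi 0) := by
  refine Integrable.mono' (integrable_inv_one_add_sq.const_mul (i.factorial : ℝ)).integrableOn
    (Measurable.aestronglyMeasurable (by fun_prop)) ?_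
  refine (ae_restrict_iff' measurableSet_Ioi).2 (ae_of_all _ fun u hu => ?_)
  rw [norm_of_nonneg (stieltjes_integrand_nonneg i hz hu)]
  exact stieltjes_integrand_le i hz hu

theorem stieltjes_nonneg (i : ℕ) {z : ℝ} (hz : 0 < z) : 0 ≤ stieltjes i z :=
  setIntegral_nonneg measurableSet_Ioi fun _ hu => stieltjes_integrand_nonneg i hz hu

theorem stieltjes_le (i : ℕ) {z : ℝ} (hz : 0 < z) :
    stieltjes i z ≤ i.factorial * (π / 2) := by
  have := setIntegral_mono_on (integrableOn_stieltjes i hz)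
    (integrable_inv_one_add_sq.const_mul (i.factorial : ℝ)).integrableOn measurableSet_Ioi
    (fun u hu => stieltjes_integrand_le i hz hu)
  rwa [integral_const_mul, integral_Ioi_inv_one_add_sq, arctan_zero, sub_zero] at this

theorem hasDerivAt_stieltjes (i : ℕ) {z : ℝ} (hz : 0 < z) :
    HasDerivAt (stieltjes i) (-stieltjes (i + 1) z) z := by
  have key := hasDerivAt_integral_of_dominated_loc_of_deriv_le (μ := volume.restrict (Ioi (0 : ℝ)))
    (F := fun z u : ℝ => (i.factorial : ℝ) * (2 * u) ^ i / (u ^ 2 + 2 * u * z + 1) ^ (i + 1))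
    (F' := fun z u : ℝ => -(((i + 1).factorial : ℝ) * (2 * u) ^ (i + 1) /
      (u ^ 2 + 2 * u * z + 1) ^ (i + 1 + 1)))
    (x₀ := z) (s := Ioi 0) (Ioi_mem_nhds hz)
    (bound := fun u => (i + 1).factorial * (1 + u ^ 2)⁻¹)
    (Eventually.of_forall fun x => Measurable.aestronglyMeasurable (by fun_prop))
    (integrableOn_stieltjes i hz) (Measurable.aestronglyMeasurable (by fun_prop))
    ?_ (integrable_inv_one_add_sq.const_mul _).integrableOn ?_
  · have := key.2
    rwa [integral_neg] at this
  · refine (ae_restrict_iff' measurableSet_Ioi).2 (ae_of_all _ fun u hu x hx => ?_)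
    rw [norm_neg, norm_of_nonneg (stieltjes_integrand_nonneg _ hx hu)]
    exact stieltjes_integrand_le _ hx hu
  · refine (ae_restrict_iff' measurableSet_Ioi).2 (ae_of_all _ fun u hu x hx => ?_)
    have hu' : (0 : ℝ) < u := hu
    have hx' : (0 : ℝ) < x := hx
    have hQ : u ^ 2 + 2 * u * x + 1 ≠ 0 := by positivity
    have h1 : HasDerivAt (fun x : ℝ => u ^ 2 + 2 * u * x + 1) (2 * u) x := by
      simpa using (((hasDerivAt_id x).const_mul (2 * u)).const_add (u ^ 2)).add_const (1 : ℝ)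
    have h2 := (hasDerivAt_const x ((i.factorial : ℝ) * (2 * u) ^ i)).div (h1.pow (i + 1))
      (pow_ne_zero _ hQ)
    refine h2.congr_deriv ?_
    simp only [Pi.pow_apply]
    rw [Nat.factorial_succ]
    push_cast
    generalize u ^ 2 + 2 * u * x + 1 = Q at hQ
    field_simp
    ring

theorem contDiffOn_of_hasDerivAt_tower {f : ℕ → ℝ → ℝ} {s : Set ℝ} (hs : IsOpen s)
    (c : ℝ) (h : ∀ i, ∀ z ∈ s, HasDerivAt (f i) (c * f (i + 1) z) z) (i : ℕ) :
    ContDiffOn ℝ ∞ (f i) s := by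
  have key : ∀ m : ℕ, ∀ i, ContDiffOn ℝ m (f i) s := by
    intro m
    induction m with
    | zero =>
      intro i
      exact contDiffOn_zero.2 fun z hz => (h i z hz).continuousAt.continuousWithinAt
    | succ m ih =>
      intro i
      rw [show ((m + 1 : ℕ) : ℕ∞ω) = (m : ℕ∞ω) + 1 by norm_cast, contDiffOn_succ_iff_deriv_of_isOpen hs]
      refine ⟨fun z hz => (h i z hz).differentiableAt.differentiableWithinAt, by simp, ?_⟩
      exact (contDiffOn_const.mul (ih (i + 1))).congr fun z hz => (h i z hz).deriv
  exact contDiffOn_infty.2 fun m => key m i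

theorem contDiffOn_stieltjes (i : ℕ) : ContDiffOn ℝ ∞ (stieltjes i) (Ioi 0) :=
  contDiffOn_of_hasDerivAt_tower isOpen_Ioi (-1)
    (fun i z hz => by simpa using hasDerivAt_stieltjes i hz) i

/-- The combined integrand is the u-derivative of -(uz + 1) / (u² + 2uz + 1), which runs from -1 at
u = 0 to 0 at infinity. This is the first-order equation of ρ / sinh ρ in z = cosh ρ, and every
later identity for ρ² rests on it. -/
theorem stieltjes_ode {z : ℝ} (hz : 0 < z) :
    (z ^ 2 - 1) * (-stieltjes 1 z) + z * stieltjes 0 z = 1 := by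
  have hQ : ∀ u ∈ Ici (0 : ℝ), u ^ 2 + 2 * u * z + 1 ≠ 0 := fun u hu => by
    have : (0 : ℝ) ≤ u := hu
    positivity
  have i0 := integrableOn_stieltjes 0 hz
  have i1 := integrableOn_stieltjes 1 hz
  have e : (z ^ 2 - 1) * (-stieltjes 1 z) + z * stieltjes 0 z =
      ∫ u in Ioi (0 : ℝ), ((z ^ 2 - 1) * -((Nat.factorial 1 : ℝ) * (2 * u) ^ 1 /
        (u ^ 2 + 2 * u * z + 1) ^ (1 + 1)) + z * ((Nat.factorial 0 : ℝ) * (2 * u) ^ 0 /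
        (u ^ 2 + 2 * u * z + 1) ^ (0 + 1))) := by
    refine Eq.symm ((integral_add (i1.neg.const_mul _) (i0.const_mul _)).trans ?_)
    rw [integral_const_mul, integral_const_mul]
    congr 2
    exact integral_neg _
  rw [e]
  have i2 : IntegrableOn (fun u : ℝ => ((z ^ 2 - 1) * -((Nat.factorial 1 : ℝ) * (2 * u) ^ 1 /
        (u ^ 2 + 2 * u * z + 1) ^ (1 + 1)) + z * ((Nat.factorial 0 : ℝ) * (2 * u) ^ 0 /
        (u ^ 2 + 2 * u * z + 1) ^ (0 + 1)))) (Ioi 0) :=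
    (i1.neg.const_mul (z ^ 2 - 1)).add (i0.const_mul z)
  have lim : Tendsto (fun u : ℝ => -((u * z + 1) / (u ^ 2 + 2 * u * z + 1))) atTop (𝓝 0) := by
    rw [← neg_zero]
    refine Tendsto.neg ?_
    have hb : Tendsto (fun u : ℝ => (z + 1) * u⁻¹) atTop (𝓝 0) := by
      simpa using tendsto_inv_atTop_zero.const_mul (z + 1)
    refine squeeze_zero' ?_ ?_ hb
    · filter_upwards [eventually_ge_atTop 1] with u hu
      have : (0 : ℝ) < u := by linarith
      positivity
    · filter_upwards [eventually_ge_atTop 1] with u hu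
      have : (0 : ℝ) < u := by linarith
      rw [← div_eq_mul_inv, div_le_div_iff₀ (by positivity) this]
      nlinarith [mul_pos this hz, mul_pos (mul_pos this this) hz, mul_pos (mul_pos this hz) hz]
  have := integral_Ioi_of_hasDerivAt_of_tendsto' (a := 0)
    (f := fun u : ℝ => -((u * z + 1) / (u ^ 2 + 2 * u * z + 1)))
    (f' := fun u : ℝ => ((z ^ 2 - 1) * -((Nat.factorial 1 : ℝ) * (2 * u) ^ 1 /
        (u ^ 2 + 2 * u * z + 1) ^ (1 + 1)) + z * ((Nat.factorial 0 : ℝ) * (2 * u) ^ 0 /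
        (u ^ 2 + 2 * u * z + 1) ^ (0 + 1)))) (m := 0) ?_ i2 lim
  · rw [this]; norm_num
  · intro u hu
    have h1 : HasDerivAt (fun u : ℝ => u * z + 1) z u := by
      simpa using ((hasDerivAt_id u).mul_const z).add_const (1 : ℝ)
    have h2 : HasDerivAt (fun u : ℝ => u ^ 2 + 2 * u * z + 1) (2 * u + 2 * z) u := by
      have := (((hasDerivAt_id u).pow 2).add (((hasDerivAt_id u).const_mul 2).mul_const z)).add_const
        (1 : ℝ)
      simpa using this
    have h := (h1.div h2 (hQ u hu)).neg
    refine h.congr_deriv ?_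
    have := hQ u hu
    simp
    field_simp
    ring

/-- The function `ρ²` in terms of `z = cosh ρ`, continued analytically to `z > 0`. -/
def arcoshSq (z : ℝ) : ℝ := 2 * ∫ x in (1 : ℝ)..z, stieltjes 0 x

theorem arcoshSq_one : arcoshSq 1 = 0 := by simp [arcoshSq]

theorem hasDerivAt_arcoshSq {z : ℝ} (hz : 0 < z) : HasDerivAt arcoshSq (2 * stieltjes 0 z) z := by
  have hc : ContinuousOn (stieltjes 0) (Ioi 0) := (contDiffOn_stieltjes 0).continuousOn
  have hsub : uIcc 1 z ⊆ Ioi 0 := fun x hx => lt_of_lt_of_le (lt_min one_pos hz) hx.1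
  refine (intervalIntegral.integral_hasDerivAt_right ((hc.mono hsub).intervalIntegrable) ?_
    (hc.continuousAt (Ioi_mem_nhds hz))).const_mul 2
  exact hc.stronglyMeasurableAtFilter isOpen_Ioi z hz

theorem contDiffOn_arcoshSq : ContDiffOn ℝ ∞ arcoshSq (Ioi 0) := by
  rw [show (∞ : ℕ∞ω) = ∞ + 1 from rfl, contDiffOn_succ_iff_deriv_of_isOpen isOpen_Ioi]
  refine ⟨fun z hz => (hasDerivAt_arcoshSq hz).differentiableAt.differentiableWithinAt, by simp, ?_⟩
  exact (contDiffOn_const.mul (contDiffOn_stieltjes 0)).congr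
    fun z hz => (hasDerivAt_arcoshSq hz).deriv

theorem arcoshSq_monotoneOn : MonotoneOn arcoshSq (Ioi 0) := by
  refine monotoneOn_of_deriv_nonneg (convex_Ioi 0)
    (contDiffOn_arcoshSq.continuousOn) ?_ ?_
  · rw [interior_Ioi]
    exact fun z hz => (hasDerivAt_arcoshSq hz).differentiableAt.differentiableWithinAt
  · rw [interior_Ioi]
    intro z hz
    rw [(hasDerivAt_arcoshSq hz).deriv]
    have := stieltjes_nonneg 0 hz
    positivity

/-- This is ρ² = sinh² ρ · (ρ / sinh ρ)², continued to z > 0: both sides vanish at z = 1, and their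
derivatives agree by `stieltjes_ode`. -/
theorem arcoshSq_eq {z : ℝ} (hz : 0 < z) :
    (z ^ 2 - 1) * stieltjes 0 z ^ 2 = arcoshSq z := by
  have hd : ∀ x ∈ Ioi (0 : ℝ),
      HasDerivAt (fun x => (x ^ 2 - 1) * stieltjes 0 x ^ 2 - arcoshSq x) 0 x := by
    intro x hx
    have h := ((((hasDerivAt_id x).pow 2).sub_const 1).mul
      ((hasDerivAt_stieltjes 0 hx).pow 2)).sub (hasDerivAt_arcoshSq hx)
    refine h.congr_deriv ?_
    have := stieltjes_ode hx
    simp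
    linear_combination 2 * stieltjes 0 x * this
  have := isOpen_Ioi.is_const_of_deriv_eq_zero isPreconnected_Ioi
    (fun x hx => (hd x hx).differentiableAt.differentiableWithinAt)
    (fun x hx => (hd x hx).deriv) hz (one_pos : (0 : ℝ) < 1)
  simp [arcoshSq_one] at this
  linarith

/-- The equation `stieltjes_ode` integrates to `stieltjes 0 (cosh x) * sinh x = x`, so the two sides
have the same derivative in s and both vanish at 0. -/
theorem arcoshSq_cosh (s : ℝ) : arcoshSq (cosh s) = s ^ 2 := by
  have h1 : ∀ x : ℝ, HasDerivAt (fun x => stieltjes 0 (cosh x) * sinh x - x) 0 x := by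
    intro x
    have h := (((hasDerivAt_stieltjes 0 (cosh_pos x)).comp x (hasDerivAt_cosh x)).mul
      (hasDerivAt_sinh x)).sub (hasDerivAt_id x)
    refine h.congr_deriv ?_
    have := stieltjes_ode (cosh_pos x)
    rw [cosh_sq] at this
    simp
    linear_combination this
  have h1' : ∀ x : ℝ, stieltjes 0 (cosh x) * sinh x = x := by
    intro x
    have := is_const_of_deriv_eq_zero (fun x => (h1 x).differentiableAt) (fun x => (h1 x).deriv) x 0
    simp at this
    linarith
  have h2 : ∀ x : ℝ, HasDerivAt (fun x => arcoshSq (cosh x) - x ^ 2) 0 x := by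
    intro x
    have h := ((hasDerivAt_arcoshSq (cosh_pos x)).comp x (hasDerivAt_cosh x)).sub
      ((hasDerivAt_id x).pow 2)
    refine h.congr_deriv ?_
    simp
    linear_combination 2 * h1' x
  have := is_const_of_deriv_eq_zero (fun x => (h2 x).differentiableAt) (fun x => (h2 x).deriv) s 0
  simp [arcoshSq_one] at this
  linarith

theorem arcoshSq_pos {z : ℝ} (hz : 1 < z) : 0 < arcoshSq z := by
  rw [← cosh_arcosh hz.le, arcoshSq_cosh]
  have : 0 < arcosh z := arcosh_pos hz
  positivity

/-- For z < 1 the continuation of ρ² is negative, but it stays above -(`stieltjes 0 z`)², hence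
above -4. The value -10 is not sharp; only some lower bound matters, to keep the Gaussian bounded on
all of z > 0. -/
theorem neg_ten_le_arcoshSq {z : ℝ} (hz : 0 < z) : -10 ≤ arcoshSq z := by
  have h := arcoshSq_eq hz
  have h0 := stieltjes_nonneg 0 hz
  have h1 := stieltjes_le 0 hz
  simp only [Nat.factorial_zero, Nat.cast_one, one_mul] at h1
  have h2 : stieltjes 0 z ≤ 2 := by linarith [pi_lt_four]
  nlinarith [sq_nonneg (z * stieltjes 0 z)]

/-- A Gaussian in ρ beats every power of z because 1 + cosh ρ ≤ 2 e^ρ. The constant N² / (4c) is the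
maximum of Nρ - cρ², and 10c covers z ≤ 1. -/
theorem exp_neg_mul_arcoshSq_le (N : ℕ) {c z : ℝ} (hc : 0 < c) (hz : 0 < z) :
    exp (-(c * arcoshSq z)) * (1 + z) ^ N ≤ 2 ^ N * exp (10 * c + N ^ 2 / (4 * c)) := by
  rcases le_total z 1 with h | h
  · have h1 : (1 + z) ^ N ≤ 2 ^ N := by gcongr; linarith
    have h2 : exp (-(c * arcoshSq z)) ≤ exp (10 * c + N ^ 2 / (4 * c)) := by
      rw [exp_le_exp]
      have := mul_le_mul_of_nonneg_left (neg_ten_le_arcoshSq hz) hc.le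
      have : 0 ≤ (N : ℝ) ^ 2 / (4 * c) := by positivity
      linarith
    calc _ ≤ exp (10 * c + N ^ 2 / (4 * c)) * 2 ^ N := by gcongr
      _ = _ := mul_comm _ _
  · obtain ⟨s, hs, rfl⟩ : ∃ s, 0 ≤ s ∧ cosh s = z := ⟨arcosh z, arcosh_nonneg h, cosh_arcosh h⟩
    have h1 : 1 + cosh s ≤ 2 * exp s := by
      rw [cosh_eq]
      have : 1 ≤ exp s := one_le_exp hs
      have : exp (-s) ≤ 1 := exp_le_one_iff.2 (by linarith)
      linarith
    rw [arcoshSq_cosh]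
    calc exp (-(c * s ^ 2)) * (1 + cosh s) ^ N ≤ exp (-(c * s ^ 2)) * (2 * exp s) ^ N := by gcongr
      _ = 2 ^ N * exp (-(c * s ^ 2) + N * s) := by
        rw [mul_pow, ← exp_nat_mul, exp_add]; ring
      _ ≤ _ := by
        refine mul_le_mul_of_nonneg_left (exp_le_exp.2 ?_) (by positivity)
        have : 0 ≤ (2 * c * s - N) ^ 2 / (4 * c) := by positivity
        have e : (2 * c * s - N) ^ 2 / (4 * c) = c * s ^ 2 - N * s + N ^ 2 / (4 * c) := by
          field_simp; ring
        nlinarith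

end

/-! ### The odd-dimensional kernels: z-derivatives of the Gaussian of the line -/

section

/-- The domain `t > 0`, `z > 0` of the variables `(t, z)`, where `z` stands for `cosh ρ`. -/
def quadrant : Set (ℝ × ℝ) := Ioi 0 ×ˢ Ioi 0

theorem isOpen_quadrant : IsOpen quadrant := isOpen_Ioi.prod isOpen_Ioi

/-- The operator `-∂/∂z` on functions of `(t, z)`. -/
def ndz (f : ℝ × ℝ → ℝ) (p : ℝ × ℝ) : ℝ := -fderiv ℝ f p (0, 1)

section Calculus

variable {f g : ℝ × ℝ → ℝ}

theorem contDiffOn_ndz (hf : ContDiffOn ℝ ∞ f quadrant) : ContDiffOn ℝ ∞ (ndz f) quadrant :=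
  ((hf.fderiv_of_isOpen isOpen_quadrant (m := ∞) le_rfl).clm_apply contDiffOn_const).neg

theorem contDiffOn_ndz_iterate (hf : ContDiffOn ℝ ∞ f quadrant) (m : ℕ) :
    ContDiffOn ℝ ∞ (ndz^[m] f) quadrant := by
  induction m with
  | zero => exact hf
  | succ m ih => rw [Function.iterate_succ_apply']; exact contDiffOn_ndz ih

theorem differentiableAt_of_quadrant (hf : ContDiffOn ℝ ∞ f quadrant) {p : ℝ × ℝ}
    (hp : p ∈ quadrant) : DifferentiableAt ℝ f p :=
  (hf.contDiffAt (isOpen_quadrant.mem_nhds hp)).differentiableAt (by simp)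

theorem hasDerivAt_snd (hf : ContDiffOn ℝ ∞ f quadrant) {t z : ℝ} (ht : 0 < t) (hz : 0 < z) :
    HasDerivAt (fun z => f (t, z)) (-ndz f (t, z)) z := by
  have h := (differentiableAt_of_quadrant hf (p := (t, z)) ⟨ht, hz⟩).hasFDerivAt
  refine (h.comp_hasDerivAt z ((hasDerivAt_const z t).prodMk (hasDerivAt_id z))).congr_deriv ?_
  simp [ndz]

theorem hasDerivAt_fst (hf : ContDiffOn ℝ ∞ f quadrant) {t z : ℝ} (ht : 0 < t) (hz : 0 < z) :
    HasDerivAt (fun t => f (t, z)) (fderiv ℝ f (t, z) (1, 0)) t := by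
  have h := (differentiableAt_of_quadrant hf (p := (t, z)) ⟨ht, hz⟩).hasFDerivAt
  exact h.comp_hasDerivAt t ((hasDerivAt_id t).prodMk (hasDerivAt_const t z))

theorem ndz_congr (h : EqOn f g quadrant) : EqOn (ndz f) (ndz g) quadrant := fun p hp => by
  have : f =ᶠ[𝓝 p] g := h.eventuallyEq_of_mem (isOpen_quadrant.mem_nhds hp)
  simp only [ndz, this.fderiv_eq]

theorem ndz_eq_of_hasDerivAt (hf : ContDiffOn ℝ ∞ f quadrant) {t z d : ℝ} (ht : 0 < t)
    (hz : 0 < z) (h : HasDerivAt (fun z => f (t, z)) d z) : ndz f (t, z) = -d := by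
  have := (hasDerivAt_snd hf ht hz).unique h
  linarith

theorem ndz_add (hf : ContDiffOn ℝ ∞ f quadrant) (hg : ContDiffOn ℝ ∞ g quadrant) :
    EqOn (ndz (f + g)) (ndz f + ndz g) quadrant := by
  rintro ⟨t, z⟩ ⟨ht, hz⟩
  rw [ndz_eq_of_hasDerivAt (f := f + g) (hf.add hg) ht hz ((hasDerivAt_snd hf ht hz).add
    (hasDerivAt_snd hg ht hz))]
  simp [add_comm]

theorem ndz_mul (hf : ContDiffOn ℝ ∞ f quadrant) (hg : ContDiffOn ℝ ∞ g quadrant) :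
    EqOn (ndz (f * g)) (ndz f * g + f * ndz g) quadrant := by
  rintro ⟨t, z⟩ ⟨ht, hz⟩
  rw [ndz_eq_of_hasDerivAt (f := f * g) (hf.mul hg) ht hz ((hasDerivAt_snd hf ht hz).mul
    (hasDerivAt_snd hg ht hz))]
  simp [add_comm]

theorem fderiv_ndz_comm (hf : ContDiffOn ℝ ∞ f quadrant) {p : ℝ × ℝ} (hp : p ∈ quadrant) :
    fderiv ℝ (ndz f) p (1, 0) = ndz (fun q => fderiv ℝ f q (1, 0)) p := by
  have hfp := hf.contDiffAt (isOpen_quadrant.mem_nhds hp)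
  have hd : DifferentiableAt ℝ (fderiv ℝ f) p :=
    ((hf.fderiv_of_isOpen isOpen_quadrant (m := ∞) le_rfl).contDiffAt
      (isOpen_quadrant.mem_nhds hp)).differentiableAt (by simp)
  have hs : IsSymmSndFDerivAt ℝ f p := hfp.isSymmSndFDerivAt (by
    rw [minSmoothness_of_isRCLikeNormedField]; exact WithTop.coe_le_coe.2 le_top)
  have h1 : ∀ v w : ℝ × ℝ, fderiv ℝ (fun q => fderiv ℝ f q v) p w = fderiv ℝ (fderiv ℝ f) p w v := by
    intro v w
    rw [fderiv_clm_apply hd (differentiableAt_const v)]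
    simp
  have h2 : fderiv ℝ (ndz f) p (1, 0) = -fderiv ℝ (fun q => fderiv ℝ f q (0, 1)) p (1, 0) := by
    have : ndz f = -(fun q => fderiv ℝ f q (0, 1)) := rfl
    rw [this, fderiv_neg]; rfl
  rw [h2, ndz, h1, h1, hs.eq]

end Calculus

/-- The radial part of the shifted Laplacian of `ℍⁿ` in the variable `z = cosh ρ`. -/
def radialLap (n : ℝ) (f : ℝ × ℝ → ℝ) (p : ℝ × ℝ) : ℝ :=
  (p.2 ^ 2 - 1) * ndz (ndz f) p - n * p.2 * ndz f p + (n - 1) ^ 2 / 4 * f p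

theorem contDiffOn_radialLap (n : ℝ) {f : ℝ × ℝ → ℝ} (hf : ContDiffOn ℝ ∞ f quadrant) :
    ContDiffOn ℝ ∞ (radialLap n f) quadrant := by
  have h1 := contDiffOn_ndz hf
  have h2 := contDiffOn_ndz h1
  have h0 : ContDiffOn ℝ ∞ (fun p : ℝ × ℝ => p.2) quadrant := contDiffOn_snd
  exact ((((h0.pow 2).sub contDiffOn_const).mul h2).sub ((contDiffOn_const.mul h0).mul h1)).add
    (contDiffOn_const.mul hf)

/-- Differentiating the radial operator in z raises n to n + 2: the term 2z from z² - 1 changes n z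
into (n + 2) z, and the extra n completes (n-1)²/4 to (n+1)²/4. Only the shifted Laplacian has this
property. -/
theorem heat_ndz {n : ℝ} {f : ℝ × ℝ → ℝ} (hf : ContDiffOn ℝ ∞ f quadrant)
    (h : ∀ p ∈ quadrant, fderiv ℝ f p (1, 0) = radialLap n f p) :
    ∀ p ∈ quadrant, fderiv ℝ (ndz f) p (1, 0) = radialLap (n + 2) (ndz f) p := by
  intro p hp
  rw [fderiv_ndz_comm hf hp, ndz_congr (g := radialLap n f) h hp]
  obtain ⟨t, z⟩ := p
  obtain ⟨ht, hz⟩ := hp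
  have h0 := hasDerivAt_snd hf ht hz
  have h1 := hasDerivAt_snd (contDiffOn_ndz hf) ht hz
  have h2 := hasDerivAt_snd (contDiffOn_ndz (contDiffOn_ndz hf)) ht hz
  have hD := (((((hasDerivAt_id z).pow 2).sub_const 1).mul h2).sub
    (((hasDerivAt_id z).const_mul n).mul h1)).add (h0.const_mul ((n - 1) ^ 2 / 4))
  rw [ndz_eq_of_hasDerivAt (contDiffOn_radialLap n hf) ht hz hD]
  simp [radialLap]
  ring

/-- The functions `f, -∂f/∂z, …, (-∂/∂z)ᵐ f` satisfy `P`. -/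
def tower (P : (ℝ × ℝ → ℝ) → Prop) : ℕ → (ℝ × ℝ → ℝ) → Prop
  | 0, f => P f
  | m + 1, f => P f ∧ tower P m (ndz f)

section Tower

variable {P Q : (ℝ × ℝ → ℝ) → Prop} {f g : ℝ × ℝ → ℝ}

theorem tower.pred {m : ℕ} (h : tower P (m + 1) f) : tower P m f := by
  induction m generalizing f with
  | zero => exact h.1
  | succ m ih => exact ⟨h.1, ih h.2⟩

theorem tower.congr (hP : ∀ {f g}, EqOn f g quadrant → P f → P g) {m : ℕ}
    (hfg : EqOn f g quadrant) (h : tower P m f) : tower P m g := by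
  induction m generalizing f g with
  | zero => exact hP hfg h
  | succ m ih => exact ⟨hP hfg h.1, ih (ndz_congr hfg) h.2⟩

theorem tower.add (hP : ∀ {f g}, EqOn f g quadrant → P f → P g)
    (hadd : ∀ {f g}, P f → P g → P (f + g)) {m : ℕ} (hf : ContDiffOn ℝ ∞ f quadrant)
    (hg : ContDiffOn ℝ ∞ g quadrant) (h : tower P m f) (h' : tower P m g) :
    tower P m (f + g) := by
  induction m generalizing f g with
  | zero => exact hadd h h'
  | succ m ih =>
    exact ⟨hadd h.1 h'.1, (ih (contDiffOn_ndz hf) (contDiffOn_ndz hg) h.2 h'.2).congr hP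
      (ndz_add hf hg).symm⟩

/-- Leibniz rule: `Q` is a class of multipliers for `P`, and each derivative of the product is a sum
of two products for which the induction hypothesis is available. -/
theorem tower.mul (hP : ∀ {f g}, EqOn f g quadrant → P f → P g)
    (hadd : ∀ {f g}, P f → P g → P (f + g)) (hmul : ∀ {f g}, Q f → P g → P (f * g)) {m : ℕ}
    (hf : ContDiffOn ℝ ∞ f quadrant) (hg : ContDiffOn ℝ ∞ g quadrant)
    (h : tower Q m f) (h' : tower P m g) : tower P m (f * g) := by
  induction m generalizing f g with
  | zero => exact hmul h h'
  | succ m ih =>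
    refine ⟨hmul h.1 h'.1, tower.congr hP (ndz_mul hf hg).symm (tower.add hP hadd ?_ ?_ ?_ ?_)⟩
    · exact (contDiffOn_ndz hf).mul hg
    · exact hf.mul (contDiffOn_ndz hg)
    · exact ih (contDiffOn_ndz hf) hg h.2 h'.pred
    · exact ih hf (contDiffOn_ndz hg) h.pred h'.2

theorem tower.iterate {m : ℕ} (h : tower P m f) : P (ndz^[m] f) := by
  induction m generalizing f with
  | zero => exact h
  | succ m ih => exact ih h.2

end Tower

/-- Nonnegative functions bounded by a power of `1 + 1 / t`. -/
def TimeBounded (f : ℝ × ℝ → ℝ) : Prop :=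
  ∃ C : ℝ, ∃ M : ℕ, 0 ≤ C ∧ ∀ p ∈ quadrant, 0 ≤ f p ∧ f p ≤ C * (1 + 1 / p.1) ^ M

/-- Nonnegative functions bounded by a Gaussian times a power of `1 + 1 / t`. -/
def GaussBounded (f : ℝ × ℝ → ℝ) : Prop :=
  ∃ C : ℝ, ∃ M : ℕ, 0 ≤ C ∧ ∀ p ∈ quadrant,
    0 ≤ f p ∧ f p ≤ C * (1 + 1 / p.1) ^ M * exp (-(arcoshSq p.2 / (4 * p.1)))

theorem GaussBounded.congr {f g : ℝ × ℝ → ℝ} (h : EqOn f g quadrant) (hf : GaussBounded f) :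
    GaussBounded g := by
  obtain ⟨C, M, hC, H⟩ := hf
  exact ⟨C, M, hC, fun p hp => by rw [← h hp]; exact H p hp⟩

theorem GaussBounded.add {f g : ℝ × ℝ → ℝ} (hf : GaussBounded f) (hg : GaussBounded g) :
    GaussBounded (f + g) := by
  obtain ⟨C, M, hC, H⟩ := hf
  obtain ⟨C', M', hC', H'⟩ := hg
  refine ⟨C + C', max M M', by positivity, fun p hp => ⟨add_nonneg (H p hp).1 (H' p hp).1, ?_⟩⟩
  have ht : 0 < p.1 := hp.1
  have h1 : 1 ≤ 1 + 1 / p.1 := by have : 0 < 1 / p.1 := by positivity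
                                  linarith
  calc f p + g p ≤ C * (1 + 1 / p.1) ^ M * exp (-(arcoshSq p.2 / (4 * p.1))) +
        C' * (1 + 1 / p.1) ^ M' * exp (-(arcoshSq p.2 / (4 * p.1))) :=
        add_le_add (H p hp).2 (H' p hp).2
    _ ≤ C * (1 + 1 / p.1) ^ (max M M') * exp (-(arcoshSq p.2 / (4 * p.1))) +
        C' * (1 + 1 / p.1) ^ (max M M') * exp (-(arcoshSq p.2 / (4 * p.1))) := by
        gcongr
        · exact le_max_left _ _
        · exact le_max_right _ _
    _ = _ := by ring

theorem TimeBounded.mul {f g : ℝ × ℝ → ℝ} (hf : TimeBounded f) (hg : GaussBounded g) :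
    GaussBounded (f * g) := by
  obtain ⟨C, M, hC, H⟩ := hf
  obtain ⟨C', M', hC', H'⟩ := hg
  refine ⟨C * C', M + M', by positivity, fun p hp => ⟨mul_nonneg (H p hp).1 (H' p hp).1, ?_⟩⟩
  have ht : 0 < p.1 := hp.1
  calc f p * g p ≤ (C * (1 + 1 / p.1) ^ M) *
        (C' * (1 + 1 / p.1) ^ M' * exp (-(arcoshSq p.2 / (4 * p.1)))) :=
        mul_le_mul (H p hp).2 (H' p hp).2 (H' p hp).1 (by positivity)
    _ = _ := by rw [pow_add]; ring

/-- The factor `∂/∂z (ρ² / 4 t)`, and up to sign its `z`-derivatives. -/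
def expFactor (i : ℕ) (p : ℝ × ℝ) : ℝ := (2 * p.1)⁻¹ * stieltjes i p.2

theorem contDiffOn_expFactor (i : ℕ) : ContDiffOn ℝ ∞ (expFactor i) quadrant := by
  refine ContDiffOn.mul ?_ ((contDiffOn_stieltjes i).comp contDiffOn_snd fun p hp => hp.2)
  exact (contDiffOn_const.mul contDiffOn_fst).inv fun p hp => by
    have : 0 < p.1 := hp.1
    positivity

theorem ndz_expFactor (i : ℕ) : EqOn (ndz (expFactor i)) (expFactor (i + 1)) quadrant := by
  rintro ⟨t, z⟩ ⟨ht, hz⟩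
  rw [ndz_eq_of_hasDerivAt (contDiffOn_expFactor i) ht hz
    ((hasDerivAt_stieltjes i hz).const_mul (2 * t)⁻¹)]
  simp [expFactor]

theorem TimeBounded.congr {f g : ℝ × ℝ → ℝ} (h : EqOn f g quadrant) (hf : TimeBounded f) :
    TimeBounded g := by
  obtain ⟨C, M, hC, H⟩ := hf
  exact ⟨C, M, hC, fun p hp => by rw [← h hp]; exact H p hp⟩

theorem timeBounded_expFactor (i : ℕ) : TimeBounded (expFactor i) := by
  refine ⟨i.factorial * (π / 2), 1, by positivity, fun p hp => ?_⟩
  have ht : 0 < p.1 := hp.1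
  have h0 := stieltjes_nonneg i hp.2
  refine ⟨mul_nonneg (by positivity) h0, ?_⟩
  rw [expFactor, mul_comm]
  refine mul_le_mul (stieltjes_le i hp.2) ?_ (by positivity) (by positivity)
  rw [pow_one, mul_inv, one_div]
  have : 0 < p.1⁻¹ := by positivity
  linarith

theorem tower_expFactor (m i : ℕ) : tower TimeBounded m (expFactor i) := by
  induction m generalizing i with
  | zero => exact timeBounded_expFactor i
  | succ m ih =>
    exact ⟨timeBounded_expFactor i, (ih (i + 1)).congr TimeBounded.congr (ndz_expFactor i).symm⟩

/-- The heat kernel of the line. -/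
def lineKernel (p : ℝ × ℝ) : ℝ := (√(4 * π * p.1))⁻¹ * exp (-(arcoshSq p.2 / (4 * p.1)))

theorem contDiffOn_lineKernel : ContDiffOn ℝ ∞ lineKernel quadrant := by
  have h4 : ∀ p ∈ quadrant, 4 * π * p.1 ≠ 0 := fun p hp => by
    have : 0 < p.1 := hp.1
    positivity
  refine ContDiffOn.mul ?_ (ContDiffOn.exp (ContDiffOn.neg (ContDiffOn.div ?_ ?_ ?_)))
  · refine ContDiffOn.inv ((contDiffOn_const.mul contDiffOn_fst).sqrt h4) fun p hp => ?_
    have : 0 < p.1 := hp.1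
    positivity
  · exact contDiffOn_arcoshSq.comp contDiffOn_snd fun p hp => hp.2
  · exact contDiffOn_const.mul contDiffOn_fst
  · intro p hp
    have : 0 < p.1 := hp.1
    positivity

theorem ndz_lineKernel : EqOn (ndz lineKernel) (expFactor 0 * lineKernel) quadrant := by
  rintro ⟨t, z⟩ ⟨ht, hz⟩
  have ht' : t ≠ 0 := ne_of_gt ht
  have h := (((hasDerivAt_arcoshSq hz).div_const (4 * t)).neg.exp).const_mul (√(4 * π * t))⁻¹
  rw [ndz_eq_of_hasDerivAt contDiffOn_lineKernel ht hz h]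
  simp [expFactor, lineKernel]
  ring

theorem gaussBounded_lineKernel : GaussBounded lineKernel := by
  refine ⟨1, 1, zero_le_one, fun p hp => ?_⟩
  have ht : 0 < p.1 := hp.1
  refine ⟨by unfold lineKernel; positivity, ?_⟩
  refine mul_le_mul_of_nonneg_right ?_ (exp_pos _).le
  rw [one_mul, pow_one]
  rw [inv_le_iff_one_le_mul₀ (by positivity)]
  have h1 : √p.1 ≤ √(4 * π * p.1) := by
    apply sqrt_le_sqrt
    nlinarith [pi_gt_three]
  have h2 : 1 ≤ (1 + 1 / p.1) * √p.1 := by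
    have h3 : 0 < √p.1 := by positivity
    have h4 : √p.1 * √p.1 = p.1 := mul_self_sqrt ht.le
    have h5 : (1 + 1 / p.1) * √p.1 = √p.1 + 1 / √p.1 := by
      have h6 : 1 / p.1 * √p.1 = 1 / √p.1 := by
        rw [div_mul_eq_mul_div, div_eq_div_iff ht.ne' h3.ne', one_mul, one_mul, h4]
      rw [add_mul, one_mul, h6]
    rw [h5, ← sub_nonneg]
    have : √p.1 + 1 / √p.1 - 1 = ((√p.1 - 1 / 2) ^ 2 + 3 / 4) / √p.1 := by
      field_simp; ring
    rw [this]
    positivity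
  calc 1 ≤ (1 + 1 / p.1) * √p.1 := h2
    _ ≤ _ := by gcongr

/-- Every -∂/∂z brings down a factor from the family `expFactor`, with a positive sign throughout.
Nonnegativity and the Gaussian bound of all derivatives are therefore obtained together. -/
theorem tower_lineKernel (m : ℕ) : tower GaussBounded m lineKernel := by
  induction m with
  | zero => exact gaussBounded_lineKernel
  | succ m ih =>
    refine ⟨gaussBounded_lineKernel, tower.congr GaussBounded.congr ndz_lineKernel.symm ?_⟩
    exact tower.mul GaussBounded.congr GaussBounded.add TimeBounded.mul (contDiffOn_expFactor 0)
      contDiffOn_lineKernel (tower_expFactor m 0) ih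

/-- For z > 1 this is the ordinary heat equation in ρ. Written in z it reduces to `stieltjes_ode`
and `arcoshSq_eq`, and so it holds across z = 1 too. -/
theorem heat_lineKernel : ∀ p ∈ quadrant,
    fderiv ℝ lineKernel p (1, 0) = radialLap 1 lineKernel p := by
  rintro ⟨t, z⟩ ⟨ht, hz⟩
  have ht0 : 0 < t := ht
  have hz0 : 0 < z := hz
  have ht' : t ≠ 0 := ne_of_gt ht
  have h1 := ndz_lineKernel ⟨ht, hz⟩
  have h2 : ndz (ndz lineKernel) (t, z) =
      expFactor 1 (t, z) * lineKernel (t, z) + expFactor 0 (t, z) ^ 2 * lineKernel (t, z) := by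
    rw [ndz_congr ndz_lineKernel ⟨ht, hz⟩, ndz_mul (contDiffOn_expFactor 0) contDiffOn_lineKernel
      ⟨ht, hz⟩]
    simp only [Pi.add_apply, Pi.mul_apply]
    rw [h1, ndz_expFactor 0 ⟨ht, hz⟩]
    simp only [Pi.mul_apply, zero_add]
    ring
  have hs : HasDerivAt (fun t => (√(4 * π * t))⁻¹) (-(1 / (2 * t)) * (√(4 * π * t))⁻¹) t := by
    have := (((hasDerivAt_id t).const_mul (4 * π)).sqrt (by simp; positivity)).inv
      (by simp; positivity)
    refine this.congr_deriv ?_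
    have h4 : √(4 * π * t) ^ 2 = 4 * π * t := sq_sqrt (by positivity)
    have h5 : √(4 * π * t) ≠ 0 := by positivity
    simp only [id, mul_one]
    rw [h4]
    field_simp
  have he : HasDerivAt (fun t => exp (-(arcoshSq z / (4 * t))))
      (exp (-(arcoshSq z / (4 * t))) * (arcoshSq z / (4 * t ^ 2))) t := by
    have := (((hasDerivAt_const t (arcoshSq z)).div ((hasDerivAt_id t).const_mul 4)
      (by simpa using ht')).neg).exp
    refine this.congr_deriv ?_
    simp
    field_simp
  rw [(hasDerivAt_fst contDiffOn_lineKernel ht hz).unique (hs.mul he), radialLap, h2, h1]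
  have o := stieltjes_ode hz0
  have q := arcoshSq_eq hz0
  simp only [expFactor, lineKernel, Pi.mul_apply]
  rw [← q]
  field_simp
  linear_combination (8 * t) * o

/-- The function `K_{2m+1}(t, ρ)` in terms of `t` and `z = cosh ρ`. -/
def oddKernel (m : ℕ) (p : ℝ × ℝ) : ℝ := (1 / (2 * π)) ^ m * ndz^[m] lineKernel p

theorem hasDerivAt_oddKernel (m : ℕ) {t z : ℝ} (ht : 0 < t) (hz : 0 < z) :
    HasDerivAt (fun z => oddKernel m (t, z)) (-(2 * π) * oddKernel (m + 1) (t, z)) z := by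
  have h := (hasDerivAt_snd (contDiffOn_ndz_iterate contDiffOn_lineKernel m) ht hz).const_mul
    ((1 / (2 * π)) ^ m)
  refine h.congr_deriv ?_
  rw [oddKernel, Function.iterate_succ_apply', pow_succ]
  field_simp

theorem gaussBounded_oddKernel (m : ℕ) : GaussBounded (oddKernel m) := by
  obtain ⟨C, M, hC, H⟩ := (tower_lineKernel m).iterate
  refine ⟨(1 / (2 * π)) ^ m * C, M, by positivity, fun p hp => ?_⟩
  refine ⟨mul_nonneg (by positivity) (H p hp).1, ?_⟩
  rw [mul_assoc, mul_assoc, oddKernel, ← mul_assoc C]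
  exact mul_le_mul_of_nonneg_left (H p hp).2 (by positivity)

theorem heat_ndz_iterate_lineKernel (m : ℕ) : ∀ p ∈ quadrant,
    fderiv ℝ (ndz^[m] lineKernel) p (1, 0) = radialLap (2 * m + 1) (ndz^[m] lineKernel) p := by
  induction m with
  | zero => simpa using heat_lineKernel
  | succ m ih =>
    intro p hp
    have := heat_ndz (contDiffOn_ndz_iterate contDiffOn_lineKernel m) ih p hp
    rw [Function.iterate_succ_apply', this]
    congr 1
    push_cast
    ring

theorem heat_oddKernel (m : ℕ) {t z : ℝ} (ht : 0 < t) (hz : 0 < z) :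
    HasDerivAt (fun t => oddKernel m (t, z))
      ((2 * π) ^ 2 * (z ^ 2 - 1) * oddKernel (m + 2) (t, z)
        - 2 * π * (2 * m + 1) * z * oddKernel (m + 1) (t, z)
        + ((2 * m + 1) - 1) ^ 2 / 4 * oddKernel m (t, z)) t := by
  have h := (hasDerivAt_fst (contDiffOn_ndz_iterate contDiffOn_lineKernel m) ht hz).const_mul
    ((1 / (2 * π)) ^ m)
  refine h.congr_deriv ?_
  rw [heat_ndz_iterate_lineKernel m (t, z) ⟨ht, hz⟩]
  simp only [radialLap, oddKernel, Function.iterate_succ_apply', pow_succ]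
  field_simp

theorem oddKernel_zero_cosh (t s : ℝ) :
    oddKernel 0 (t, cosh s) = (√(4 * π * t))⁻¹ * exp (-(s ^ 2 / (4 * t))) := by
  simp [oddKernel, lineKernel, arcoshSq_cosh]

end

/-! ### Abel transform, heat towers, and the kernels in every dimension -/

section

/-- A sequence of functions of `(t, z)` in which each term is `-1/(2π) ∂/∂z` of the preceding one,
the `m`-th of which solves the radial heat equation in dimension `ν + 2m`. -/
structure HeatTower (ν : ℝ) (f : ℕ → ℝ → ℝ → ℝ) : Prop where
  deriv_z : ∀ m {t z}, 0 < t → 0 < z → HasDerivAt (f m t) (-(2 * π) * f (m + 1) t z) z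
  nonneg : ∀ m {t z}, 0 < t → 0 < z → 0 ≤ f m t z
  decay : ∀ m (N : ℕ) {a b}, 0 < a → ∃ C, 0 ≤ C ∧ ∀ t ∈ Icc a b, ∀ z, 0 < z →
    f m t z ≤ C * ((1 + z) ^ N)⁻¹
  heat : ∀ m {t z}, 0 < t → 0 < z → HasDerivAt (fun t => f m t z)
    ((2 * π) ^ 2 * (z ^ 2 - 1) * f (m + 2) t z - 2 * π * (ν + 2 * m) * z * f (m + 1) t z
      + (ν + 2 * m - 1) ^ 2 / 4 * f m t z) t

/-- The Abel transform in the variable `z`. -/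
def abel (f : ℝ → ℝ → ℝ) (t z : ℝ) : ℝ := ∫ u : ℝ, f t (z + u ^ 2 / 2)

theorem heatTower_oddKernel : HeatTower 1 (fun m t z => oddKernel m (t, z)) where
  deriv_z m _ _ ht hz := hasDerivAt_oddKernel m ht hz
  nonneg m t z ht hz := by
    obtain ⟨C, M, -, H⟩ := gaussBounded_oddKernel m
    exact (H (t, z) ⟨ht, hz⟩).1
  decay m N a b ha := by
    obtain ⟨C, M, hC, H⟩ := gaussBounded_oddKernel m
    -- `exp_neg_mul_arcoshSq_le` is applied with c = 1 / (4t): then 10c ≤ 10 / (4a) and N² / (4c) =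
    -- N² t ≤ N² b on [a, b].
    refine ⟨C * (1 + 1 / a) ^ M * (2 ^ N * exp (10 / (4 * a) + N ^ 2 * b)), by positivity, ?_⟩
    rintro t ⟨hat, htb⟩ z hz
    have ht : 0 < t := ha.trans_le hat
    rw [← div_eq_mul_inv, le_div_iff₀ (by positivity)]
    refine (mul_le_mul_of_nonneg_right (H (t, z) ⟨ht, hz⟩).2 (by positivity)).trans ?_
    rw [mul_assoc]
    have h1 := exp_neg_mul_arcoshSq_le N (c := 1 / (4 * t)) (by positivity) hz
    have h2 : exp (10 * (1 / (4 * t)) + N ^ 2 / (4 * (1 / (4 * t)))) ≤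
        exp (10 / (4 * a) + N ^ 2 * b) := by
      rw [exp_le_exp]
      refine add_le_add ?_ ?_
      · rw [mul_one_div]; gcongr
      · have : (N : ℝ) ^ 2 / (4 * (1 / (4 * t))) = N ^ 2 * t := by field_simp
        rw [this]; gcongr
    have h3 : exp (-(arcoshSq z / (4 * t))) = exp (-(1 / (4 * t) * arcoshSq z)) := by
      congr 1; ring
    rw [h3]
    refine mul_le_mul ?_ (h1.trans (mul_le_mul_of_nonneg_left h2 (by positivity)))
      (by positivity) (by positivity)
    simp only
    gcongr
  heat m t z ht hz := by
    refine (heat_oddKernel m ht hz).congr_deriv ?_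
    ring

theorem HeatTower.shift {ν : ℝ} {f : ℕ → ℝ → ℝ → ℝ} (h : HeatTower ν f) :
    HeatTower (ν + 2) (fun m => f (m + 1)) where
  deriv_z m _ _ ht hz := h.deriv_z (m + 1) ht hz
  nonneg m _ _ ht hz := h.nonneg (m + 1) ht hz
  decay m := h.decay (m + 1)
  heat m t z ht hz := by
    refine (h.heat (m + 1) ht hz).congr_deriv ?_
    push_cast
    ring

section Abel

variable {ν : ℝ} {f : ℕ → ℝ → ℝ → ℝ}

theorem HeatTower.continuousOn (h : HeatTower ν f) (m : ℕ) {t : ℝ} (ht : 0 < t) :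
    ContinuousOn (f m t) (Ioi 0) :=
  fun _ hz => (h.deriv_z m ht hz).continuousAt.continuousWithinAt

theorem add_sq_pos {z : ℝ} (hz : 0 < z) (u : ℝ) : 0 < z + u ^ 2 / 2 := by positivity

theorem HeatTower.continuous_shift (h : HeatTower ν f) (m : ℕ) {t z : ℝ} (ht : 0 < t)
    (hz : 0 < z) : Continuous fun u : ℝ => f m t (z + u ^ 2 / 2) :=
  (h.continuousOn m ht).comp_continuous (by fun_prop) fun u => add_sq_pos hz u

/-- One power of decay in z is traded for an integrable weight in u. The Abel transform thus costs
one power, which is harmless since heat towers decay to every order. -/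
theorem inv_shift_pow_le (N : ℕ) {z : ℝ} (hz : 0 < z) (u : ℝ) :
    ((1 + (z + u ^ 2 / 2)) ^ (N + 1))⁻¹ ≤ ((1 + z) ^ N)⁻¹ * (2 * (1 + u ^ 2)⁻¹) := by
  have h2 : 2 * (1 + u ^ 2)⁻¹ = ((1 + u ^ 2) / 2)⁻¹ := by rw [inv_div]; ring
  rw [pow_succ, mul_inv, h2]
  gcongr
  · nlinarith [sq_nonneg u]
  · nlinarith [sq_nonneg u]

theorem inv_shift_pow_le' (N : ℕ) {z : ℝ} (hz : 0 < z) (u : ℝ) :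
    ((1 + (z + u ^ 2 / 2)) ^ N)⁻¹ ≤ 2 ^ N * ((1 + u ^ 2) ^ N)⁻¹ := by
  have h2 : (2 : ℝ) ^ N * ((1 + u ^ 2) ^ N)⁻¹ = (((1 + u ^ 2) / 2) ^ N)⁻¹ := by
    rw [div_pow, inv_div]; ring
  rw [h2]
  gcongr
  nlinarith [sq_nonneg u]

theorem HeatTower.integrable_pow_mul (h : HeatTower ν f) (m j : ℕ) {t z : ℝ} (ht : 0 < t)
    (hz : 0 < z) : Integrable fun u : ℝ => u ^ j * f m t (z + u ^ 2 / 2) := by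
  obtain ⟨C, hC, H⟩ := h.decay m (j + 1) (b := t) ht
  refine Integrable.mono' (integrable_inv_one_add_sq.const_mul (C * 2 ^ (j + 1)))
    ((continuous_pow j).mul (h.continuous_shift m ht hz)).aestronglyMeasurable
    (ae_of_all _ fun u => ?_)
  have hp := add_sq_pos hz u
  have hu : |u| ≤ 1 + u ^ 2 := by rw [← sq_abs]; nlinarith [sq_nonneg (|u| - 1), abs_nonneg u]
  rw [norm_mul, norm_pow, norm_eq_abs, norm_of_nonneg (h.nonneg m ht hp)]
  calc |u| ^ j * f m t (z + u ^ 2 / 2)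
      ≤ (1 + u ^ 2) ^ j * (C * (2 ^ (j + 1) * ((1 + u ^ 2) ^ (j + 1))⁻¹)) := by
        refine mul_le_mul (pow_le_pow_left₀ (abs_nonneg u) hu j) ?_ (h.nonneg m ht hp)
          (by positivity)
        exact (H t ⟨le_rfl, le_rfl⟩ _ hp).trans
          (mul_le_mul_of_nonneg_left (inv_shift_pow_le' (j + 1) hz u) hC)
    _ = C * 2 ^ (j + 1) * (1 + u ^ 2)⁻¹ := by
        have : (1 + u ^ 2) ≠ 0 := by positivity
        rw [pow_succ (1 + u ^ 2)]
        field_simp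

theorem HeatTower.integrable_shift (h : HeatTower ν f) (m : ℕ) {t z : ℝ} (ht : 0 < t)
    (hz : 0 < z) : Integrable fun u : ℝ => f m t (z + u ^ 2 / 2) := by
  simpa using h.integrable_pow_mul m 0 ht hz

theorem HeatTower.abel_deriv_z (h : HeatTower ν f) (m : ℕ) {t z : ℝ} (ht : 0 < t) (hz : 0 < z) :
    HasDerivAt (abel (f m) t) (-(2 * π) * abel (f (m + 1)) t z) z := by
  obtain ⟨C, hC, H⟩ := h.decay (m + 1) (0 + 1) (b := t) ht
  have key := hasDerivAt_integral_of_dominated_loc_of_deriv_le (μ := volume)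
    (F := fun z u : ℝ => f m t (z + u ^ 2 / 2))
    (F' := fun z u : ℝ => -(2 * π) * f (m + 1) t (z + u ^ 2 / 2))
    (x₀ := z) (s := Ioi 0) (Ioi_mem_nhds hz)
    (bound := fun u => 2 * π * C * (2 * (1 + u ^ 2)⁻¹))
    ?_ (h.integrable_shift m ht hz)
    ((h.continuous_shift (m + 1) ht hz).const_smul (-(2 * π))).aestronglyMeasurable
    ?_ ((integrable_inv_one_add_sq.const_mul _).const_mul _) ?_
  · have := key.2
    rwa [integral_const_mul] at this
  · filter_upwards [Ioi_mem_nhds hz] with x hx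
    exact (h.continuous_shift m ht hx).aestronglyMeasurable
  · refine ae_of_all _ fun u x hx => ?_
    have hp := add_sq_pos hx u
    rw [norm_mul, norm_neg, norm_of_nonneg (by positivity : 0 ≤ 2 * π),
      norm_of_nonneg (h.nonneg (m + 1) ht hp), mul_assoc (2 * π)]
    refine mul_le_mul_of_nonneg_left ?_ (by positivity)
    refine (H t ⟨le_rfl, le_rfl⟩ _ hp).trans ?_
    gcongr
    simpa using inv_shift_pow_le 0 hx u
  · refine ae_of_all _ fun u x hx => ?_
    exact (h.deriv_z m ht (add_sq_pos hx u)).comp_add_const x (u ^ 2 / 2)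

theorem HeatTower.abel_nonneg (h : HeatTower ν f) (m : ℕ) {t z : ℝ} (ht : 0 < t) (hz : 0 < z) :
    0 ≤ abel (f m) t z :=
  integral_nonneg fun u => h.nonneg m ht (add_sq_pos hz u)

theorem HeatTower.abel_decay (h : HeatTower ν f) (m N : ℕ) {a b : ℝ} (ha : 0 < a) :
    ∃ C, 0 ≤ C ∧ ∀ t ∈ Icc a b, ∀ z, 0 < z → abel (f m) t z ≤ C * ((1 + z) ^ N)⁻¹ := by
  obtain ⟨C, hC, H⟩ := h.decay m (N + 1) (b := b) ha
  refine ⟨C * (2 * π), by positivity, fun t ht z hz => ?_⟩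
  have ht0 : 0 < t := ha.trans_le ht.1
  have hi := ((integrable_inv_one_add_sq).const_mul 2).const_mul (C * ((1 + z) ^ N)⁻¹)
  have := integral_mono (h.integrable_shift m ht0 hz) hi fun u =>
    (H t ht _ (add_sq_pos hz u)).trans
      ((mul_le_mul_of_nonneg_left (inv_shift_pow_le N hz u) hC).trans_eq (mul_assoc _ _ _).symm)
  refine this.trans_eq ?_
  rw [integral_const_mul, integral_const_mul, integral_univ_inv_one_add_sq]
  ring

theorem HeatTower.heat_bound (h : HeatTower ν f) (m : ℕ) {a b : ℝ} (ha : 0 < a) (N : ℕ) :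
    ∃ C, 0 ≤ C ∧ ∀ t ∈ Icc a b, ∀ z, 0 < z →
      |(2 * π) ^ 2 * (z ^ 2 - 1) * f (m + 2) t z - 2 * π * (ν + 2 * m) * z * f (m + 1) t z
        + (ν + 2 * m - 1) ^ 2 / 4 * f m t z| ≤ C * ((1 + z) ^ N)⁻¹ := by
  obtain ⟨C₂, h₂, H₂⟩ := h.decay (m + 2) (N + 2) (b := b) ha
  obtain ⟨C₁, h₁, H₁⟩ := h.decay (m + 1) (N + 1) (b := b) ha
  obtain ⟨C₀, h₀, H₀⟩ := h.decay m N (b := b) ha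
  refine ⟨(2 * π) ^ 2 * C₂ + 2 * π * |ν + 2 * m| * C₁ + (ν + 2 * m - 1) ^ 2 / 4 * C₀,
    by positivity, fun t ht z hz => ?_⟩
  have ht0 : 0 < t := ha.trans_le ht.1
  have n₂ := h.nonneg (m + 2) ht0 hz
  have n₁ := h.nonneg (m + 1) ht0 hz
  have n₀ := h.nonneg m ht0 hz
  have e₂ : |z ^ 2 - 1| ≤ (1 + z) ^ 2 := by rw [abs_le]; constructor <;> nlinarith
  have e₁ : |z| ≤ 1 + z := by rw [abs_of_pos hz]; linarith
  have p : 0 < 1 + z := by linarith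
  have b₂ : |(2 * π) ^ 2 * (z ^ 2 - 1) * f (m + 2) t z| ≤ (2 * π) ^ 2 * C₂ * ((1 + z) ^ N)⁻¹ := by
    rw [abs_mul, abs_mul, abs_of_nonneg n₂, abs_of_nonneg (by positivity : 0 ≤ (2 * π) ^ 2)]
    calc _ ≤ (2 * π) ^ 2 * (1 + z) ^ 2 * (C₂ * ((1 + z) ^ (N + 2))⁻¹) := by
          gcongr; exact H₂ t ht z hz
      _ = _ := by rw [pow_add]; field_simp
  have b₁ : |2 * π * (ν + 2 * m) * z * f (m + 1) t z| ≤
      2 * π * |ν + 2 * m| * C₁ * ((1 + z) ^ N)⁻¹ := by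
    rw [abs_mul, abs_mul, abs_mul, abs_of_nonneg n₁, abs_of_nonneg (by positivity : 0 ≤ 2 * π)]
    calc _ ≤ 2 * π * |ν + 2 * m| * (1 + z) * (C₁ * ((1 + z) ^ (N + 1))⁻¹) := by
          gcongr; exact H₁ t ht z hz
      _ = _ := by rw [pow_add]; field_simp
  have b₀ : |(ν + 2 * m - 1) ^ 2 / 4 * f m t z| ≤
      (ν + 2 * m - 1) ^ 2 / 4 * C₀ * ((1 + z) ^ N)⁻¹ := by
    rw [abs_of_nonneg (by positivity), mul_assoc]
    gcongr
    exact H₀ t ht z hz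
  calc _ ≤ _ := (abs_add_le _ _).trans (add_le_add_left (abs_sub _ _) _)
    _ ≤ _ := add_le_add (add_le_add b₂ b₁) b₀
    _ = _ := by ring

/-- The operator of the higher dimension, evaluated at z + u²/2, differs from the operator of the
lower dimension with coefficients taken at z by a total u-derivative, which integrates to zero. -/
theorem HeatTower.abel_heat (h : HeatTower (ν + 1) f) (m : ℕ) {t z : ℝ} (ht : 0 < t)
    (hz : 0 < z) : HasDerivAt (fun t => abel (f m) t z)
      ((2 * π) ^ 2 * (z ^ 2 - 1) * abel (f (m + 2)) t z
        - 2 * π * (ν + 2 * m) * z * abel (f (m + 1)) t z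
        + (ν + 2 * m - 1) ^ 2 / 4 * abel (f m) t z) t := by
  obtain ⟨C, hC, H⟩ := h.heat_bound m (a := t / 2) (b := 2 * t) (by positivity) (0 + 1)
  have hcont : Continuous fun u : ℝ => (2 * π) ^ 2 * ((z + u ^ 2 / 2) ^ 2 - 1) *
      f (m + 2) t (z + u ^ 2 / 2) - 2 * π * (ν + 1 + 2 * m) * (z + u ^ 2 / 2) *
        f (m + 1) t (z + u ^ 2 / 2)
      + (ν + 1 + 2 * m - 1) ^ 2 / 4 * f m t (z + u ^ 2 / 2) := by
    have := h.continuous_shift m ht hz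
    have := h.continuous_shift (m + 1) ht hz
    have := h.continuous_shift (m + 2) ht hz
    refine ((Continuous.mul (by fun_prop) ‹_›).sub (Continuous.mul (by fun_prop) ?_)).add
      (Continuous.mul (by fun_prop) ?_) <;> assumption
  have key := hasDerivAt_integral_of_dominated_loc_of_deriv_le (μ := volume)
    (F := fun t u : ℝ => f m t (z + u ^ 2 / 2))
    (F' := fun t u : ℝ => (2 * π) ^ 2 * ((z + u ^ 2 / 2) ^ 2 - 1) *
      f (m + 2) t (z + u ^ 2 / 2) - 2 * π * (ν + 1 + 2 * m) * (z + u ^ 2 / 2) *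
        f (m + 1) t (z + u ^ 2 / 2)
      + (ν + 1 + 2 * m - 1) ^ 2 / 4 * f m t (z + u ^ 2 / 2))
    (x₀ := t) (s := Icc (t / 2) (2 * t)) (Icc_mem_nhds (by linarith) (by linarith))
    (bound := fun u => C * (2 * (1 + u ^ 2)⁻¹))
    ?_ (h.integrable_shift m ht hz) hcont.aestronglyMeasurable
    ?_ ((integrable_inv_one_add_sq.const_mul _).const_mul _) ?_
  · refine key.2.congr_deriv ?_
    have i0 := h.integrable_shift m ht hz
    have i1 := h.integrable_shift (m + 1) ht hz
    have i2 := h.integrable_shift (m + 2) ht hz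
    -- Since d/du f(z + u²/2) = u f', the integrand is the derivative of (zu + u³/4) ∂_z f + ((2a -
    -- 1)/4) u f with a = ν + 2m; the number (2a - 1)/4 is a²/4 - (a-1)²/4, the change in the
    -- spectral shift.
    have hΦ : ∫ u : ℝ, ((2 * π) ^ 2 * (z * u ^ 2 + u ^ 4 / 4) * f (m + 2) t (z + u ^ 2 / 2)
        - 2 * π * (z + (ν + 2 * m + 1) * u ^ 2 / 2) * f (m + 1) t (z + u ^ 2 / 2)
        + (2 * (ν + 2 * m) - 1) / 4 * f m t (z + u ^ 2 / 2)) = 0 := by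
      refine integral_eq_zero_of_hasDerivAt_of_integrable
        (f := fun u : ℝ => -(2 * π) * (z * u + u ^ 3 / 4) * f (m + 1) t (z + u ^ 2 / 2)
          + (2 * (ν + 2 * m) - 1) / 4 * u * f m t (z + u ^ 2 / 2)) (fun u => ?_) ?_ ?_
      · have hp := add_sq_pos hz u
        have hin : HasDerivAt (fun u : ℝ => z + u ^ 2 / 2) u u := by
          have := (((hasDerivAt_id u).pow 2).div_const 2).const_add z
          refine this.congr_deriv ?_
          simp
        have h1 := (h.deriv_z (m + 1) ht hp).comp u hin
        have h0 := (h.deriv_z m ht hp).comp u hin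
        have hpoly : HasDerivAt (fun u : ℝ => -(2 * π) * (z * u + u ^ 3 / 4))
            (-(2 * π) * (z + 3 * u ^ 2 / 4)) u := by
          have := ((((hasDerivAt_id u).const_mul z).add
            (((hasDerivAt_id u).pow 3).div_const 4))).const_mul (-(2 * π))
          refine this.congr_deriv ?_
          simp
        have := (hpoly.mul h1).add
          (((hasDerivAt_id u).const_mul ((2 * (ν + 2 * m) - 1) / 4)).mul h0)
        refine this.congr_deriv ?_
        simp only [Function.comp, id]
        ring
      · have j2 := (h.integrable_pow_mul (m + 2) 2 ht hz).const_mul ((2 * π) ^ 2 * z)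
        have j4 := (h.integrable_pow_mul (m + 2) 4 ht hz).const_mul ((2 * π) ^ 2 / 4)
        have l0 := i1.const_mul (-(2 * π) * z)
        have l2 := (h.integrable_pow_mul (m + 1) 2 ht hz).const_mul
          (-(2 * π) * (ν + 2 * m + 1) / 2)
        have o := i0.const_mul ((2 * (ν + 2 * m) - 1) / 4)
        refine ((((j2.add j4).add l0).add l2).add o).congr (ae_of_all _ fun u => ?_)
        simp only [Pi.add_apply]
        ring
      · have l1 := (h.integrable_pow_mul (m + 1) 1 ht hz).const_mul (-(2 * π) * z)
        have l3 := (h.integrable_pow_mul (m + 1) 3 ht hz).const_mul (-(2 * π) / 4)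
        have o := (h.integrable_pow_mul m 1 ht hz).const_mul ((2 * (ν + 2 * m) - 1) / 4)
        refine ((l1.add l3).add o).congr (ae_of_all _ fun u => ?_)
        simp only [Pi.add_apply]
        ring
    have hE : ∫ u : ℝ, ((2 * π) ^ 2 * (z ^ 2 - 1) * f (m + 2) t (z + u ^ 2 / 2)
        - 2 * π * (ν + 2 * m) * z * f (m + 1) t (z + u ^ 2 / 2)
        + (ν + 2 * m - 1) ^ 2 / 4 * f m t (z + u ^ 2 / 2)) =
        (2 * π) ^ 2 * (z ^ 2 - 1) * abel (f (m + 2)) t z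
        - 2 * π * (ν + 2 * m) * z * abel (f (m + 1)) t z
        + (ν + 2 * m - 1) ^ 2 / 4 * abel (f m) t z := by
      refine (integral_add ((i2.const_mul _).sub (i1.const_mul _)) (i0.const_mul _)).trans ?_
      rw [integral_const_mul]
      congr 1
      refine (integral_sub (i2.const_mul _) (i1.const_mul _)).trans ?_
      rw [integral_const_mul, integral_const_mul]
      rfl
    rw [← hE, ← sub_eq_zero]
    refine ((integral_sub key.1
      (((i2.const_mul _).sub (i1.const_mul _)).add (i0.const_mul _))).symm).trans ?_
    rw [← hΦ]
    refine integral_congr_ae (ae_of_all _ fun u => ?_)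
    simp only [Pi.add_apply, Pi.sub_apply]
    ring
  · filter_upwards [Ioi_mem_nhds ht] with x hx
    exact (h.continuous_shift m hx hz).aestronglyMeasurable
  · refine ae_of_all _ fun u x hx => ?_
    refine (H x hx _ (add_sq_pos hz u)).trans ?_
    gcongr
    simpa using inv_shift_pow_le 0 hz u
  · refine ae_of_all _ fun u x hx => ?_
    exact h.heat m (lt_of_lt_of_le (by positivity) hx.1) (add_sq_pos hz u)

theorem HeatTower.abel (h : HeatTower (ν + 1) f) : HeatTower ν (fun m => abel (f m)) where
  deriv_z m _ _ ht hz := h.abel_deriv_z m ht hz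
  nonneg m _ _ ht hz := h.abel_nonneg m ht hz
  decay m N _ _ ha := h.abel_decay m N ha
  heat m _ _ ht hz := h.abel_heat m ht hz

theorem HeatTower.tendsto_zero (h : HeatTower ν f) (m : ℕ) {t : ℝ} (ht : 0 < t) :
    Tendsto (f m t) atTop (𝓝 0) := by
  obtain ⟨C, hC, H⟩ := h.decay m 1 (b := t) ht
  have hb : Tendsto (fun z : ℝ => C * ((1 + z) ^ 1)⁻¹) atTop (𝓝 0) := by
    simpa using (tendsto_inv_atTop_zero.comp
      (tendsto_atTop_add_const_left atTop (1 : ℝ) tendsto_id)).const_mul C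
  refine squeeze_zero' ?_ ?_ hb
  · filter_upwards [eventually_gt_atTop 0] with z hz using h.nonneg m ht hz
  · filter_upwards [eventually_gt_atTop 0] with z hz using H t ⟨le_rfl, le_rfl⟩ z hz

/-- The double transform is an integral over the plane of a radial function. Polar coordinates give
2π ∫ r f_{m+1}(z + r²/2) dr, whose integrand is the exact derivative of -f_m(z + r²/2). -/
theorem HeatTower.abel_abel (h : HeatTower ν f) (m : ℕ) {t z : ℝ} (ht : 0 < t) (hz : 0 < z) :
    HypHeat.abel (HypHeat.abel (f (m + 1))) t z = f m t z := by
  obtain ⟨C, hC, H⟩ := h.decay (m + 1) 2 (b := t) ht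
  have hpos : ∀ p : ℝ × ℝ, 0 < z + (p.1 ^ 2 + p.2 ^ 2) / 2 := fun p => by positivity
  have hint : Integrable (fun p : ℝ × ℝ => f (m + 1) t (z + (p.1 ^ 2 + p.2 ^ 2) / 2))
      (volume.prod volume) := by
    have hb := ((integrable_inv_one_add_sq).const_mul 2).mul_prod
      ((integrable_inv_one_add_sq).const_mul 2)
    refine (hb.const_mul C).mono' ?_ (ae_of_all _ fun p => ?_)
    · exact ((h.continuousOn (m + 1) ht).comp_continuous (by fun_prop) hpos).aestronglyMeasurable
    · rw [norm_of_nonneg (h.nonneg _ ht (hpos p))]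
      refine (H t ⟨le_rfl, le_rfl⟩ _ (hpos p)).trans ?_
      gcongr
      have e : ∀ u : ℝ, 2 * (1 + u ^ 2)⁻¹ = ((1 + u ^ 2) / 2)⁻¹ := fun u => by
        rw [inv_div]; ring
      rw [e, e, ← mul_inv, pow_two]
      gcongr
      · nlinarith [sq_nonneg p.1, sq_nonneg p.2]
      · nlinarith [sq_nonneg p.1, sq_nonneg p.2]
  have e1 : HypHeat.abel (HypHeat.abel (f (m + 1))) t z =
      ∫ p : ℝ × ℝ, f (m + 1) t (z + (p.1 ^ 2 + p.2 ^ 2) / 2) := by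
    rw [Measure.volume_eq_prod, integral_prod _ hint]
    refine integral_congr_ae (ae_of_all _ fun u => integral_congr_ae (ae_of_all _ fun v => ?_))
    simp only
    congr 1
    ring
  have hd : ∀ r : ℝ, HasDerivAt (fun r : ℝ => -f m t (z + r ^ 2 / 2))
      (2 * π * (r * f (m + 1) t (z + r ^ 2 / 2))) r := fun r => by
    have hin : HasDerivAt (fun u : ℝ => z + u ^ 2 / 2) r r := by
      have := (((hasDerivAt_id r).pow 2).div_const 2).const_add z
      refine this.congr_deriv ?_
      simp
    refine ((h.deriv_z m ht (add_sq_pos hz r)).comp r hin).neg.congr_deriv ?_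
    ring
  have hr := (h.integrable_pow_mul (m + 1) 1 ht hz).const_mul (2 * π)
  simp only [pow_one] at hr
  have hlim : Tendsto (fun r : ℝ => -f m t (z + r ^ 2 / 2)) atTop (𝓝 (-0)) := by
    refine ((h.tendsto_zero m ht).comp ?_).neg
    exact tendsto_atTop_add_const_left _ _ ((tendsto_pow_atTop two_ne_zero).atTop_div_const two_pos)
  have e2 := integral_Ioi_of_hasDerivAt_of_tendsto' (a := 0) (fun r _ => hd r) hr.integrableOn hlim
  rw [e1, ← integral_comp_polarCoord_symm, polarCoord_target,
    Measure.volume_eq_prod, ← Measure.prod_restrict]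
  have e3 : (fun p : ℝ × ℝ => p.1 • (f (m + 1) t (z + ((polarCoord.symm p).1 ^ 2 +
      (polarCoord.symm p).2 ^ 2) / 2))) =
      fun p => (p.1 * f (m + 1) t (z + p.1 ^ 2 / 2)) * (fun _ => (1 : ℝ)) p.2 := by
    funext p
    simp only [polarCoord_symm_apply, smul_eq_mul, mul_one]
    congr 4
    linear_combination p.1 ^ 2 * (cos_sq_add_sin_sq p.2)
  rw [e3, integral_prod_mul (fun r : ℝ => r * f (m + 1) t (z + r ^ 2 / 2)) fun _ : ℝ => (1 : ℝ)]
  rw [integral_const_mul] at e2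
  simp only [integral_const, MeasurableSet.univ, measureReal_restrict_apply, univ_inter,
    smul_eq_mul, mul_one]
  rw [volume_real_Ioo_of_le (by linarith [pi_pos])]
  simp at e2
  linarith

end Abel

/-- The function `K_n(t, ρ)` in terms of `t` and `z = cosh ρ`. -/
def radialKernel (n : ℕ) (t z : ℝ) : ℝ :=
  if n % 2 = 1 then oddKernel (n / 2) (t, z) else abel (fun t z => oddKernel (n / 2) (t, z)) t z

theorem radialKernel_odd (m : ℕ) :
    radialKernel (2 * m + 1) = fun t z => oddKernel m (t, z) := by
  have h1 : (2 * m + 1) % 2 = 1 := by omega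
  have h2 : (2 * m + 1) / 2 = m := by omega
  funext t z
  simp [radialKernel, h1, h2]

theorem radialKernel_even (m : ℕ) :
    radialKernel (2 * m) = abel fun t z => oddKernel m (t, z) := by
  have h1 : (2 * m) % 2 = 0 := by omega
  have h2 : (2 * m) / 2 = m := by omega
  funext t z
  simp [radialKernel, h1, h2]

/-- Odd dimensions are shifts of the tower of the line. Even dimensions start from dimension 2, the
Abel transform of the tower shifted to dimension 3, and shift from there. -/
theorem heatTower_radialKernel {n : ℕ} (hn : n ≠ 0) :
    HeatTower n (fun m => radialKernel (n + 2 * m)) := by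
  rcases Nat.even_or_odd' n with ⟨k, rfl | rfl⟩
  · have key : ∀ k : ℕ, HeatTower (2 * (k + 1) : ℝ)
        (fun m => abel fun t z => oddKernel (m + (k + 1)) (t, z)) := by
      intro k
      induction k with
      | zero =>
        refine HeatTower.abel (ν := (2 * ((0 : ℕ) + 1) : ℝ)) ?_
        convert heatTower_oddKernel.shift using 1
        norm_num
      | succ k ih =>
        convert ih.shift using 1
        · push_cast; ring
        · funext m
          rw [show m + 1 + (k + 1) = m + (k + 1 + 1) by ring]
    obtain ⟨j, rfl⟩ : ∃ j, k = j + 1 := ⟨k - 1, by omega⟩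
    convert key j using 1
    · push_cast; ring
    · funext m
      rw [show 2 * (j + 1) + 2 * m = 2 * (m + (j + 1)) by ring, radialKernel_even]
  · have key : ∀ k : ℕ, HeatTower (2 * k + 1 : ℝ) (fun m t z => oddKernel (m + k) (t, z)) := by
      intro k
      induction k with
      | zero => simpa using heatTower_oddKernel
      | succ k ih =>
        convert ih.shift using 1
        · push_cast; ring
        · funext m
          rw [show m + 1 + k = m + (k + 1) by ring]
    convert key k using 1
    · push_cast; ring
    · funext m
      rw [show 2 * k + 1 + 2 * m = 2 * (m + k) + 1 by ring, radialKernel_odd]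

section RadialKernel

variable {n : ℕ} {t z : ℝ}

theorem hasDerivAt_radialKernel (hn : n ≠ 0) (ht : 0 < t) (hz : 0 < z) :
    HasDerivAt (radialKernel n t) (-(2 * π) * radialKernel (n + 2) t z) z :=
  (heatTower_radialKernel hn).deriv_z 0 ht hz

theorem radialKernel_nonneg (hn : n ≠ 0) (ht : 0 < t) (hz : 0 < z) : 0 ≤ radialKernel n t z :=
  (heatTower_radialKernel hn).nonneg 0 ht hz

theorem radialKernel_decay (hn : n ≠ 0) (N : ℕ) {a b : ℝ} (ha : 0 < a) :
    ∃ C, 0 ≤ C ∧ ∀ t ∈ Icc a b, ∀ z, 0 < z → radialKernel n t z ≤ C * ((1 + z) ^ N)⁻¹ :=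
  (heatTower_radialKernel hn).decay 0 N ha

/-- The time derivative of `K_n(t, ρ)`, in terms of `z = cosh ρ`. -/
def radialKernelDot (n : ℕ) (t z : ℝ) : ℝ :=
  (2 * π) ^ 2 * (z ^ 2 - 1) * radialKernel (n + 4) t z - 2 * π * n * z * radialKernel (n + 2) t z
      + (n - 1) ^ 2 / 4 * radialKernel n t z

theorem heat_radialKernel (hn : n ≠ 0) (ht : 0 < t) (hz : 0 < z) :
    HasDerivAt (fun t => radialKernel n t z) (radialKernelDot n t z) t := by
  simpa [radialKernelDot] using (heatTower_radialKernel hn).heat 0 ht hz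

theorem radialKernelDot_decay (hn : n ≠ 0) (N : ℕ) {a b : ℝ} (ha : 0 < a) :
    ∃ C, 0 ≤ C ∧ ∀ t ∈ Icc a b, ∀ z, 0 < z → |radialKernelDot n t z| ≤ C * ((1 + z) ^ N)⁻¹ := by
  simpa [radialKernelDot] using (heatTower_radialKernel hn).heat_bound 0 (b := b) ha N

theorem contDiffOn_radialKernel (hn : n ≠ 0) (ht : 0 < t) :
    ContDiffOn ℝ ∞ (radialKernel n t) (Ioi 0) :=
  contDiffOn_of_hasDerivAt_tower isOpen_Ioi (-(2 * π))
    (f := fun m => radialKernel (n + 2 * m) t)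
    (fun m _ hz => (heatTower_radialKernel hn).deriv_z m ht hz) 0

theorem integrable_radialKernel_shift (hn : n ≠ 0) (ht : 0 < t) (hz : 0 < z) :
    Integrable fun u : ℝ => radialKernel n t (z + u ^ 2 / 2) :=
  (heatTower_radialKernel hn).integrable_shift 0 ht hz

/-- For even n this is the definition; for odd n it is `HeatTower.abel_abel`, the kernel in
dimension n + 1 being itself an Abel transform. -/
theorem radialKernel_eq_abel (hn : n ≠ 0) (ht : 0 < t) (hz : 0 < z) :
    radialKernel n t z = ∫ u : ℝ, radialKernel (n + 1) t (z + u ^ 2 / 2) := by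
  change _ = abel (radialKernel (n + 1)) t z
  rcases Nat.even_or_odd' n with ⟨k, rfl | rfl⟩
  · rw [radialKernel_even, radialKernel_odd]
  · rw [radialKernel_odd, show 2 * k + 1 + 1 = 2 * (k + 1) by ring, radialKernel_even]
    exact (heatTower_oddKernel.abel_abel k ht hz).symm

theorem radialKernel_one_cosh (t s : ℝ) :
    radialKernel 1 t (cosh s) = (√(4 * π * t))⁻¹ * exp (-(s ^ 2 / (4 * t))) := by
  rw [show 1 = 2 * 0 + 1 by rfl, radialKernel_odd]
  exact oddKernel_zero_cosh t s

/-- In even dimension half of the exponent ρ² / (4t) is kept as the Gaussian at z, by monotonicity,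
and the other half makes the u-integral converge uniformly for t ≤ 1. This is why 8t replaces 4t. -/
theorem radialKernel_gauss (n : ℕ) : ∃ C : ℝ, ∃ M : ℕ, 0 ≤ C ∧ ∀ t ∈ Ioc (0 : ℝ) 1, ∀ z, 1 ≤ z →
    radialKernel n t z ≤ C * (1 + 1 / t) ^ M * exp (-(arcoshSq z / (8 * t))) := by
  have hF : ∀ z : ℝ, 1 ≤ z → 0 ≤ arcoshSq z := fun z hz => by
    rw [← arcoshSq_one]; exact arcoshSq_monotoneOn (mem_Ioi.2 one_pos) (mem_Ioi.2 (by linarith)) hz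
  obtain ⟨C, M, hC, H⟩ := gaussBounded_oddKernel (n / 2)
  rcases Nat.even_or_odd' n with ⟨k, hk | hk⟩
  · subst hk
    rw [show 2 * k / 2 = k by omega] at H
    have h1 := fun {z : ℝ} (hz : 0 < z) => exp_neg_mul_arcoshSq_le 1 (c := 1 / 8) (by norm_num) hz
    simp only [Nat.cast_one, pow_one] at h1
    set B : ℝ := 2 * exp (10 * (1 / 8) + 1 ^ 2 / (4 * (1 / 8)))
    have hB : 0 ≤ B := by positivity
    refine ⟨C * (B * (2 * π)), M, by positivity, fun t ht z hz => ?_⟩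
    have ht0 : 0 < t := ht.1
    have hz0 : 0 < z := by linarith
    rw [radialKernel_even]
    have hi := (((integrable_inv_one_add_sq).const_mul 2).const_mul
      (C * (1 + 1 / t) ^ M * exp (-(arcoshSq z / (8 * t))) * B))
    refine (integral_mono (heatTower_oddKernel.integrable_shift k ht0 hz0) hi fun u => ?_).trans_eq
      ?_
    · have hp := add_sq_pos hz0 u
      have hzu : z ≤ z + u ^ 2 / 2 := by nlinarith [sq_nonneg u]
      have hmono : arcoshSq z ≤ arcoshSq (z + u ^ 2 / 2) := arcoshSq_monotoneOn hz0 hp hzu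
      have hF' := hF _ (hz.trans hzu)
      refine (H (t, z + u ^ 2 / 2) ⟨ht0, hp⟩).2.trans ?_
      simp only
      rw [mul_assoc _ B, mul_assoc _ (exp _)]
      gcongr
      have e : -(arcoshSq (z + u ^ 2 / 2) / (4 * t)) = -(arcoshSq (z + u ^ 2 / 2) / (8 * t)) +
          -(arcoshSq (z + u ^ 2 / 2) / (8 * t)) := by field_simp; ring
      rw [e, exp_add]
      gcongr
      have h2 : exp (-(arcoshSq (z + u ^ 2 / 2) / (8 * t))) ≤
          exp (-(1 / 8 * arcoshSq (z + u ^ 2 / 2))) := by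
        rw [exp_le_exp, neg_le_neg_iff, one_div_mul_eq_div]
        gcongr
        linarith [ht.2]
      have h3 : exp (-(1 / 8 * arcoshSq (z + u ^ 2 / 2))) ≤ B * (1 + (z + u ^ 2 / 2))⁻¹ := by
        rw [← div_eq_mul_inv, le_div_iff₀ (by linarith)]
        exact h1 hp
      refine h2.trans (h3.trans ?_)
      gcongr
      simpa using inv_shift_pow_le 0 hz0 u
    · rw [integral_const_mul, integral_const_mul, integral_univ_inv_one_add_sq]
      ring
  · subst hk
    rw [show (2 * k + 1) / 2 = k by omega] at H
    refine ⟨C, M, hC, fun t ht z hz => ?_⟩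
    have ht0 : 0 < t := ht.1
    rw [radialKernel_odd]
    refine (H (t, z) ⟨ht0, by change (0 : ℝ) < z; linarith⟩).2.trans ?_
    simp only
    gcongr ?_ * exp (-(?_))
    exact div_le_div_of_nonneg_left (hF z hz) (by positivity) (by linarith)

theorem tendsto_pow_mul_exp_neg_inv (M : ℕ) {b : ℝ} (hb : 0 < b) :
    Tendsto (fun t : ℝ => (1 + 1 / t) ^ M * exp (-(b / t))) (𝓝[>] 0) (𝓝 0) := by
  have h1 : Tendsto (fun s : ℝ => (1 + s) ^ M * exp (-(b * s))) atTop (𝓝 0) := by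
    have h0 : Tendsto (fun x : ℝ => x ^ M * exp (-b * x)) atTop (𝓝 0) := by
      simpa using tendsto_rpow_mul_exp_neg_mul_atTop_nhds_zero M b hb
    have h2 := (h0.comp (tendsto_atTop_add_const_left atTop (1 : ℝ) tendsto_id)).mul_const (exp b)
    rw [zero_mul] at h2
    refine h2.congr fun s => ?_
    simp only [Function.comp, id]
    rw [mul_assoc, ← exp_add]
    congr 2
    ring
  refine (h1.comp tendsto_inv_nhdsGT_zero).congr fun t => ?_
  simp [div_eq_mul_inv]

/-- The exponent ρ² / (8t) is split in two halves. One is at least its value at 1 + δ and tends to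
infinity as t → 0; the other is at least ρ² / 16 because t ≤ 1, and gives the decay in z. -/
theorem radialKernel_off_diagonal (n N : ℕ) {δ : ℝ} (hδ : 0 < δ) :
    ∃ ε : ℝ → ℝ, Tendsto ε (𝓝[>] 0) (𝓝 0) ∧ ∀ t ∈ Ioc (0 : ℝ) 1, ∀ z, 1 + δ ≤ z →
      radialKernel n t z ≤ ε t * ((1 + z) ^ N)⁻¹ := by
  obtain ⟨C, M, hC, H⟩ := radialKernel_gauss n
  have hb : 0 < arcoshSq (1 + δ) / 16 := by
    have := arcoshSq_pos (z := 1 + δ) (by linarith)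
    positivity
  refine ⟨fun t => C * (2 ^ N * exp (10 * (1 / 16) + N ^ 2 / (4 * (1 / 16)))) *
    ((1 + 1 / t) ^ M * exp (-(arcoshSq (1 + δ) / 16 / t))), ?_, fun t ht z hz => ?_⟩
  · simpa using (tendsto_pow_mul_exp_neg_inv M hb).const_mul
      (C * (2 ^ N * exp (10 * (1 / 16) + N ^ 2 / (4 * (1 / 16)))))
  · have ht0 : 0 < t := ht.1
    have hz0 : 0 < z := by linarith
    have hmono : arcoshSq (1 + δ) ≤ arcoshSq z :=
      arcoshSq_monotoneOn (mem_Ioi.2 (by linarith)) hz0 hz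
    have hpos := arcoshSq_pos (z := 1 + δ) (by linarith)
    rw [← div_eq_mul_inv, le_div_iff₀ (by positivity)]
    have h1 := exp_neg_mul_arcoshSq_le N (c := 1 / 16) (by norm_num) hz0
    have h2 : exp (-(arcoshSq z / (8 * t))) ≤
        exp (-(arcoshSq (1 + δ) / 16 / t)) * exp (-(1 / 16 * arcoshSq z)) := by
      rw [← exp_add, exp_le_exp]
      have e1 : arcoshSq z / (8 * t) = arcoshSq z / 16 / t + arcoshSq z / 16 / t := by
        field_simp; ring
      have e2 : arcoshSq (1 + δ) / 16 / t ≤ arcoshSq z / 16 / t := by gcongr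
      have e3 : arcoshSq z / 16 ≤ arcoshSq z / 16 / t := by
        rw [le_div_iff₀ ht0]
        nlinarith [ht.2]
      rw [e1]
      linarith
    calc radialKernel n t z * (1 + z) ^ N
        ≤ C * (1 + 1 / t) ^ M * (exp (-(arcoshSq (1 + δ) / 16 / t)) *
          exp (-(1 / 16 * arcoshSq z))) * (1 + z) ^ N := by
          gcongr
          exact (H t ht z (by linarith)).trans (by gcongr)
      _ = C * (1 + 1 / t) ^ M * exp (-(arcoshSq (1 + δ) / 16 / t)) *
          (exp (-(1 / 16 * arcoshSq z)) * (1 + z) ^ N) := by ring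
      _ ≤ C * (1 + 1 / t) ^ M * exp (-(arcoshSq (1 + δ) / 16 / t)) *
          (2 ^ N * exp (10 * (1 / 16) + N ^ 2 / (4 * (1 / 16)))) := by gcongr
      _ = _ := by ring

end RadialKernel

end

section

/-! ### Resolvent of a closed symmetric nonpositive operator -/

section Resolvent

variable {H : Type*} [NormedAddCommGroup H] [InnerProductSpace ℂ H] [CompleteSpace H]

/-- Applied to a point (u, g) of the graph, this says that 1 - G is bounded below in the graph norm.
-/
theorem norm_fst_sq_add_norm_snd_sq_le {H : Type*} [NormedAddCommGroup H] [InnerProductSpace ℂ H]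
    {u g : H} (h : (inner ℂ u g).re ≤ 0) :
    ‖u‖ ^ 2 + ‖g‖ ^ 2 ≤ ‖u - g‖ ^ 2 := by
  have := @norm_sub_sq ℂ H _ _ _ u g
  simp only [RCLike.re_to_complex] at this
  linarith

/-- A closed, symmetric, nonpositive operator, given by its graph `G`, for which `1 - G` has dense
range, has a resolvent at `1`. -/
theorem exists_resolvent_of_dense (G : Submodule ℂ (H × H)) (hG : IsClosed (G : Set (H × H)))
    (hsymm : ∀ p ∈ G, ∀ q ∈ G, inner ℂ p.2 q.1 = inner ℂ p.1 q.2)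
    (hneg : ∀ p ∈ G, (inner ℂ p.1 p.2).re ≤ 0)
    (hdense : ∀ v : H, (∀ p ∈ G, inner ℂ v (p.1 - p.2) = 0) → v = 0) :
    ∃ R : H →L[ℂ] H, (∀ f u, R f = u ↔ (u, u - f) ∈ G) ∧ R.IsPositive ∧ (1 - R).IsPositive := by
  let T : G →L[ℂ] H :=
    (ContinuousLinearMap.fst ℂ H H - ContinuousLinearMap.snd ℂ H H).comp G.subtypeL
  have hT : ∀ p : G, T p = p.1.1 - p.1.2 := fun p => rfl
  have : CompleteSpace G := hG.completeSpace_coe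
  have hbound : ∀ p : G, ‖p‖ ≤ ‖T p‖ := by
    intro p
    have h := norm_fst_sq_add_norm_snd_sq_le (hneg p.1 p.2)
    rw [← hT] at h
    have h1 : ‖p.1.1‖ ≤ ‖T p‖ := by
      refine le_of_sq_le_sq ?_ (norm_nonneg _)
      linarith [sq_nonneg ‖p.1.2‖]
    have h2 : ‖p.1.2‖ ≤ ‖T p‖ := by
      refine le_of_sq_le_sq ?_ (norm_nonneg _)
      linarith [sq_nonneg ‖p.1.1‖]
    exact max_le h1 h2
  -- Being bounded below on the complete space G, the map u - g is injective with closed range;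
  -- `hdense` makes the range dense, so the map is bijective and its inverse yields R.
  have hanti : AntilipschitzWith 1 T :=
    T.antilipschitz_of_bound fun p => by simpa using hbound p
  have hclosed : IsClosed (Set.range T) := hanti.isClosed_range T.uniformContinuous
  have hker : T.toLinearMap.ker = ⊥ := LinearMap.ker_eq_bot.2 hanti.injective
  have hrange : T.toLinearMap.range = ⊤ := by
    have hc : IsClosed (T.toLinearMap.range : Set H) := by
      rw [LinearMap.coe_range]; exact hclosed
    rw [← hc.submodule_topologicalClosure_eq, Submodule.topologicalClosure_eq_top_iff,
      Submodule.eq_bot_iff]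
    intro v hv
    refine hdense v fun p hp => ?_
    rw [Submodule.mem_orthogonal'] at hv
    exact hv _ ⟨⟨p, hp⟩, rfl⟩
  let e := ContinuousLinearEquiv.ofBijective T hker hrange
  have he : ∀ p : G, e p = p.1.1 - p.1.2 := fun p => rfl
  let R : H →L[ℂ] H := ((ContinuousLinearMap.fst ℂ H H).comp G.subtypeL).comp
    (e.symm : H →L[ℂ] G)
  have hR : ∀ f, R f = (e.symm f).1.1 := fun f => rfl
  have hR' : ∀ f, R f - f = (e.symm f).1.2 := fun f => by
    have h1 : e (e.symm f) = f := e.apply_symm_apply f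
    rw [he] at h1
    rw [hR]
    nth_rw 2 [← h1]
    abel
  have hmem : ∀ f, (R f, R f - f) ∈ G := fun f => by
    rw [hR', hR]
    exact (e.symm f).2
  refine ⟨R, fun f u => ⟨fun h => h ▸ hmem f, fun h => ?_⟩, ⟨fun f k => ?_, fun f => ?_⟩,
    ⟨fun f k => ?_, fun f => ?_⟩⟩
  · have h1 : e.symm f = ⟨(u, u - f), h⟩ := by
      rw [ContinuousLinearEquiv.symm_apply_eq, he]
      simp
    rw [hR, h1]
  · have := hsymm _ (hmem f) _ (hmem k)
    simp only [inner_sub_left, inner_sub_right] at this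
    change inner ℂ (R f) k = inner ℂ f (R k)
    linear_combination this
  · have := hneg _ (hmem f)
    rw [ContinuousLinearMap.reApplyInnerSelf_apply]
    have h2 : 0 ≤ ‖R f‖ ^ 2 := by positivity
    simp only [inner_sub_right, Complex.sub_re] at this
    have h3 : (inner ℂ (R f) (R f)).re = ‖R f‖ ^ 2 := by
      rw [inner_self_eq_norm_sq_to_K]; norm_cast
    simp only [RCLike.re_to_complex]
    linarith
  · have := hsymm _ (hmem f) _ (hmem k)
    simp only [inner_sub_left, inner_sub_right] at this
    change inner ℂ (f - R f) k = inner ℂ f (k - R k)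
    rw [inner_sub_left, inner_sub_right]
    linear_combination -this
  · have := hneg _ (hmem f)
    rw [ContinuousLinearMap.reApplyInnerSelf_apply]
    have h2 : 0 ≤ ‖f - R f‖ ^ 2 := by positivity
    have h3 : (inner ℂ (f - R f) (f - R f)).re = ‖f - R f‖ ^ 2 := by
      rw [inner_self_eq_norm_sq_to_K]; norm_cast
    -- With u = R f and g = u - f this is ⟨-g, f⟩ = ‖g‖² + ⟨-g, u⟩, and the last real part is
    -- nonnegative because the operator is nonpositive.
    have h4 : inner ℂ (f - R f) f = inner ℂ (f - R f) (f - R f) + inner ℂ (f - R f) (R f) := by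
      rw [← inner_add_right, sub_add_cancel]
    have h5 : (inner ℂ (f - R f) (R f)).re = -(inner ℂ (R f) (R f - f)).re := by
      rw [← Complex.neg_re, ← inner_neg_right, neg_sub, ← inner_conj_symm]
      rfl
    simp only [RCLike.re_to_complex]
    change 0 ≤ (inner ℂ (f - R f) f).re
    rw [h4, Complex.add_re, h5, h3]
    linarith

end Resolvent

/-! ### The semigroup through the functional calculus of the resolvent -/

section Calculus

variable {H : Type*} [NormedAddCommGroup H] [InnerProductSpace ℂ H] [CompleteSpace H]
  {R : H →L[ℂ] H}

theorem spectrum_subset_Icc (h0 : R.IsPositive) (h1 : (1 - R).IsPositive) :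
    spectrum ℝ R ⊆ Icc 0 1 := by
  intro r hr
  refine ⟨spectrum_nonneg_of_nonneg ((ContinuousLinearMap.nonneg_iff_isPositive R).2 h0) hr, ?_⟩
  have h2 : (1 - r) ∈ spectrum ℝ (1 - R) := by
    have := spectrum.singleton_sub_eq R (1 : ℝ)
    rw [map_one] at this
    rw [← this]
    exact Set.sub_mem_sub (mem_singleton 1) hr
  have := spectrum_nonneg_of_nonneg ((ContinuousLinearMap.nonneg_iff_isPositive (1 - R)).2 h1) h2
  linarith

/-- The function of `r = 1 / (1 + l)` corresponding to the function `g` of `l`. -/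
def compactify (g : ℝ → ℝ) (r : ℝ) : ℝ := if r = 0 then 0 else g (1 / r - 1)

theorem calculus_eq (g : ℝ → ℝ) : calculus R g = cfc (compactify g) R := rfl

/-- The point r = 0 stands for l = ∞, so vanishing at infinity is exactly continuity there with the
assigned value 0. -/
theorem continuousOn_compactify {g : ℝ → ℝ} (hg : ContinuousOn g (Ici 0))
    (hlim : Tendsto g atTop (𝓝 0)) : ContinuousOn (compactify g) (Icc 0 1) := by
  intro r hr
  rcases hr.1.eq_or_lt with h | h
  · subst h
    have hc : compactify g 0 = 0 := by simp [compactify]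
    rw [ContinuousWithinAt, hc]
    have h1 : Tendsto (fun r : ℝ => g (1 / r - 1)) (𝓝[>] 0) (𝓝 0) := by
      refine hlim.comp (tendsto_atTop_add_const_right _ _ ?_)
      exact (tendsto_inv_nhdsGT_zero (𝕜 := ℝ)).congr fun x => (one_div x).symm
    have h2 : Tendsto (compactify g) (𝓝[>] 0) (𝓝 0) := by
      refine h1.congr' ?_
      filter_upwards [self_mem_nhdsWithin] with x hx
      simp [compactify, (ne_of_gt hx : x ≠ 0)]
    have h3 : Tendsto (compactify g) (𝓝[≥] 0) (𝓝 0) := by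
      have : Ici (0 : ℝ) = insert 0 (Ioi 0) := by rw [insert_eq, union_comm, Ioi_union_left]
      rw [this, nhdsWithin_insert, tendsto_sup]
      refine ⟨?_, h2⟩
      rw [tendsto_pure_left]
      intro s hs
      rw [hc]
      exact mem_of_mem_nhds hs
    exact h3.mono_left (nhdsWithin_mono _ Icc_subset_Ici_self)
  · have hne : r ≠ 0 := h.ne'
    have hmap : MapsTo (fun r : ℝ => 1 / r - 1) (Icc 0 1 ∩ Ioi 0) (Ici 0) := by
      rintro x ⟨hx, hx0⟩
      have : (0 : ℝ) < x := hx0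
      have : 1 ≤ 1 / x := by rw [le_div_iff₀ this]; linarith [hx.2]
      simpa using this
    have h1 : ContinuousWithinAt (fun r : ℝ => g (1 / r - 1)) (Icc 0 1 ∩ Ioi 0) r := by
      refine ContinuousWithinAt.comp (g := g) (hg _ (hmap ⟨hr, h⟩)) ?_ hmap
      refine ContinuousWithinAt.sub (ContinuousAt.continuousWithinAt ?_) continuousWithinAt_const
      exact continuousAt_const.div continuousAt_id hne
    have h2 : ContinuousWithinAt (compactify g) (Icc 0 1 ∩ Ioi 0) r := by
      refine h1.congr (fun x hx => ?_) ?_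
      · simp [compactify, (ne_of_gt hx.2 : x ≠ 0)]
      · simp [compactify, hne]
    exact (continuousWithinAt_inter (Ioi_mem_nhds h)).1 h2

theorem tendsto_exp_neg_mul {t : ℝ} (ht : 0 < t) :
    Tendsto (fun l : ℝ => exp (-t * l)) atTop (𝓝 0) := by
  have h : Tendsto (fun l : ℝ => t * l) atTop atTop := tendsto_id.const_mul_atTop ht
  refine (tendsto_exp_neg_atTop_nhds_zero.comp h).congr fun l => ?_
  simp

theorem continuousOn_compactify_exp {t : ℝ} (ht : 0 < t) :
    ContinuousOn (compactify fun l => exp (-t * l)) (Icc 0 1) :=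
  continuousOn_compactify (by fun_prop) (tendsto_exp_neg_mul ht)

theorem continuousOn_compactify_deriv_exp {t : ℝ} (ht : 0 < t) :
    ContinuousOn (compactify fun l => -(l * exp (-t * l))) (Icc 0 1) := by
  refine continuousOn_compactify (by fun_prop) ?_
  have := (tendsto_rpow_mul_exp_neg_mul_atTop_nhds_zero 1 t ht).neg
  simpa using this

theorem compactify_abs_le {g : ℝ → ℝ} {C : ℝ} (hC : 0 ≤ C) (hg : ∀ l, 0 ≤ l → |g l| ≤ C) {r : ℝ}
    (hr : r ∈ Icc (0 : ℝ) 1) : |compactify g r| ≤ C := by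
  unfold compactify
  split_ifs with h
  · simpa using hC
  · refine hg _ ?_
    have h0 : 0 < r := lt_of_le_of_ne hr.1 (Ne.symm h)
    have : 1 ≤ 1 / r := by rw [le_div_iff₀ h0]; linarith [hr.2]
    linarith

theorem norm_calculus_le (hs : spectrum ℝ R ⊆ Icc 0 1) {g : ℝ → ℝ} {C : ℝ} (hC : 0 ≤ C)
    (hg : ∀ l, 0 ≤ l → |g l| ≤ C) : ‖calculus R g‖ ≤ C :=
  norm_cfc_le hC fun _ hr => compactify_abs_le hC hg (hs hr)

theorem norm_calculus_exp_le (hs : spectrum ℝ R ⊆ Icc 0 1) {t : ℝ} (ht : 0 < t) :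
    ‖calculus R fun l => exp (-t * l)‖ ≤ 1 := by
  refine norm_calculus_le hs zero_le_one fun l hl => ?_
  rw [abs_exp, exp_le_one_iff]
  nlinarith

/-- The operator `-A e^{-tA}`, where `R = (1 + A)⁻¹`. -/
def calculusDeriv (R : H →L[ℂ] H) (t : ℝ) : H →L[ℂ] H := calculus R fun l => -(l * exp (-t * l))

/-- On the spectrum r (1 + l) = 1, so r (e^{-tl} + l e^{-tl}) = e^{-tl}. This puts the range of
e^{-tA} in the domain of the generator and identifies the generator's action there. -/
theorem resolvent_mul_calculus (hR : IsSelfAdjoint R) (hs : spectrum ℝ R ⊆ Icc 0 1) {t : ℝ}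
    (ht : 0 < t) : R * (calculus R (fun l => exp (-t * l)) - calculusDeriv R t) =
      calculus R (fun l => exp (-t * l)) := by
  have c1 := (continuousOn_compactify_exp ht).mono hs
  have c2 := (continuousOn_compactify_deriv_exp ht).mono hs
  rw [calculusDeriv, calculus_eq, calculus_eq, ← cfc_sub _ _ R c1 c2]
  nth_rw 1 [← cfc_id' ℝ R]
  rw [← cfc_mul (fun x => x) (fun x => compactify (fun l => exp (-t * l)) x -
    compactify (fun l => -(l * exp (-t * l))) x) R continuousOn_id (c1.sub c2)]
  refine cfc_congr fun r _ => ?_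
  simp only [compactify]
  split_ifs with h
  · simp
  · field_simp
    ring

theorem exp_sub_one_sub_id_abs_le (w : ℝ) : |exp w - 1 - w| ≤ w ^ 2 * (1 + exp w) := by
  have h1 := add_one_le_exp w
  have h2 : exp w * (1 - w) ≤ 1 := by
    have h3 := add_one_le_exp (-w)
    have h4 : exp w * exp (-w) = 1 := by rw [← exp_add]; simp
    nlinarith [exp_pos w]
  rw [abs_of_nonneg (by linarith)]
  rcases le_total 0 w with h | h
  · nlinarith [exp_pos w, sq_nonneg w]
  · have h3 : exp w ≤ 1 := exp_le_one_iff.2 h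
    nlinarith [exp_pos w, sq_nonneg w, mul_pos (exp_pos w) (exp_pos w),
      mul_nonneg (sq_nonneg w) (exp_pos w).le]

theorem sq_mul_exp_neg_le {a l : ℝ} (ha : 0 < a) (hl : 0 ≤ l) :
    l ^ 2 * exp (-(a * l)) ≤ 2 / a ^ 2 := by
  have h := quadratic_le_exp_of_nonneg (mul_nonneg ha.le hl)
  rw [exp_neg, ← div_eq_mul_inv, div_le_div_iff₀ (exp_pos _) (by positivity)]
  nlinarith [mul_nonneg ha.le hl]

/-- The second-order remainder is quadratic in (s - t) l, and the factor l² is absorbed by e^{-tl}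
and e^{-sl} as long as both times stay above a. Uniformity in l is what makes the semigroup
differentiable in operator norm. -/
theorem exp_taylor_bound {a s t l : ℝ} (ha : 0 < a) (hs : a ≤ s) (ht : a ≤ t) (hl : 0 ≤ l) :
    |exp (-s * l) - exp (-t * l) - (s - t) * -(l * exp (-t * l))| ≤ 4 / a ^ 2 * (s - t) ^ 2 := by
  have h := exp_sub_one_sub_id_abs_le (-(s - t) * l)
  have e1 : exp (-s * l) = exp (-t * l) * exp (-(s - t) * l) := by rw [← exp_add]; ring_nf
  have e2 : exp (-s * l) - exp (-t * l) - (s - t) * -(l * exp (-t * l)) =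
      exp (-t * l) * (exp (-(s - t) * l) - 1 - -(s - t) * l) := by rw [e1]; ring
  rw [e2, abs_mul, abs_exp]
  have b1 : l ^ 2 * exp (-t * l) ≤ 2 / a ^ 2 := by
    refine le_trans ?_ (sq_mul_exp_neg_le ha hl)
    gcongr
    nlinarith
  have b2 : l ^ 2 * exp (-s * l) ≤ 2 / a ^ 2 := by
    refine le_trans ?_ (sq_mul_exp_neg_le ha hl)
    gcongr
    nlinarith
  calc exp (-t * l) * |exp (-(s - t) * l) - 1 - -(s - t) * l|
      ≤ exp (-t * l) * ((-(s - t) * l) ^ 2 * (1 + exp (-(s - t) * l))) := by gcongr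
    _ = (s - t) ^ 2 * (l ^ 2 * exp (-t * l) + l ^ 2 * exp (-s * l)) := by rw [e1]; ring
    _ ≤ (s - t) ^ 2 * (2 / a ^ 2 + 2 / a ^ 2) := by gcongr
    _ = _ := by ring

theorem hasDerivAt_calculus_exp (hs : spectrum ℝ R ⊆ Icc 0 1) {t : ℝ}
    (ht : 0 < t) :
    HasDerivAt (fun t => calculus R fun l => exp (-t * l)) (calculusDeriv R t) t := by
  rw [hasDerivAt_iff_isLittleO]
  have hO : (fun s => (calculus R fun l => exp (-s * l)) - (calculus R fun l => exp (-t * l)) -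
      (s - t) • calculusDeriv R t) =O[𝓝 t] fun s => (s - t) ^ 2 := by
    refine Asymptotics.IsBigO.of_bound (4 / (t / 2) ^ 2) ?_
    filter_upwards [Ioi_mem_nhds (by linarith : t / 2 < t)] with s hst
    have hs0 : 0 < s := lt_trans (by linarith) hst
    have c0 := (continuousOn_compactify_exp hs0).mono hs
    have c1 := (continuousOn_compactify_exp ht).mono hs
    have c2 := (continuousOn_compactify_deriv_exp ht).mono hs
    rw [calculusDeriv, calculus_eq, calculus_eq, calculus_eq, ← cfc_smul (s - t) _ R c2,
      ← cfc_sub _ _ R c0 c1, ← cfc_sub (fun x => compactify (fun l => exp (-s * l)) x -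
      compactify (fun l => exp (-t * l)) x)
      (fun x => (s - t) • compactify (fun l => -(l * exp (-t * l))) x) R (c0.sub c1)
      (c2.const_smul (s - t)), norm_pow,
      norm_eq_abs (s - t), sq_abs]
    refine norm_cfc_le (by positivity) fun r hr => ?_
    have := compactify_abs_le (g := fun l => exp (-s * l) - exp (-t * l) -
      (s - t) * -(l * exp (-t * l))) (by positivity)
      (fun l hl => exp_taylor_bound (half_pos ht) (le_of_lt hst) (by linarith) hl) (hs hr)
    refine le_trans (le_of_eq ?_) this
    simp only [compactify, norm_eq_abs]
    split_ifs <;> simp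
  refine hO.trans_isLittleO ?_
  have h2 : (fun s : ℝ => (s - t) ^ 2) = fun s => (s - t) * (s - t) := by funext s; ring
  rw [h2]
  have h3 : (fun s : ℝ => s - t) =o[𝓝 t] fun _ => (1 : ℝ) := by
    rw [Asymptotics.isLittleO_one_iff]
    have : Tendsto (fun s : ℝ => s - t) (𝓝 t) (𝓝 (t - t)) := (continuous_id.sub continuous_const).tendsto t
    simpa using this
  simpa using h3.mul_isBigO (Asymptotics.isBigO_refl (fun s : ℝ => s - t) (𝓝 t))

/-- Spectrally |e^{-tl} - 1| r ≤ t l r = t (1 - r) ≤ t. -/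
theorem norm_calculus_exp_mul_sub_le (hR : IsSelfAdjoint R) (hs : spectrum ℝ R ⊆ Icc 0 1) {t : ℝ}
    (ht : 0 < t) : ‖calculus R (fun l => exp (-t * l)) * R - R‖ ≤ t := by
  have c1 := (continuousOn_compactify_exp ht).mono hs
  have e : calculus R (fun l => exp (-t * l)) * R - R =
      cfc (fun r => compactify (fun l => exp (-t * l)) r * r - r) R := by
    rw [cfc_sub (fun r => compactify (fun l => exp (-t * l)) r * r) (fun r => r) R
      (c1.mul continuousOn_id) continuousOn_id, cfc_mul _ (fun r => r) R c1 continuousOn_id,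
      cfc_id' ℝ R]
    rfl
  rw [e]
  refine norm_cfc_le ht.le fun r hr => ?_
  obtain ⟨h0, h1⟩ := hs hr
  unfold compactify
  split_ifs with h
  · simp [h, ht.le]
  · have hr0 : 0 < r := lt_of_le_of_ne h0 (Ne.symm h)
    have hl : 0 ≤ 1 / r - 1 := by
      have : 1 ≤ 1 / r := by rw [le_div_iff₀ hr0]; linarith
      linarith
    have e1 : exp (-t * (1 / r - 1)) ≤ 1 := exp_le_one_iff.2 (by nlinarith)
    have e2 : 1 - t * (1 / r - 1) ≤ exp (-t * (1 / r - 1)) := by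
      have := add_one_le_exp (-t * (1 / r - 1)); linarith
    have e3 : (1 / r - 1) * r = 1 - r := by field_simp
    rw [norm_eq_abs, abs_le]
    constructor <;> nlinarith

/-- On the range of R convergence is linear in t by `norm_calculus_exp_mul_sub_le`; it extends to
the closure of the range since the operators are contractions. -/
theorem tendsto_calculus_exp (hR : IsSelfAdjoint R) (hs : spectrum ℝ R ⊆ Icc 0 1)
    (hd : DenseRange R) (f : H) :
    Tendsto (fun t => calculus R (fun l => exp (-t * l)) f) (𝓝[>] 0) (𝓝 f) := by
  rw [Metric.tendsto_nhds]
  intro ε hε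
  obtain ⟨k, hk⟩ := hd.exists_dist_lt f (by positivity : 0 < ε / 4)
  have hlim : Tendsto (fun t : ℝ => t * ‖k‖) (𝓝[>] 0) (𝓝 0) := by
    have : Tendsto (fun t : ℝ => t * ‖k‖) (𝓝 0) (𝓝 (0 * ‖k‖)) :=
      (continuous_id.mul continuous_const).tendsto 0
    rw [zero_mul] at this
    exact this.mono_left nhdsWithin_le_nhds
  filter_upwards [self_mem_nhdsWithin, hlim.eventually (gt_mem_nhds (by positivity : 0 < ε / 4))]
    with t ht hsmall
  have ht0 : (0 : ℝ) < t := ht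
  set T := calculus R (fun l => exp (-t * l))
  have hT : ‖T‖ ≤ 1 := norm_calculus_exp_le hs ht0
  have e : T f - f = T (f - R k) + (T * R - R) k + (R k - f) := by
    simp
  rw [dist_eq_norm] at hk ⊢
  rw [e]
  have b1 : ‖T (f - R k)‖ ≤ ‖f - R k‖ := (T.le_opNorm _).trans (by nlinarith [norm_nonneg (f - R k)])
  have b2 : ‖(T * R - R) k‖ ≤ t * ‖k‖ := (ContinuousLinearMap.le_opNorm _ _).trans (by
    gcongr; exact norm_calculus_exp_mul_sub_le hR hs ht0)
  have b3 : ‖R k - f‖ = ‖f - R k‖ := norm_sub_rev _ _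
  have := norm_add₃_le (a := T (f - R k)) (b := (T * R - R) k) (c := R k - f)
  linarith

end Calculus

end

section

/-! ### The scalar subordination formula -/

section Subordination

/-- The antiderivative `∫₀ˣ e^{-s²} ds`. -/
def gaussPrimitive (x : ℝ) : ℝ := ∫ s in (0 : ℝ)..x, exp (-s ^ 2)

theorem hasDerivAt_gaussPrimitive (x : ℝ) : HasDerivAt gaussPrimitive (exp (-x ^ 2)) x :=
  (by fun_prop : Continuous fun s : ℝ => exp (-s ^ 2)).integral_hasStrictDerivAt 0 x |>.hasDerivAt

theorem gaussPrimitive_neg (x : ℝ) : gaussPrimitive (-x) = -gaussPrimitive x := by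
  unfold gaussPrimitive
  have h := intervalIntegral.integral_comp_neg (a := 0) (b := x) fun s : ℝ => exp (-s ^ 2)
  simp only [neg_sq, neg_zero] at h
  rw [h, intervalIntegral.integral_symm]

theorem tendsto_gaussPrimitive : Tendsto gaussPrimitive atTop (𝓝 (√π / 2)) := by
  have h1 : IntegrableOn (fun s : ℝ => exp (-s ^ 2)) (Ioi 0) := by
    have := (integrable_exp_neg_mul_sq (b := 1) one_pos).integrableOn (s := Ioi 0)
    simpa using this
  have h2 := intervalIntegral_tendsto_integral_Ioi 0 h1 tendsto_id
  have h3 := integral_gaussian_Ioi 1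
  simp only [neg_mul, one_mul, div_one] at h3
  rw [h3] at h2
  exact h2

theorem tendsto_gaussPrimitive_atBot : Tendsto gaussPrimitive atBot (𝓝 (-(√π / 2))) := by
  refine (tendsto_gaussPrimitive.comp tendsto_neg_atBot_atTop).neg.congr fun x => ?_
  simp [gaussPrimitive_neg]

theorem integrableOn_exp_mul_inv_sqrt {p : ℝ} (hp : 0 < p) :
    IntegrableOn (fun u : ℝ => exp (-p * u) * (√u)⁻¹) (Ioi 0) := by
  refine (integrableOn_rpow_mul_exp_neg_mul_rpow (s := -(1 / 2)) (p := 1) (by norm_num) one_pos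
    hp).congr_fun (fun u hu => ?_) measurableSet_Ioi
  have hu' : (0 : ℝ) < u := hu
  simp only [rpow_one]
  rw [rpow_neg hu'.le, ← sqrt_eq_rpow, mul_comm]

theorem integrableOn_subordination {p : ℝ} (hp : 0 < p) {l : ℝ} (hl : 0 ≤ l) :
    IntegrableOn (fun u : ℝ => exp (-p * u) * ((√u)⁻¹ * exp (-(1 / (4 * u)) * l))) (Ioi 0) := by
  refine (integrableOn_exp_mul_inv_sqrt hp).mono' (Measurable.aestronglyMeasurable (by fun_prop)) ?_
  refine (ae_restrict_iff' measurableSet_Ioi).2 (ae_of_all _ fun u hu => ?_)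
  have hu' : (0 : ℝ) < u := hu
  rw [norm_of_nonneg (by positivity), ← mul_assoc]
  refine mul_le_of_le_one_right (by positivity) (exp_le_one_iff.2 ?_)
  have : 0 ≤ 1 / (4 * u) * l := by positivity
  linarith

theorem tendsto_sqrt_mul_sub_atTop {p : ℝ} (hp : 0 < p) (a : ℝ) :
    Tendsto (fun u => √p * √u + a / (2 * √u)) atTop atTop := by
  have h1 : Tendsto (fun u => √p * √u) atTop atTop :=
    tendsto_sqrt_atTop.const_mul_atTop (sqrt_pos.2 hp)
  have h2 : Tendsto (fun u => a / (2 * √u)) atTop (𝓝 0) :=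
    (tendsto_const_nhds).div_atTop (tendsto_sqrt_atTop.const_mul_atTop two_pos)
  exact h1.atTop_add h2

theorem tendsto_sqrt_mul_sub_nhdsGT {p a : ℝ} (ha : 0 < a) :
    Tendsto (fun u => √p * √u + a / (2 * √u)) (𝓝[>] 0) atTop := by
  have hs : Tendsto (fun u : ℝ => √u) (𝓝[>] 0) (𝓝[>] 0) := by
    refine tendsto_nhdsWithin_iff.2 ⟨?_, ?_⟩
    · have := (continuous_sqrt.tendsto 0).mono_left (nhdsWithin_le_nhds (s := Ioi (0 : ℝ)))
      simpa using this
    · filter_upwards [self_mem_nhdsWithin] with u hu using sqrt_pos.2 hu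
  have h1 : Tendsto (fun u => √p * √u) (𝓝[>] 0) (𝓝 (√p * 0)) :=
    (hs.mono_right nhdsWithin_le_nhds).const_mul _
  have h2 : Tendsto (fun u => a / (2 * √u)) (𝓝[>] 0) atTop := by
    refine ((tendsto_inv_nhdsGT_zero.comp hs).const_mul_atTop (half_pos ha)).congr fun u => ?_
    simp only [Function.comp]
    rw [div_mul_eq_div_div, div_eq_mul_inv (a / 2)]
  exact h1.add_atTop h2

/-- The subordination identity. -/
theorem integral_subordination {p : ℝ} (hp : 0 < p) {l : ℝ} (hl : 0 ≤ l) :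
    ∫ u in Ioi (0 : ℝ), exp (-p * u) * ((√u)⁻¹ * exp (-(1 / (4 * u)) * l)) =
      √π / √p * exp (-√p * √l) := by
  have hsp : 0 < √p := sqrt_pos.2 hp
  have hint := integrableOn_subordination hp hl
  set a := √l with ha_def
  have ha : 0 ≤ a := sqrt_nonneg l
  have hla : l = a ^ 2 := (sq_sqrt hl).symm
  -- An explicit antiderivative: completing the square, (√(pu) ± a / (2√u))² = pu + l / (4u) ± a√p,
  -- so both error functions differentiate to the same exponential once weighted by e^{±a√p}.
  let P : ℝ → ℝ := fun u => (√p)⁻¹ * (exp (-√p * a) * gaussPrimitive (√p * √u + -a / (2 * √u)) +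
    exp (√p * a) * gaussPrimitive (√p * √u + a / (2 * √u)))
  have hderiv : ∀ u ∈ Ioi (0 : ℝ), HasDerivAt P
      (exp (-p * u) * ((√u)⁻¹ * exp (-(1 / (4 * u)) * l))) u := by
    intro u hu
    have hu' : (0 : ℝ) < u := hu
    have hsu : 0 < √u := sqrt_pos.2 hu'
    have hd : ∀ c : ℝ, HasDerivAt (fun u => √p * √u + c / (2 * √u))
        (√p / (2 * √u) - c / (4 * u * √u)) u := by
      intro c
      have h1 := hasDerivAt_sqrt hu'.ne'
      have := (h1.const_mul √p).add ((hasDerivAt_const u c).div (h1.const_mul 2) (by positivity))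
      refine this.congr_deriv ?_
      have e : u = √u ^ 2 := (sq_sqrt hu'.le).symm
      rw [show (4 * u * √u) = 4 * √u ^ 2 * √u by rw [← e]]
      field_simp
      ring
    have hg : ∀ c : ℝ, c ^ 2 = l → HasDerivAt (fun u => gaussPrimitive (√p * √u + c / (2 * √u)))
        (exp (-p * u) * exp (-(1 / (4 * u)) * l) * exp (-√p * c) *
          (√p / (2 * √u) - c / (4 * u * √u))) u := by
      intro c hc
      refine ((hasDerivAt_gaussPrimitive _).comp u (hd c)).congr_deriv ?_
      congr 1
      rw [← exp_add, ← exp_add]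
      congr 1
      have e1 : √p ^ 2 = p := sq_sqrt hp.le
      have e2 : √u ^ 2 = u := sq_sqrt hu'.le
      have e3 : (√p * √u + c / (2 * √u)) ^ 2 = √p ^ 2 * √u ^ 2 + √p * c + c ^ 2 / (4 * √u ^ 2) := by
        field_simp
        ring
      rw [e3, e1, e2, hc]
      ring
    have h1 := hg (-a) (by rw [neg_sq, hla])
    have h2 := hg a hla.symm
    refine (((h1.const_mul (exp (-√p * a))).add (h2.const_mul (exp (√p * a)))).const_mul
      (√p)⁻¹).congr_deriv ?_
    have e4 : exp (-√p * a) * exp (-√p * -a) = 1 := by rw [← exp_add]; simp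
    have e5 : exp (√p * a) * exp (-√p * a) = 1 := by rw [← exp_add]; simp
    generalize exp (-√p * a) = A at e4 e5 ⊢
    generalize exp (√p * a) = B at e4 e5 ⊢
    generalize exp (-√p * -a) = B' at e4 ⊢
    rw [show exp (-p * u) * ((√u)⁻¹ * exp (-(1 / (4 * u)) * l)) =
      exp (-p * u) * exp (-(1 / (4 * u)) * l) * (√u)⁻¹ by ring]
    generalize exp (-p * u) * exp (-(1 / (4 * u)) * l) = Q
    · have e6 : (√p)⁻¹ * (A * (Q * B' * (√p / (2 * √u) - -a / (4 * u * √u))) +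
          B * (Q * A * (√p / (2 * √u) - a / (4 * u * √u)))) =
          (√p)⁻¹ * Q * ((A * B') * (√p / (2 * √u) - -a / (4 * u * √u)) +
          (B * A) * (√p / (2 * √u) - a / (4 * u * √u))) := by ring
      rw [e6, e4, e5]
      field_simp
      ring
  have htop : Tendsto P atTop (𝓝 ((√p)⁻¹ * (exp (-√p * a) * (√π / 2) +
      exp (√p * a) * (√π / 2)))) := by
    refine Tendsto.const_mul _ (Tendsto.add (Tendsto.const_mul _ ?_) (Tendsto.const_mul _ ?_))
    · exact tendsto_gaussPrimitive.comp (tendsto_sqrt_mul_sub_atTop hp _)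
    · exact tendsto_gaussPrimitive.comp (tendsto_sqrt_mul_sub_atTop hp _)
  -- At u = 0 the arguments of the error functions tend to ∓∞ when a > 0, whereas for a = 0 the
  -- antiderivative is simply continuous. In the first case its value at 0 has to be redefined as
  -- the limit.
  rcases ha.eq_or_lt with h0 | h0
  · have hc : ContinuousWithinAt P (Ici 0) 0 := by
      have : Continuous P := by
        have hg : Continuous gaussPrimitive :=
          continuous_iff_continuousAt.2 fun x => (hasDerivAt_gaussPrimitive x).continuousAt
        simp only [P, ← h0, neg_zero, zero_div, add_zero]
        fun_prop
      exact this.continuousWithinAt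
    rw [integral_Ioi_of_hasDerivAt_of_tendsto hc hderiv hint htop]
    simp [P, ← h0, gaussPrimitive]
    ring
  · have hlow : Tendsto P (𝓝[>] 0) (𝓝 ((√p)⁻¹ * (exp (-√p * a) * (-(√π / 2)) +
        exp (√p * a) * (√π / 2)))) := by
      refine Tendsto.const_mul _ (Tendsto.add (Tendsto.const_mul _ ?_) (Tendsto.const_mul _ ?_))
      · refine tendsto_gaussPrimitive_atBot.comp ?_
        have := tendsto_neg_atTop_atBot.comp (tendsto_sqrt_mul_sub_nhdsGT (p := p) h0)
        have h1 : Tendsto (fun u => √p * √u) (𝓝[>] 0) (𝓝 (√p * √0)) :=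
          ((continuous_const.mul continuous_sqrt).tendsto 0).mono_left nhdsWithin_le_nhds
        refine ((h1.const_mul 2).add_atBot this).congr fun u => ?_
        simp only [Function.comp]
        ring
      · exact tendsto_gaussPrimitive.comp (tendsto_sqrt_mul_sub_nhdsGT h0)
    set m₀ := (√p)⁻¹ * (exp (-√p * a) * (-(√π / 2)) + exp (√p * a) * (√π / 2)) with hm₀
    have hc : ContinuousWithinAt (Function.update P 0 m₀) (Ici 0) 0 := by
      rw [continuousWithinAt_update_same]
      refine hlow.mono_left (nhdsWithin_mono _ ?_)
      intro x hx
      exact lt_of_le_of_ne hx.1 (Ne.symm hx.2)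
    have hd' : ∀ u ∈ Ioi (0 : ℝ), HasDerivAt (Function.update P 0 m₀)
        (exp (-p * u) * ((√u)⁻¹ * exp (-(1 / (4 * u)) * l))) u := by
      intro u hu
      refine (hderiv u hu).congr_of_eventuallyEq ?_
      filter_upwards [Ioi_mem_nhds hu] with x hx
      exact Function.update_of_ne (ne_of_gt hx) _ _
    have ht' := htop.congr' (f₂ := Function.update P 0 m₀) (by
      filter_upwards [eventually_gt_atTop 0] with x hx
      exact (Function.update_of_ne (ne_of_gt hx) _ _).symm)
    rw [integral_Ioi_of_hasDerivAt_of_tendsto hc hd' hint ht', Function.update_self, hm₀]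
    ring

end Subordination

/-! ### Uniqueness of vector-valued Laplace transforms -/

section Uniqueness

variable {E : Type*} [NormedAddCommGroup E] [NormedSpace ℂ E] [CompleteSpace E]

/-- Only the values p = 1, 2, 3, … are used: in x = e^{-u} they are the moments of d. -/
theorem integral_polynomial_exp_smul_eq_zero {E : Type*} [NormedAddCommGroup E] [NormedSpace ℂ E]
    {d : ℝ → E}
    (hint : ∀ p > 0, IntegrableOn (fun u => exp (-p * u) • d u) (Ioi 0))
    (h0 : ∀ p > 0, ∫ u in Ioi (0 : ℝ), exp (-p * u) • d u = 0) (q : Polynomial ℝ) :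
    IntegrableOn (fun u => q.eval (exp (-u)) • exp (-1 * u) • d u) (Ioi 0) ∧
      ∫ u in Ioi (0 : ℝ), q.eval (exp (-u)) • exp (-1 * u) • d u = 0 := by
  induction q using Polynomial.induction_on' with
  | add a b ha hb =>
    simp only [Polynomial.eval_add, add_smul]
    exact ⟨ha.1.add hb.1, by rw [integral_add ha.1 hb.1, ha.2, hb.2, add_zero]⟩
  | monomial k c =>
    have e : (fun u => (Polynomial.monomial k c).eval (exp (-u)) • exp (-1 * u) • d u) =
        fun u => c • exp (-(k + 1 : ℝ) * u) • d u := by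
      funext u
      rw [Polynomial.eval_monomial, mul_smul, smul_smul (exp (-u) ^ k), ← exp_nat_mul, ← exp_add]
      congr 3
      ring
    rw [e]
    have hk : (0 : ℝ) < k + 1 := by positivity
    exact ⟨(hint _ hk).smul c, by rw [integral_smul, h0 _ hk, smul_zero]⟩

/-- Lerch's theorem: with all moments in x = e^{-u} zero, Weierstrass approximation makes d
orthogonal to all test functions on (0, ∞), so d vanishes almost everywhere, and everywhere by
continuity. -/
theorem eqOn_zero_of_laplace_eq_zero {d : ℝ → E} (hd : ContinuousOn d (Ioi 0))
    (hint : ∀ p > 0, IntegrableOn (fun u => exp (-p * u) • d u) (Ioi 0))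
    (h0 : ∀ p > 0, ∫ u in Ioi (0 : ℝ), exp (-p * u) • d u = 0) : EqOn d 0 (Ioi 0) := by
  have hint1 := hint 1 one_pos
  have hc : ContinuousOn (fun u => exp (-1 * u) • d u) (Ioi 0) := by fun_prop
  have key : ∀ φ : ℝ → ℝ, ContDiff ℝ ∞ φ → HasCompactSupport φ → tsupport φ ⊆ Ioi 0 →
      ∫ u, φ u • exp (-1 * u) • d u = 0 := by
    intro φ hφ hφc hφs
    have hz : ∀ u ∉ Ioi (0 : ℝ), φ u • exp (-1 * u) • d u = 0 := fun u hu => by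
      rw [image_eq_zero_of_notMem_tsupport fun h => hu (hφs h), zero_smul]
    rw [← setIntegral_eq_integral_of_forall_compl_eq_zero hz]
    -- The test function in the variable x = e^{-u} is continuous up to x = 0, since it vanishes for
    -- large u, that is, for x near 0.
    have hq : ContinuousOn (fun x : ℝ => if x = 0 then 0 else φ (-log x)) (Icc 0 1) := by
      obtain ⟨B, hB⟩ : ∃ B : ℝ, ∀ u, B < u → φ u = 0 := by
        obtain ⟨B, hB⟩ := hφc.isCompact.isBounded.bddAbove
        exact ⟨B, fun u hu => image_eq_zero_of_notMem_tsupport fun h => absurd (hB h) (not_le.2 hu)⟩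
      intro x hx
      rcases hx.1.eq_or_lt with h | h
      · subst h
        have : (fun x : ℝ => if x = 0 then 0 else φ (-log x)) =ᶠ[𝓝[Icc 0 1] 0] fun _ => 0 := by
          have hlt : Iio (exp (-B)) ∈ 𝓝 (0 : ℝ) := Iio_mem_nhds (exp_pos _)
          filter_upwards [mem_nhdsWithin_of_mem_nhds hlt, self_mem_nhdsWithin] with y hy hy'
          split_ifs with h
          · rfl
          · apply hB
            have hy0 : 0 < y := lt_of_le_of_ne hy'.1 (Ne.symm h)
            have := (log_lt_iff_lt_exp hy0).2 hy
            linarith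
        exact (continuousWithinAt_const (b := (0 : ℝ))).congr_of_eventuallyEq this (by simp)
      · have hev : (fun x : ℝ => if x = 0 then 0 else φ (-log x)) =ᶠ[𝓝 x] fun x => φ (-log x) := by
          filter_upwards [Ioi_mem_nhds h] with y hy
          rw [if_neg (ne_of_gt hy)]
        refine (ContinuousAt.congr ?_ hev.symm).continuousWithinAt
        exact hφ.continuous.continuousAt.comp (continuousAt_log h.ne').neg
    rw [← norm_le_zero_iff]
    refine le_of_forall_pos_le_add fun ε hε => ?_
    set I := ∫ u in Ioi (0 : ℝ), ‖exp (-1 * u) • d u‖ with hI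
    have hI0 : 0 ≤ I := integral_nonneg fun _ => norm_nonneg _
    -- The tolerance is divided by I + 1 instead of I so that I = 0 causes no trouble.
    obtain ⟨q, hq'⟩ := exists_polynomial_near_of_continuousOn 0 1 _ hq (ε / (I + 1)) (by positivity)
    obtain ⟨i2, e2⟩ := integral_polynomial_exp_smul_eq_zero hint h0 q
    have i1 : IntegrableOn (fun u => φ u • exp (-1 * u) • d u) (Ioi 0) := by
      obtain ⟨C, hC⟩ := hφ.continuous.bounded_above_of_compact_support hφc
      refine (hint1.norm.const_mul C).mono' (hφ.continuous.aestronglyMeasurable.smul hint1.1)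
        (ae_of_all _ fun u => ?_)
      rw [norm_smul]
      gcongr
      exact hC u
    rw [zero_add, ← sub_zero (∫ u in Ioi (0 : ℝ), φ u • exp (-1 * u) • d u), ← e2,
      ← integral_sub i1 i2]
    have : ‖∫ u in Ioi (0 : ℝ), (φ u • exp (-1 * u) • d u -
        q.eval (exp (-u)) • exp (-1 * u) • d u)‖ ≤
        ∫ u in Ioi (0 : ℝ), ε / (I + 1) * ‖exp (-1 * u) • d u‖ := by
      refine norm_integral_le_of_norm_le (hint1.norm.const_mul _) ?_
      refine (ae_restrict_iff' measurableSet_Ioi).2 (ae_of_all _ fun u hu => ?_)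
      rw [← sub_smul, norm_smul]
      gcongr
      have hu' : (0 : ℝ) < u := hu
      have := hq' (exp (-u)) ⟨(exp_pos _).le, exp_le_one_iff.2 (by linarith)⟩
      rw [if_neg (exp_pos _).ne', log_exp, neg_neg, abs_sub_comm] at this
      exact this.le
    rw [integral_const_mul, ← hI] at this
    refine this.trans ?_
    rw [div_mul_eq_mul_div, div_le_iff₀ (by positivity)]
    nlinarith
  have hae := isOpen_Ioi.ae_eq_zero_of_integral_contDiff_smul_eq_zero
    (hint1.locallyIntegrableOn) key
  have hae' : (fun u => exp (-1 * u) • d u) =ᵐ[volume.restrict (Ioi 0)] fun _ => 0 :=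
    (ae_restrict_iff' measurableSet_Ioi).2 hae
  intro u hu
  have := Measure.eqOn_open_of_ae_eq hae' isOpen_Ioi hc continuousOn_const hu
  simpa using this

theorem HasLaplace.eqOn {g g' F : ℝ → E} (h : HasLaplace g F) (h' : HasLaplace g' F) :
    EqOn g g' (Ioi 0) := by
  have := eqOn_zero_of_laplace_eq_zero (d := fun u => g u - g' u) (h.1.sub h'.1)
    (fun p hp => by simp only [smul_sub]; exact (h.2 p hp).1.sub (h'.2 p hp).1)
    (fun p hp => by
      simp only [smul_sub]
      rw [integral_sub (h.2 p hp).1 (h'.2 p hp).1, (h.2 p hp).2, (h'.2 p hp).2, sub_self])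
  intro u hu
  exact sub_eq_zero.1 (this hu)

theorem HasLaplace.inverseLaplace {g F : ℝ → E} (h : HasLaplace g F) :
    HasLaplace (inverseLaplace F) F ∧ EqOn (inverseLaplace F) g (Ioi 0) := by
  have hex : ∃ g, HasLaplace g F := ⟨g, h⟩
  have hs : HasLaplace (HypHeat.inverseLaplace F) F := by
    rw [HypHeat.inverseLaplace, dif_pos hex]
    exact hex.choose_spec
  exact ⟨hs, hs.eqOn h⟩

end Uniqueness

/-! ### Subordination for operators -/

section Poisson

variable {H : Type*} [NormedAddCommGroup H] [InnerProductSpace ℂ H] [CompleteSpace H]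
  {R : H →L[ℂ] H}

/-- Joint continuity is what allows the functional calculus to be exchanged with the integral over
u. Only the points r = 0 are delicate. -/
theorem continuousOn_compactify_exp_prod :
    ContinuousOn (fun q : ℝ × ℝ => compactify (fun l => exp (-(1 / (4 * q.1)) * l)) q.2)
      (Ioi 0 ×ˢ Icc 0 1) := by
  rintro ⟨u, r⟩ ⟨hu, hr⟩
  have hu' : (0 : ℝ) < u := hu
  rcases hr.1.eq_or_lt with h | h
  · simp only at h
    subst h
    have hz : ∀ g, compactify g 0 = 0 := fun g => by simp [compactify]
    rw [ContinuousWithinAt, hz]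
    -- For parameters below 2u the exponential is at most e^{-l/(8u)}, which no longer depends on
    -- the parameter and tends to 0 as r → 0.
    have hu8 : 0 < 1 / (8 * u) := by positivity
    have hlim : Tendsto (fun q : ℝ × ℝ => compactify (fun l => exp (-(1 / (8 * u)) * l)) q.2)
        (𝓝[Ioi 0 ×ˢ Icc 0 1] (u, 0)) (𝓝 0) := by
      have h1 := continuousOn_compactify_exp hu8 0 ⟨le_rfl, zero_le_one⟩
      rw [ContinuousWithinAt, hz] at h1
      rw [nhdsWithin_prod_eq]
      exact h1.comp tendsto_snd
    have hpos : ∀ c r : ℝ, 0 ≤ compactify (fun l => exp (-c * l)) r := fun c r => by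
      unfold compactify; split_ifs <;> positivity
    refine squeeze_zero' (Eventually.of_forall fun q => hpos _ _) ?_ hlim
    have hn : {q : ℝ × ℝ | q.1 < 2 * u} ∈ 𝓝 (u, (0 : ℝ)) :=
      (isOpen_lt continuous_fst continuous_const).mem_nhds (show u < 2 * u by linarith)
    filter_upwards [mem_nhdsWithin_of_mem_nhds hn, self_mem_nhdsWithin] with q hq hq'
    unfold compactify
    split_ifs with h
    · exact le_rfl
    · have hq0 : 0 < q.2 := lt_of_le_of_ne hq'.2.1 (Ne.symm h)
      have hl : 0 ≤ 1 / q.2 - 1 := by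
        have : 1 ≤ 1 / q.2 := by rw [le_div_iff₀ hq0]; linarith [hq'.2.2]
        linarith
      have hq1 : 0 < q.1 := hq'.1
      rw [exp_le_exp]
      refine mul_le_mul_of_nonneg_right (neg_le_neg ?_) hl
      exact one_div_le_one_div_of_le (by positivity) (by have : q.1 < 2 * u := hq; linarith)
  · simp only at h
    refine ContinuousAt.continuousWithinAt ?_
    have : ContinuousAt (fun q : ℝ × ℝ => exp (-(1 / (4 * q.1)) * (1 / q.2 - 1))) (u, r) := by
      have h1 : ContinuousAt (fun q : ℝ × ℝ => 1 / (4 * q.1)) (u, r) :=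
        continuousAt_const.div (by fun_prop) (by simp only; positivity)
      have h2 : ContinuousAt (fun q : ℝ × ℝ => 1 / q.2) (u, r) :=
        continuousAt_const.div (by fun_prop) (by simp only; positivity)
      exact (h1.neg.mul (h2.sub continuousAt_const)).rexp
    refine this.congr ?_
    have hn : {q : ℝ × ℝ | 0 < q.2} ∈ 𝓝 (u, r) :=
      (isOpen_lt continuous_const continuous_snd).mem_nhds h
    filter_upwards [hn] with q hq
    have hq' : 0 < q.2 := hq
    simp [compactify, hq'.ne']

/-- The functional calculus commutes with the Bochner integral, dominated by e^{-pu} u^{-1/2}, so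
the scalar subordination formula passes to operators. -/
theorem hasLaplace_calculus (hR : IsSelfAdjoint R) (hs : spectrum ℝ R ⊆ Icc 0 1) :
    HasLaplace (fun u : ℝ => (((√u)⁻¹ : ℝ) : ℂ) • calculus R fun l => exp (-(1 / (4 * u)) * l))
      (fun p : ℝ => ((√π / √p : ℝ) : ℂ) • calculus R fun l => exp (-√p * √l)) := by
  have hcont : ContinuousOn
      (fun u : ℝ => (((√u)⁻¹ : ℝ) : ℂ) • calculus R fun l => exp (-(1 / (4 * u)) * l)) (Ioi 0) := by
    intro u hu
    have hu' : (0 : ℝ) < u := hu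
    refine ContinuousAt.continuousWithinAt ?_
    have hc1 : ContinuousAt (fun u : ℝ => (((√u)⁻¹ : ℝ) : ℂ)) u :=
      Complex.continuous_ofReal.continuousAt.comp
        (continuous_sqrt.continuousAt.inv₀ (sqrt_pos.2 hu').ne')
    refine hc1.smul ?_
    · have h1 := (hasDerivAt_calculus_exp (R := R) hs
        (by positivity : 0 < 1 / (4 * u))).continuousAt
      refine ContinuousAt.comp (f := fun u : ℝ => 1 / (4 * u)) h1 ?_
      exact continuousAt_const.div (by fun_prop) (by positivity)
  refine ⟨hcont, fun p hp => ⟨?_, ?_⟩⟩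
  · refine (integrableOn_exp_mul_inv_sqrt hp).mono' ?_ ?_
    · have he : ContinuousOn (fun u : ℝ => exp (-p * u)) (Ioi 0) := by fun_prop
      exact (he.smul hcont).aestronglyMeasurable measurableSet_Ioi
    · refine (ae_restrict_iff' measurableSet_Ioi).2 (ae_of_all _ fun u hu => ?_)
      have hu' : (0 : ℝ) < u := hu
      rw [norm_smul, norm_smul, norm_of_nonneg (exp_pos _).le, Complex.norm_real,
        norm_of_nonneg (by positivity : 0 ≤ (√u)⁻¹), ← mul_assoc]
      exact mul_le_of_le_one_right (by positivity)
        (norm_calculus_exp_le hs (by positivity : 0 < 1 / (4 * u)))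
  · have key := cfc_setIntegral (μ := volume) measurableSet_Ioi (fun u r : ℝ => exp (-p * u) *
      ((√u)⁻¹ * compactify (fun l => exp (-(1 / (4 * u)) * l)) r))
      (fun u => exp (-p * u) * (√u)⁻¹) R ?_ ?_ (integrableOn_exp_mul_inv_sqrt hp).2 hR
    · have c2 : ContinuousOn (compactify fun l => exp (-√p * √l)) (spectrum ℝ R) := by
        refine (continuousOn_compactify (by fun_prop) ?_).mono hs
        exact (tendsto_exp_neg_mul (sqrt_pos.2 hp)).comp tendsto_sqrt_atTop
      have e1 : cfc (fun r => ∫ u in Ioi (0 : ℝ), exp (-p * u) *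
          ((√u)⁻¹ * compactify (fun l => exp (-(1 / (4 * u)) * l)) r)) R =
          (√π / √p) • calculus R fun l => exp (-√p * √l) := by
        rw [calculus_eq, ← cfc_smul (√π / √p) _ R c2]
        refine cfc_congr fun r hr => ?_
        obtain ⟨h0, h1⟩ := hs hr
        simp only [compactify, smul_eq_mul]
        split_ifs with h
        · simp
        · have hr0 : 0 < r := lt_of_le_of_ne h0 (Ne.symm h)
          have hl : 0 ≤ 1 / r - 1 := by
            have : 1 ≤ 1 / r := by rw [le_div_iff₀ hr0]; linarith
            linarith
          exact integral_subordination hp hl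
      change _ = (√π / √p) • calculus R fun l => exp (-√p * √l)
      rw [← e1, key]
      refine setIntegral_congr_fun measurableSet_Ioi fun u hu => ?_
      have hu' : (0 : ℝ) < u := hu
      have c1 := (continuousOn_compactify_exp (by positivity : 0 < 1 / (4 * u))).mono hs
      change exp (-p * u) • (√u)⁻¹ • calculus R (fun l => exp (-(1 / (4 * u)) * l)) = _
      rw [calculus_eq, ← cfc_smul (√u)⁻¹ _ R c1, ← cfc_smul (exp (-p * u))
        (fun x => (√u)⁻¹ • compactify (fun l => exp (-(1 / (4 * u)) * l)) x) R (c1.const_smul (√u)⁻¹)]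
      rfl
    · have hj := continuousOn_compactify_exp_prod.mono (prod_mono_right (s := Ioi (0 : ℝ)) hs)
      have h1 : ContinuousOn (fun q : ℝ × ℝ => exp (-p * q.1)) (Ioi 0 ×ˢ spectrum ℝ R) := by fun_prop
      have h2 : ContinuousOn (fun q : ℝ × ℝ => (√q.1)⁻¹) (Ioi 0 ×ˢ spectrum ℝ R) :=
        ContinuousOn.inv₀ (by fun_prop) fun q hq => (sqrt_pos.2 hq.1).ne'
      exact h1.mul (h2.mul hj)
    · refine (ae_restrict_iff' measurableSet_Ioi).2 (ae_of_all _ fun u hu r hr => ?_)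
      have hu' : (0 : ℝ) < u := hu
      have hu4 : 0 < 1 / (4 * u) := by positivity
      have := compactify_abs_le (g := fun l => exp (-(1 / (4 * u)) * l)) zero_le_one (fun l hl => by
        rw [abs_exp, exp_le_one_iff]; nlinarith) (hs hr)
      rw [norm_mul, norm_mul, norm_eq_abs (compactify _ _), norm_of_nonneg (exp_pos _).le,
        norm_of_nonneg (by positivity : 0 ≤ (√u)⁻¹), ← mul_assoc]
      exact mul_le_of_le_one_right (by positivity) this

end Poisson

end

/-! ### Half-space geometry: volume, distance and decay weights -/

section

section HalfSpace

variable {n : ℕ} [NeZero n]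

/-- The last coordinate. -/
def height (w : EuclideanSpace ℝ (Fin n)) : ℝ := w (lastIdx n)

theorem mem_halfSpace {w : EuclideanSpace ℝ (Fin n)} : w ∈ halfSpace n ↔ 0 < height w := Iff.rfl

theorem contDiff_height : ContDiff ℝ ∞ (height : EuclideanSpace ℝ (Fin n) → ℝ) :=
  (EuclideanSpace.proj (𝕜 := ℝ) (lastIdx n)).contDiff

@[fun_prop]
theorem continuous_height : Continuous (height : EuclideanSpace ℝ (Fin n) → ℝ) :=
  contDiff_height.continuous

theorem isOpen_halfSpace : IsOpen (halfSpace n) := isOpen_lt continuous_const continuous_height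

theorem measurableSet_halfSpace : MeasurableSet (halfSpace n) := isOpen_halfSpace.measurableSet

/-- The density of the hyperbolic volume. -/
def volDensity (w : EuclideanSpace ℝ (Fin n)) : ℝ := (height w ^ n)⁻¹

@[fun_prop]
theorem measurable_volDensity : Measurable (volDensity : EuclideanSpace ℝ (Fin n) → ℝ) :=
  (continuous_height.measurable.pow_const n).inv

theorem volDensity_nonneg {w : EuclideanSpace ℝ (Fin n)} (hw : w ∈ halfSpace n) :
    0 ≤ volDensity w := by
  have : 0 < height w := hw
  unfold volDensity; positivity

theorem hypVolume_eq : hypVolume n = (volume.restrict (halfSpace n)).withDensity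
    fun w => ENNReal.ofReal (volDensity w) := rfl

theorem ae_mem_halfSpace : ∀ᵐ w ∂(hypVolume n), w ∈ halfSpace n := by
  rw [hypVolume_eq]
  exact (withDensity_absolutelyContinuous _ _).ae_le (ae_restrict_mem measurableSet_halfSpace)

theorem integral_hypVolume {F : Type*} [NormedAddCommGroup F] [NormedSpace ℝ F]
    (f : EuclideanSpace ℝ (Fin n) → F) :
    ∫ w, f w ∂(hypVolume n) = ∫ w in halfSpace n, volDensity w • f w := by
  rw [hypVolume_eq, integral_withDensity_eq_integral_toReal_smul
    measurable_volDensity.ennreal_ofReal (ae_of_all _ fun _ => ENNReal.ofReal_lt_top)]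
  refine setIntegral_congr_fun measurableSet_halfSpace fun w hw => ?_
  rw [ENNReal.toReal_ofReal (volDensity_nonneg hw)]

theorem integrable_hypVolume_iff {F : Type*} [NormedAddCommGroup F] [NormedSpace ℝ F]
    {f : EuclideanSpace ℝ (Fin n) → F} :
    Integrable f (hypVolume n) ↔ IntegrableOn (fun w => volDensity w • f w) (halfSpace n) := by
  rw [hypVolume_eq, integrable_withDensity_iff_integrable_smul'
    measurable_volDensity.ennreal_ofReal (ae_of_all _ fun _ => ENNReal.ofReal_lt_top)]
  refine integrableOn_congr_fun (fun w hw => ?_) measurableSet_halfSpace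
  rw [ENNReal.toReal_ofReal (volDensity_nonneg hw)]

theorem integral_hypVolume_of_support {F : Type*} [NormedAddCommGroup F] [NormedSpace ℝ F]
    {f : EuclideanSpace ℝ (Fin n) → F} (hf : ∀ w ∉ halfSpace n, f w = 0) :
    ∫ w, f w ∂(hypVolume n) = ∫ w, volDensity w • f w := by
  rw [integral_hypVolume, setIntegral_eq_integral_of_forall_compl_eq_zero]
  intro w hw
  rw [hf w hw, smul_zero]

theorem volDensity_continuousOn : ContinuousOn (volDensity : EuclideanSpace ℝ (Fin n) → ℝ)
    (halfSpace n) :=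
  ContinuousOn.inv₀ (by fun_prop) fun w hw => by
    have : 0 < height w := hw
    positivity

theorem hypVolume_lt_top_of_isCompact {K : Set (EuclideanSpace ℝ (Fin n))} (hK : IsCompact K)
    (hKs : K ⊆ halfSpace n) : hypVolume n K < ⊤ := by
  obtain ⟨C, hC⟩ := hK.exists_bound_of_continuousOn (volDensity_continuousOn.mono hKs)
  have hm : MeasurableSet K := hK.measurableSet
  rw [hypVolume_eq, withDensity_apply _ hm]
  calc ∫⁻ w in K, ENNReal.ofReal (volDensity w) ∂(volume.restrict (halfSpace n))
      ≤ ∫⁻ _ in K, ENNReal.ofReal C ∂(volume.restrict (halfSpace n)) := by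
        refine setLIntegral_mono measurable_const fun w hw => ENNReal.ofReal_le_ofReal ?_
        exact (le_abs_self _).trans (hC w hw)
    _ = ENNReal.ofReal C * (volume.restrict (halfSpace n)) K := by rw [setLIntegral_const]
    _ < ⊤ := ENNReal.mul_lt_top ENNReal.ofReal_lt_top
        ((Measure.restrict_apply_le _ _).trans_lt hK.measure_lt_top)

instance : SigmaFinite (hypVolume n) := by
  rw [hypVolume_eq]
  exact SigmaFinite.withDensity_of_ne_top' fun _ => ENNReal.ofReal_ne_top

theorem integrable_of_isTest {F : Type*} [NormedAddCommGroup F]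
    {φ : EuclideanSpace ℝ (Fin n) → F} (hφ : Continuous φ) (hc : HasCompactSupport φ)
    (hs : tsupport φ ⊆ halfSpace n) : Integrable φ (hypVolume n) := by
  obtain ⟨C, hC⟩ := hφ.bounded_above_of_compact_support hc
  have h1 : IntegrableOn φ (tsupport φ) (hypVolume n) := by
    refine Measure.integrableOn_of_bounded (hypVolume_lt_top_of_isCompact hc hs).ne
      hφ.aestronglyMeasurable (M := C) (ae_of_all _ hC)
  rwa [integrableOn_iff_integrable_of_support_subset (subset_tsupport φ)] at h1

theorem locallyIntegrableOn_of_memLp {F : Type*} [NormedAddCommGroup F]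
    {f : EuclideanSpace ℝ (Fin n) → F} (hf : MemLp f 2 (hypVolume n)) :
    LocallyIntegrableOn f (halfSpace n) (hypVolume n) := by
  rw [locallyIntegrableOn_iff isOpen_halfSpace.isLocallyClosed]
  intro K hK hc
  have : IsFiniteMeasure ((hypVolume n).restrict K) :=
    ⟨by rw [Measure.restrict_apply_univ]; exact hypVolume_lt_top_of_isCompact hc hK⟩
  exact (hf.restrict K).integrable (by norm_num)

/-- `cosh` of the hyperbolic distance. -/
def coshDist (w w' : EuclideanSpace ℝ (Fin n)) : ℝ :=
  1 + ‖w - w'‖ ^ 2 / (2 * (height w * height w'))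

theorem cosh_hypDist {w w' : EuclideanSpace ℝ (Fin n)} (hw : w ∈ halfSpace n)
    (hw' : w' ∈ halfSpace n) : cosh (hypDist w w') = coshDist w w' := by
  have h := cosh_sq_half_hypDist hw hw'
  have h1 : hypDist w w' = 2 * (hypDist w w' / 2) := by ring
  have p1 : 0 < height w := hw
  have p2 : 0 < height w' := hw'
  rw [h1, cosh_two_mul, sinh_sq, h, coshDist]
  simp only [height] at *
  field_simp
  ring

theorem hypDist_nonneg (w w' : EuclideanSpace ℝ (Fin n)) : 0 ≤ hypDist w w' := by
  unfold hypDist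
  have : 0 ≤ arsinh (‖w - w'‖ / (2 * √(w (lastIdx n) * w' (lastIdx n)))) :=
    arsinh_nonneg_iff.2 (by positivity)
  linarith

theorem coshDist_comm (w w' : EuclideanSpace ℝ (Fin n)) : coshDist w w' = coshDist w' w := by
  unfold coshDist
  rw [norm_sub_rev, mul_comm (height w)]

theorem one_le_coshDist {w w' : EuclideanSpace ℝ (Fin n)} (hw : w ∈ halfSpace n)
    (hw' : w' ∈ halfSpace n) : 1 ≤ coshDist w w' := by
  have p1 : 0 < height w := hw
  have p2 : 0 < height w' := hw'
  have : 0 ≤ ‖w - w'‖ ^ 2 / (2 * (height w * height w')) := by positivity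
  unfold coshDist
  linarith

theorem coshDist_pos {w w' : EuclideanSpace ℝ (Fin n)} (hw : w ∈ halfSpace n)
    (hw' : w' ∈ halfSpace n) : 0 < coshDist w w' := one_pos.trans_le (one_le_coshDist hw hw')

theorem contDiffOn_coshDist {w : EuclideanSpace ℝ (Fin n)} (hw : w ∈ halfSpace n) :
    ContDiffOn ℝ ∞ (coshDist w) (halfSpace n) := by
  refine contDiffOn_const.add (ContDiffOn.div ?_ ?_ ?_)
  · exact (contDiff_const.sub contDiff_id).norm_sq ℝ |>.contDiffOn
  · exact contDiffOn_const.mul (contDiffOn_const.mul contDiff_height.contDiffOn)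
  · intro x hx
    have p1 : 0 < height w := hw
    have p2 : 0 < height x := hx
    positivity

/-- A multiple of `1 / cosh` of the distance to a fixed point. -/
def decayWeight (w : EuclideanSpace ℝ (Fin n)) : ℝ := height w / (1 + ‖w‖ ^ 2)

/-- The constant in the comparison of `cosh` of the distance with `decayWeight`. -/
def decayConst (w : EuclideanSpace ℝ (Fin n)) : ℝ :=
  height w / (2 * (2 * height w ^ 2 + 1 + 2 * ‖w‖ ^ 2))

theorem decayConst_pos {w : EuclideanSpace ℝ (Fin n)} (hw : w ∈ halfSpace n) :
    0 < decayConst w := by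
  have p1 : 0 < height w := hw
  unfold decayConst; positivity

@[fun_prop]
theorem continuous_decayWeight : Continuous (decayWeight : EuclideanSpace ℝ (Fin n) → ℝ) := by
  unfold decayWeight
  refine Continuous.div (by fun_prop) (by fun_prop) fun w => ?_
  positivity

theorem decayWeight_pos {w : EuclideanSpace ℝ (Fin n)} (hw : w ∈ halfSpace n) :
    0 < decayWeight w := by
  have p1 : 0 < height w := hw
  unfold decayWeight; positivity

theorem height_sub_sq_le (w w' : EuclideanSpace ℝ (Fin n)) :
    (height w - height w') ^ 2 ≤ ‖w - w'‖ ^ 2 := by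
  have := PiLp.norm_apply_le (w - w') (lastIdx n)
  rw [norm_eq_abs] at this
  rw [← sq_abs]
  exact pow_le_pow_left₀ (abs_nonneg _) this 2

theorem height_sq_le (w : EuclideanSpace ℝ (Fin n)) : height w ^ 2 ≤ ‖w‖ ^ 2 := by
  simpa [height] using height_sub_sq_le w 0

theorem decayWeight_le_one {w : EuclideanSpace ℝ (Fin n)} : decayWeight w ≤ 1 := by
  unfold decayWeight
  rw [div_le_one (by positivity)]
  nlinarith [height_sq_le w, sq_nonneg (height w - 1)]

/-- `decayWeight` is 1 / (2 cosh) of the distance to (0, …, 0, 1), so this is a quantitative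
triangle inequality. The quantity S = 2yy' + |w - w'|² controls both y² and |w - w'|², hence also
y²(1 + |w'|²) up to a factor depending on w alone. -/
theorem decayConst_le {w w' : EuclideanSpace ℝ (Fin n)} (hw : w ∈ halfSpace n)
    (hw' : w' ∈ halfSpace n) : decayConst w ≤ coshDist w w' * decayWeight w' := by
  have p1 : 0 < height w := hw
  have p2 : 0 < height w' := hw'
  set y := height w
  set y' := height w'
  have e : coshDist w w' * decayWeight w' =
      (2 * (y * y') + ‖w - w'‖ ^ 2) / (2 * y * (1 + ‖w'‖ ^ 2)) := by
    unfold coshDist decayWeight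
    change (1 + ‖w - w'‖ ^ 2 / (2 * (y * y'))) * (y' / (1 + ‖w'‖ ^ 2)) = _
    have : 1 + ‖w'‖ ^ 2 ≠ 0 := by positivity
    field_simp
  have h1 := height_sub_sq_le w w'
  have h2 : ‖w'‖ ^ 2 ≤ 2 * ‖w - w'‖ ^ 2 + 2 * ‖w‖ ^ 2 := by
    have h3 : ‖w'‖ ≤ ‖w - w'‖ + ‖w‖ := by
      have := norm_sub_le w (w - w')
      simp only [sub_sub_cancel] at this
      linarith
    nlinarith [norm_nonneg w', sq_nonneg (‖w - w'‖ - ‖w‖), norm_nonneg (w - w'), norm_nonneg w]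
  change (y - y') ^ 2 ≤ _ at h1
  rw [e]
  unfold decayConst
  change y / (2 * (2 * y ^ 2 + 1 + 2 * ‖w‖ ^ 2)) ≤ _
  rw [div_le_div_iff₀ (by positivity) (by positivity)]
  set S := 2 * (y * y') + ‖w - w'‖ ^ 2 with hS
  have hS1 : y ^ 2 ≤ S := by nlinarith [sq_nonneg y']
  have hS2 : ‖w - w'‖ ^ 2 ≤ S := by nlinarith [mul_pos p1 p2]
  have h3 : 1 + ‖w'‖ ^ 2 ≤ 1 + 2 * S + 2 * ‖w‖ ^ 2 := by linarith
  have h4 : y ^ 2 * (1 + ‖w'‖ ^ 2) ≤ S * (2 * y ^ 2 + 1 + 2 * ‖w‖ ^ 2) := by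
    calc y ^ 2 * (1 + ‖w'‖ ^ 2) ≤ y ^ 2 * (1 + 2 * S + 2 * ‖w‖ ^ 2) := by gcongr
      _ = y ^ 2 * (1 + 2 * ‖w‖ ^ 2) + S * (2 * y ^ 2) := by ring
      _ ≤ S * (1 + 2 * ‖w‖ ^ 2) + S * (2 * y ^ 2) := by gcongr
      _ = _ := by ring
  nlinarith

theorem inv_coshDist_pow_le {w w' : EuclideanSpace ℝ (Fin n)} (hw : w ∈ halfSpace n)
    (hw' : w' ∈ halfSpace n) (N : ℕ) :
    ((1 + coshDist w w') ^ N)⁻¹ ≤ (decayConst w ^ N)⁻¹ * decayWeight w' ^ N := by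
  have h := decayConst_le hw hw'
  have p := decayConst_pos hw
  have q := decayWeight_pos hw'
  have z := coshDist_pos hw hw'
  have h2 : decayConst w ^ N ≤ (1 + coshDist w w') ^ N * decayWeight w' ^ N := by
    rw [← mul_pow]
    exact pow_le_pow_left₀ p.le (h.trans (by gcongr; linarith)) N
  rw [inv_mul_eq_div, le_div_iff₀ (by positivity), inv_mul_le_iff₀ (by positivity)]
  exact h2

/-- The exponent n + 2 cancels the density and leaves y² / (1 + |w|²)^{n+2} ≤ (1 + |w|²)^{-(n+1)},
which is Lebesgue integrable on ℝⁿ. -/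
theorem integrable_decayWeight_pow : Integrable (fun w => decayWeight w ^ (n + 2)) (hypVolume n) := by
  rw [integrable_hypVolume_iff]
  have h := integrable_rpow_neg_one_add_norm_sq (E := EuclideanSpace ℝ (Fin n)) (μ := volume)
    (r := 2 * (n + 1)) (by rw [finrank_euclideanSpace_fin]; linarith [Nat.cast_nonneg (α := ℝ) n])
  refine (h.integrableOn (s := halfSpace n)).mono' ?_ ?_
  · exact (measurable_volDensity.mul
      (continuous_decayWeight.measurable.pow_const _)).aestronglyMeasurable
  · refine (ae_restrict_iff' measurableSet_halfSpace).2 (ae_of_all _ fun w hw => ?_)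
    have p : 0 < height w := hw
    have q := decayWeight_pos hw
    have hv := volDensity_nonneg hw
    rw [norm_of_nonneg (by rw [smul_eq_mul]; positivity)]
    have e : (1 + ‖w‖ ^ 2) ^ (-(2 * ((n : ℝ) + 1)) / 2) = ((1 + ‖w‖ ^ 2) ^ (n + 1))⁻¹ := by
      rw [show -(2 * ((n : ℝ) + 1)) / 2 = -((n + 1 : ℕ) : ℝ) by push_cast; ring,
        rpow_neg (by positivity), rpow_natCast]
    rw [e, smul_eq_mul, volDensity, decayWeight, div_pow, pow_add]
    have h2 : height w ^ 2 ≤ 1 + ‖w‖ ^ 2 := by linarith [height_sq_le w]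
    have e2 : (height w ^ n)⁻¹ * (height w ^ n * height w ^ 2 / (1 + ‖w‖ ^ 2) ^ (n + 2)) =
        height w ^ 2 / (1 + ‖w‖ ^ 2) ^ (n + 2) := by
      field_simp
    rw [e2, div_le_iff₀ (by positivity), ← div_eq_inv_mul, le_div_iff₀ (by positivity)]
    calc height w ^ 2 * (1 + ‖w‖ ^ 2) ^ (n + 1) ≤ (1 + ‖w‖ ^ 2) * (1 + ‖w‖ ^ 2) ^ (n + 1) := by
          gcongr
      _ = _ := by ring

theorem memLp_decayWeight_pow : MemLp (fun w => decayWeight w ^ (n + 2)) 2 (hypVolume n) := by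
  have hm : AEStronglyMeasurable (fun w : EuclideanSpace ℝ (Fin n) => decayWeight w ^ (n + 2))
      (hypVolume n) := (continuous_decayWeight.pow _).aestronglyMeasurable
  rw [memLp_two_iff_integrable_sq hm]
  refine integrable_decayWeight_pow.mono' (hm.pow 2) ?_
  filter_upwards [ae_mem_halfSpace] with w hw
  have q := decayWeight_pos hw
  rw [norm_of_nonneg (by positivity), pow_two]
  exact mul_le_of_le_one_right (by positivity) (pow_le_one₀ q.le decayWeight_le_one)

end HalfSpace

end

section

/-! ### Coordinate derivatives and integration by parts -/

section PartialDerivatives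

variable {n : ℕ} {F : Type*} [NormedAddCommGroup F] [NormedSpace ℝ F]

/-- The partial derivative in the `i`-th coordinate. -/
def pd (i : Fin n) (f : EuclideanSpace ℝ (Fin n) → F) (w : EuclideanSpace ℝ (Fin n)) : F :=
  fderiv ℝ f w (EuclideanSpace.single i 1)

theorem pd_eq_of_hasDerivAt {i : Fin n} {f : EuclideanSpace ℝ (Fin n) → F}
    {w : EuclideanSpace ℝ (Fin n)} {d : F} (hf : DifferentiableAt ℝ f w)
    (h : HasDerivAt (fun t : ℝ => f (w + t • EuclideanSpace.single i 1)) d 0) : pd i f w = d := by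
  have := hf.hasFDerivAt.hasLineDerivAt (EuclideanSpace.single i (1 : ℝ))
  exact HasDerivAt.unique this h

theorem pd_congr {i : Fin n} {f g : EuclideanSpace ℝ (Fin n) → F} {w : EuclideanSpace ℝ (Fin n)}
    (h : f =ᶠ[𝓝 w] g) : pd i f w = pd i g w := by
  simp only [pd, h.fderiv_eq]

theorem contDiffOn_pd (i : Fin n) {f : EuclideanSpace ℝ (Fin n) → F}
    {s : Set (EuclideanSpace ℝ (Fin n))} (hs : IsOpen s) (hf : ContDiffOn ℝ ∞ f s) :
    ContDiffOn ℝ ∞ (pd i f) s :=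
  (hf.fderiv_of_isOpen hs (m := ∞) le_rfl).clm_apply contDiffOn_const

theorem contDiff_pd (i : Fin n) {f : EuclideanSpace ℝ (Fin n) → F} (hf : ContDiff ℝ ∞ f) :
    ContDiff ℝ ∞ (pd i f) :=
  (hf.fderiv_right (m := ∞) le_rfl).clm_apply contDiff_const

theorem laplacian_eq_sum_pd {f : EuclideanSpace ℝ (Fin n) → F} {w : EuclideanSpace ℝ (Fin n)}
    (hf : ContDiffAt ℝ ∞ f w) : Laplacian.laplacian f w = ∑ i, pd i (pd i f) w := by
  rw [InnerProductSpace.laplacian_eq_iteratedFDeriv_orthonormalBasis f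
    (EuclideanSpace.basisFun (Fin n) ℝ)]
  refine Finset.sum_congr rfl fun i _ => ?_
  have hd : DifferentiableAt ℝ (fderiv ℝ f) w :=
    (hf.fderiv_right (m := ∞) le_rfl).differentiableAt (by simp)
  rw [iteratedFDeriv_two_apply]
  simp only [EuclideanSpace.basisFun_apply, Matrix.cons_val_zero, Matrix.cons_val_one]
  have : pd i f = fun x => fderiv ℝ f x (EuclideanSpace.single i 1) := rfl
  rw [pd, this, fderiv_clm_apply hd (differentiableAt_const _)]
  simp

theorem pd_mul {𝔸 : Type*} [NormedCommRing 𝔸] [NormedAlgebra ℝ 𝔸] (i : Fin n)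
    {f g : EuclideanSpace ℝ (Fin n) → 𝔸} {w : EuclideanSpace ℝ (Fin n)}
    (hf : DifferentiableAt ℝ f w) (hg : DifferentiableAt ℝ g w) :
    pd i (fun x => f x * g x) w = pd i f w * g w + f w * pd i g w := by
  simp only [pd]
  rw [fderiv_fun_mul hf hg]
  simp
  ring

theorem pd_clm_comp {G : Type*} [NormedAddCommGroup G] [NormedSpace ℝ G] (i : Fin n)
    (l : F →L[ℝ] G) {f : EuclideanSpace ℝ (Fin n) → F} {w : EuclideanSpace ℝ (Fin n)}
    (hf : DifferentiableAt ℝ f w) : pd i (fun x => l (f x)) w = l (pd i f w) := by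
  have : HasFDerivAt (fun x => l (f x)) (l.comp (fderiv ℝ f w)) w :=
    (l.hasFDerivAt (x := f w)).comp w hf.hasFDerivAt
  rw [pd, this.fderiv]
  rfl

theorem tsupport_pd_subset (i : Fin n) {f : EuclideanSpace ℝ (Fin n) → F} :
    tsupport (pd i f) ⊆ tsupport f := by
  refine (closure_minimal ?_ isClosed_closure).trans (tsupport_fderiv_subset ℝ (f := f))
  intro w hw
  refine subset_tsupport _ fun h => hw ?_
  simp [pd, h]

theorem integral_pd_eq_zero (i : Fin n) {f : EuclideanSpace ℝ (Fin n) → ℂ} (hf : ContDiff ℝ ∞ f)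
    (hc : HasCompactSupport f) : ∫ w, pd i f w = 0 := by
  have hi : Integrable (pd i f) :=
    (contDiff_pd i hf).continuous.integrable_of_hasCompactSupport
      (hc.mono' ((subset_tsupport _).trans (tsupport_pd_subset i)))
  have h0 := integral_mul_fderiv_eq_neg_fderiv_mul_of_integrable (μ := volume) (𝕜 := ℂ)
    (f := fun _ => 1) (g := f) (v := EuclideanSpace.single i 1) (by simp)
    (by simp only [one_mul]; exact hi)
    (by simp only [one_mul]; exact hf.continuous.integrable_of_hasCompactSupport hc)
    (fun x _ => differentiableAt_const _) (fun x _ => hf.differentiable (by simp) x)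
  simpa [pd] using h0

theorem contDiff_of_tsupport {f : EuclideanSpace ℝ (Fin n) → F}
    {U K : Set (EuclideanSpace ℝ (Fin n))} (hU : IsOpen U) (hK : IsClosed K) (hKU : K ⊆ U)
    (hf : ContDiffOn ℝ ∞ f U) (h0 : ∀ w ∉ K, f w = 0) : ContDiff ℝ ∞ f := by
  rw [contDiff_iff_contDiffAt]
  intro w
  by_cases hw : w ∈ U
  · exact hf.contDiffAt (hU.mem_nhds hw)
  · have : f =ᶠ[𝓝 w] fun _ => 0 := by
      filter_upwards [hK.isOpen_compl.mem_nhds fun h => hw (hKU h)] with x hx using h0 x hx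
    exact contDiffAt_const.congr_of_eventuallyEq this

end PartialDerivatives

/-! ### Symmetry and nonpositivity of 𝓛_n on test functions -/

section Test

variable {n : ℕ} [NeZero n]

theorem pd_height (i : Fin n) (w : EuclideanSpace ℝ (Fin n)) :
    pd i height w = if i = lastIdx n then 1 else 0 := by
  have h : HasFDerivAt height (EuclideanSpace.proj (𝕜 := ℝ) (lastIdx n)) w :=
    (EuclideanSpace.proj (𝕜 := ℝ) (lastIdx n)).hasFDerivAt
  rw [pd, h.fderiv]
  simp [eq_comm]

/-- The complex-valued height. -/
def heightC (w : EuclideanSpace ℝ (Fin n)) : ℂ := height w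

theorem contDiff_heightC : ContDiff ℝ ∞ (heightC : EuclideanSpace ℝ (Fin n) → ℂ) :=
  Complex.ofRealCLM.contDiff.comp contDiff_height

theorem pd_heightC (i : Fin n) (w : EuclideanSpace ℝ (Fin n)) :
    pd i heightC w = if i = lastIdx n then 1 else 0 := by
  have := pd_clm_comp i Complex.ofRealCLM (contDiff_height.differentiable (by simp) w)
  refine this.trans ?_
  rw [pd_height]
  split_ifs <;> simp

theorem heightC_ne_zero {w : EuclideanSpace ℝ (Fin n)} (hw : w ∈ halfSpace n) :
    heightC w ≠ 0 := by
  have : height w ≠ 0 := (mem_halfSpace.1 hw).ne'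
  exact Complex.ofReal_ne_zero.2 this

/-- The complex-valued density of the hyperbolic volume. -/
def densC (w : EuclideanSpace ℝ (Fin n)) : ℂ := (heightC w ^ n)⁻¹

theorem densC_eq (w : EuclideanSpace ℝ (Fin n)) : densC w = (volDensity w : ℂ) := by
  simp [densC, heightC, volDensity]

theorem contDiffOn_densC : ContDiffOn ℝ ∞ (densC : EuclideanSpace ℝ (Fin n) → ℂ) (halfSpace n) :=
  (contDiff_heightC.pow n).contDiffOn.inv fun _ hw => pow_ne_zero _ (heightC_ne_zero hw)

theorem pd_densC (i : Fin n) {w : EuclideanSpace ℝ (Fin n)} (hw : w ∈ halfSpace n) :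
    pd i densC w = if i = lastIdx n then -(n * densC w / heightC w) else 0 := by
  have hd : DifferentiableAt ℝ densC w :=
    (contDiffOn_densC.contDiffAt (isOpen_halfSpace.mem_nhds hw)).differentiableAt (by simp)
  have hh : DifferentiableAt ℝ heightC w := contDiff_heightC.differentiable (by simp) w
  have hp := hh.hasFDerivAt.pow n
  have hne := heightC_ne_zero hw
  have hi := (hasDerivAt_inv (pow_ne_zero n hne)).comp_hasFDerivAt (𝕜 := ℝ) w hp
  rw [pd, show densC = (fun x : ℂ => x⁻¹) ∘ fun x => heightC x ^ n from rfl, hi.fderiv]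
  have e := pd_heightC i w
  rw [pd] at e
  simp only [smul_apply, e]
  split_ifs
  · simp only [smul_eq_mul, nsmul_eq_mul]
    obtain ⟨m, hm⟩ := Nat.exists_eq_succ_of_ne_zero (NeZero.ne n)
    simp only [hm, Nat.succ_eq_add_one, Nat.add_sub_cancel]
    simp
    field_simp
    ring
  · simp

/-- Smooth functions with compact support in the half space. -/
theorem IsTest.contDiffOn_mul {φ f : EuclideanSpace ℝ (Fin n) → ℂ} (hφ : IsTest n φ)
    (hf : ContDiffOn ℝ ∞ f (halfSpace n)) : IsTest n (fun w => f w * φ w) := by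
  have hsupp : tsupport (fun w => f w * φ w) ⊆ tsupport φ := tsupport_mul_subset_right
  refine ⟨?_, hφ.2.1.mono' ((subset_tsupport _).trans hsupp), hsupp.trans hφ.2.2⟩
  refine contDiff_of_tsupport isOpen_halfSpace (isClosed_tsupport φ) hφ.2.2
    (hf.mul hφ.1.contDiffOn) fun w hw => ?_
  rw [image_eq_zero_of_notMem_tsupport hw, mul_zero]

theorem IsTest.pd {φ : EuclideanSpace ℝ (Fin n) → ℂ} (hφ : IsTest n φ) (i : Fin n) :
    IsTest n (pd i φ) :=
  ⟨contDiff_pd i hφ.1, hφ.2.1.mono' ((subset_tsupport _).trans (tsupport_pd_subset i)),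
    (tsupport_pd_subset i).trans hφ.2.2⟩

theorem IsTest.add {φ ψ : EuclideanSpace ℝ (Fin n) → ℂ} (hφ : IsTest n φ) (hψ : IsTest n ψ) :
    IsTest n (φ + ψ) :=
  ⟨hφ.1.add hψ.1, hφ.2.1.add hψ.2.1, (tsupport_add φ ψ).trans (union_subset hφ.2.2 hψ.2.2)⟩

theorem IsTest.const_mul {φ : EuclideanSpace ℝ (Fin n) → ℂ} (hφ : IsTest n φ) (c : ℂ) :
    IsTest n (fun w => c * φ w) := hφ.contDiffOn_mul contDiffOn_const

theorem IsTest.conj {φ : EuclideanSpace ℝ (Fin n) → ℂ} (hφ : IsTest n φ) :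
    IsTest n (fun w => (starRingEnd ℂ) (φ w)) := by
  have hs : tsupport (fun w => (starRingEnd ℂ) (φ w)) ⊆ tsupport φ :=
    closure_mono fun w hw h => hw (by simp [h])
  exact ⟨Complex.conjCLE.contDiff.comp hφ.1, hφ.2.1.mono' ((subset_tsupport _).trans hs),
    hs.trans hφ.2.2⟩

theorem IsTest.integrable {φ : EuclideanSpace ℝ (Fin n) → ℂ} (hφ : IsTest n φ) :
    Integrable φ volume := hφ.1.continuous.integrable_of_hasCompactSupport hφ.2.1

theorem IsTest.eq_zero {φ : EuclideanSpace ℝ (Fin n) → ℂ} (hφ : IsTest n φ)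
    {w : EuclideanSpace ℝ (Fin n)} (hw : w ∉ halfSpace n) : φ w = 0 :=
  image_eq_zero_of_notMem_tsupport fun h => hw (hφ.2.2 h)

theorem hypLap_eq {φ : EuclideanSpace ℝ (Fin n) → ℂ} {w : EuclideanSpace ℝ (Fin n)}
    (hφ : ContDiffAt ℝ ∞ φ w) :
    hypLap n φ w = heightC w ^ 2 * ∑ i, HypHeat.pd i (HypHeat.pd i φ) w
      + (2 - n) * heightC w * HypHeat.pd (lastIdx n) φ w + ((n : ℂ) - 1) ^ 2 / 4 * φ w := by
  rw [hypLap, laplacian_eq_sum_pd hφ]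
  simp [heightC, height, HypHeat.pd]

theorem IsTest.hypLap {φ : EuclideanSpace ℝ (Fin n) → ℂ} (hφ : IsTest n φ) :
    IsTest n (hypLap n φ) := by
  have e : HypHeat.hypLap n φ = fun w => heightC w ^ 2 * ∑ i, HypHeat.pd i (HypHeat.pd i φ) w
      + (2 - n) * heightC w * HypHeat.pd (lastIdx n) φ w + ((n : ℂ) - 1) ^ 2 / 4 * φ w :=
    funext fun w => hypLap_eq hφ.1.contDiffAt
  rw [e]
  have hsum : IsTest n (fun w => ∑ i, HypHeat.pd i (HypHeat.pd i φ) w) := by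
    have key : ∀ s : Finset (Fin n), IsTest n (fun w => ∑ i ∈ s, HypHeat.pd i (HypHeat.pd i φ) w) := by
      intro s
      induction s using Finset.induction_on with
      | empty => simpa using hφ.const_mul 0
      | insert i s hi ih =>
        simp only [Finset.sum_insert hi]
        exact ((hφ.pd i).pd i).add ih
    exact key _
  exact ((hsum.contDiffOn_mul (contDiff_heightC.pow 2).contDiffOn).add
    ((hφ.pd (lastIdx n)).contDiffOn_mul
      (contDiffOn_const.mul contDiff_heightC.contDiffOn))).add (hφ.const_mul _)

/-- The Dirichlet form of `𝓛_n`. -/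
theorem integral_mul_hypLap {φ ψ : EuclideanSpace ℝ (Fin n) → ℂ} (hφ : IsTest n φ)
    (hψ : IsTest n ψ) :
    ∫ w, ψ w * hypLap n φ w ∂(hypVolume n) =
      -(∑ i, ∫ w, densC w * heightC w ^ 2 * (HypHeat.pd i ψ w * HypHeat.pd i φ w))
        + ((n : ℂ) - 1) ^ 2 / 4 * ∫ w, densC w * (ψ w * φ w) := by
  have hW := contDiffOn_densC (n := n)
  have hy := (contDiff_heightC (n := n)).contDiffOn (s := halfSpace n)
  have hWy : ContDiffOn ℝ ∞ (fun w : EuclideanSpace ℝ (Fin n) => densC w * heightC w ^ 2)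
      (halfSpace n) := hW.mul (hy.pow 2)
  have hA : ∀ i, IsTest n fun w => densC w * heightC w ^ 2 * (ψ w * HypHeat.pd i φ w) := fun i =>
    ((hφ.pd i).contDiffOn_mul hψ.1.contDiffOn).contDiffOn_mul hWy
  have hB : ∀ i, IsTest n fun w => densC w * heightC w ^ 2 * (HypHeat.pd i ψ w * HypHeat.pd i φ w) :=
    fun i => ((hφ.pd i).contDiffOn_mul (hψ.pd i).1.contDiffOn).contDiffOn_mul hWy
  have hC : IsTest n fun w => densC w * (ψ w * φ w) :=
    (hφ.contDiffOn_mul hψ.1.contDiffOn).contDiffOn_mul hW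
  have hB' : Integrable fun w =>
      -∑ i, densC w * heightC w ^ 2 * (HypHeat.pd i ψ w * HypHeat.pd i φ w) :=
    (integrable_finsetSum _ fun i _ => (hB i).integrable).neg
  have h0 : ∑ i, ∫ w, HypHeat.pd i (fun w => densC w * heightC w ^ 2 * (ψ w * HypHeat.pd i φ w)) w = 0 :=
    Finset.sum_eq_zero fun i _ => integral_pd_eq_zero i (hA i).1 (hA i).2.1
  rw [← integral_finsetSum _ fun i _ => ((hA i).pd i).integrable] at h0
  rw [integral_hypVolume_of_support fun w hw => by rw [hψ.eq_zero hw, zero_mul],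
    ← integral_finsetSum _ fun i _ => (hB i).integrable, ← integral_const_mul, ← sub_eq_zero,
    ← h0, ← integral_neg, ← integral_add hB' (hC.integrable.const_mul _), ← integral_sub]
  · refine integral_congr_ae (ae_of_all _ fun w => ?_)
    simp only
    by_cases hw : w ∈ halfSpace n
    · have hne := heightC_ne_zero hw
      have dW : DifferentiableAt ℝ densC w :=
        (hW.contDiffAt (isOpen_halfSpace.mem_nhds hw)).differentiableAt (by simp)
      have dy : DifferentiableAt ℝ heightC w := contDiff_heightC.differentiable (by simp) w
      have dψ := hψ.1.differentiable (by simp) w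
      -- The derivative of y^{2-n} contributes (2 - n) y^{1-n}, precisely the first-order term: up
      -- to the constant, 𝓛_n is y^n div(y^{2-n} ∇).
      have e : ∀ i, HypHeat.pd i (fun w => densC w * heightC w ^ 2 * (ψ w * HypHeat.pd i φ w)) w =
          (if i = lastIdx n then (2 - n) * densC w * heightC w * (ψ w * HypHeat.pd i φ w) else 0) +
          densC w * heightC w ^ 2 * (HypHeat.pd i ψ w * HypHeat.pd i φ w) +
          densC w * heightC w ^ 2 * ψ w * HypHeat.pd i (HypHeat.pd i φ) w := by
        intro i
        have dφ := (hφ.pd i).1.differentiable (by simp) w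
        simp only [pow_two]
        rw [pd_mul i (dW.fun_mul (dy.fun_mul dy)) (dψ.fun_mul dφ), pd_mul i dW (dy.fun_mul dy),
          pd_mul i dy dy, pd_mul i dψ dφ, pd_heightC, pd_densC i hw]
        split_ifs
        · field_simp
          ring
        · ring
      simp only [e]
      rw [Finset.sum_add_distrib, Finset.sum_add_distrib, Finset.sum_ite_eq' , if_pos (Finset.mem_univ _),
        hypLap_eq hφ.1.contDiffAt, ← Finset.mul_sum Finset.univ (fun i => HypHeat.pd i (HypHeat.pd i φ) w),
        Complex.real_smul, ← densC_eq]
      ring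
    · have z1 := hψ.eq_zero hw
      have z2 := fun i => (hB i).eq_zero hw
      have z4 := fun i => ((hA i).pd i).eq_zero hw
      simp [z1, z2, z4]
  · exact (((hφ.hypLap.contDiffOn_mul hψ.1.contDiffOn).contDiffOn_mul hW).integrable).congr
      (ae_of_all _ fun w => by simp [densC_eq])
  · exact hB'.add (hC.integrable.const_mul _)

theorem integral_mul_hypLap_comm {φ ψ : EuclideanSpace ℝ (Fin n) → ℂ} (hφ : IsTest n φ)
    (hψ : IsTest n ψ) :
    ∫ w, ψ w * hypLap n φ w ∂(hypVolume n) = ∫ w, φ w * hypLap n ψ w ∂(hypVolume n) := by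
  rw [integral_mul_hypLap hφ hψ, integral_mul_hypLap hψ hφ]
  simp only [mul_comm]

theorem hypLap_conj {φ : EuclideanSpace ℝ (Fin n) → ℂ} (hφ : IsTest n φ)
    (w : EuclideanSpace ℝ (Fin n)) :
    hypLap n (fun w => (starRingEnd ℂ) (φ w)) w = (starRingEnd ℂ) (hypLap n φ w) := by
  have hp : ∀ {f : EuclideanSpace ℝ (Fin n) → ℂ}, ContDiff ℝ ∞ f → ∀ i,
      HypHeat.pd i (fun w => (starRingEnd ℂ) (f w)) = fun w => (starRingEnd ℂ) (HypHeat.pd i f w) :=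
    fun {f} hf i => funext fun w =>
      pd_clm_comp i (Complex.conjCLE : ℂ →L[ℝ] ℂ) (hf.differentiable (by simp) w)
  rw [hypLap_eq hφ.conj.1.contDiffAt, hypLap_eq hφ.1.contDiffAt]
  simp only [hp hφ.1, hp (contDiff_pd _ hφ.1), map_add, map_mul, map_sum, map_pow, map_sub, map_div₀,
    map_one, map_natCast, map_ofNat]
  simp [heightC]

omit [NeZero n] in
theorem pd_conj {f : EuclideanSpace ℝ (Fin n) → ℂ} (hf : ContDiff ℝ ∞ f) (i : Fin n) :
    pd i (fun w => (starRingEnd ℂ) (f w)) = fun w => (starRingEnd ℂ) (pd i f w) :=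
  funext fun w => pd_clm_comp i (Complex.conjCLE : ℂ →L[ℝ] ℂ) (hf.differentiable (by simp) w)

theorem re_integral_densC_mul_normSq_nonneg {f : EuclideanSpace ℝ (Fin n) → ℂ}
    (hf : ∀ w ∉ halfSpace n, f w = 0) :
    0 ≤ (∫ w, densC w * (starRingEnd ℂ (f w) * f w)).re := by
  have e : ∀ w, densC w * (starRingEnd ℂ (f w) * f w) =
      ((volDensity w * Complex.normSq (f w) : ℝ) : ℂ) := fun w => by
    rw [densC_eq, ← Complex.normSq_eq_conj_mul_self, Complex.ofReal_mul]
  simp only [e]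
  rw [integral_complex_ofReal, Complex.ofReal_re]
  refine integral_nonneg fun w => ?_
  by_cases hw : w ∈ halfSpace n
  · exact mul_nonneg (volDensity_nonneg hw) (Complex.normSq_nonneg _)
  · simp [hf w hw]

/-- Hardy's inequality: expanding ∫ y^{-n} |y ∂_yφ - aφ|² ≥ 0 with a = (n-1)/2 gives a² ∫ y^{-n}
|φ|² ≤ ∫ y^{2-n} |∂_yφ|². The vertical part of the Dirichlet form thus already absorbs the shift. -/
theorem re_integral_conj_mul_hypLap_nonpos {φ : EuclideanSpace ℝ (Fin n) → ℂ} (hφ : IsTest n φ) :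
    (∫ w, (starRingEnd ℂ) (φ w) * hypLap n φ w ∂(hypVolume n)).re ≤ 0 := by
  have hW := contDiffOn_densC (n := n)
  have hy := (contDiff_heightC (n := n)).contDiffOn (s := halfSpace n)
  have hc := hφ.conj
  set l := lastIdx n with hl
  set a : ℂ := ((n : ℂ) - 1) / 2 with ha
  set X : Fin n → ℂ := fun i =>
    ∫ w, densC w * heightC w ^ 2 * (starRingEnd ℂ (pd i φ w) * pd i φ w) with hX
  set B : ℂ := ∫ w, densC w * (starRingEnd ℂ (φ w) * φ w) with hB
  have e1 : ∫ w, (starRingEnd ℂ) (φ w) * hypLap n φ w ∂(hypVolume n) = -∑ i, X i + a ^ 2 * B := by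
    rw [integral_mul_hypLap hφ hc]
    simp only [pd_conj hφ.1, hX, hB, ha]
    ring
  have hXn : ∀ i, 0 ≤ (X i).re := fun i => by
    have := re_integral_densC_mul_normSq_nonneg (n := n) (f := fun w => heightC w * pd i φ w)
      fun w hw => by rw [(hφ.pd i).eq_zero hw, mul_zero]
    convert this using 4
    simp only [map_mul, heightC, Complex.conj_ofReal]
    ring
  have tD : IsTest n fun w =>
      densC w * heightC w * (starRingEnd ℂ (pd l φ w) * φ w + starRingEnd ℂ (φ w) * pd l φ w) :=
    ((hφ.contDiffOn_mul (hφ.pd l).conj.1.contDiffOn).add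
      ((hφ.pd l).contDiffOn_mul hc.1.contDiffOn)).contDiffOn_mul (hW.mul hy)
  have tB : IsTest n fun w => densC w * (starRingEnd ℂ (φ w) * φ w) :=
    (hφ.contDiffOn_mul hc.1.contDiffOn).contDiffOn_mul hW
  have tX : IsTest n fun w => densC w * heightC w ^ 2 * (starRingEnd ℂ (pd l φ w) * pd l φ w) :=
    ((hφ.pd l).contDiffOn_mul (hφ.pd l).conj.1.contDiffOn).contDiffOn_mul (hW.mul (hy.pow 2))
  have tE : IsTest n fun w => densC w * heightC w * (starRingEnd ℂ (φ w) * φ w) :=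
    (hφ.contDiffOn_mul hc.1.contDiffOn).contDiffOn_mul (hW.mul hy)
  -- The cross term is y^{1-n} ∂_y|φ|², and integration by parts moves the derivative onto the
  -- power, giving the factor n - 1 = 2a.
  have hD : ∫ w, densC w * heightC w *
      (starRingEnd ℂ (pd l φ w) * φ w + starRingEnd ℂ (φ w) * pd l φ w) = 2 * a * B := by
    have h0 := integral_pd_eq_zero l tE.1 tE.2.1
    rw [← sub_eq_zero, hB, ← integral_const_mul, ← h0,
      ← integral_sub tD.integrable (tB.integrable.const_mul _)]
    refine integral_congr_ae (ae_of_all _ fun w => ?_)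
    simp only
    by_cases hw : w ∈ halfSpace n
    · have hne := heightC_ne_zero hw
      have dW : DifferentiableAt ℝ densC w :=
        (hW.contDiffAt (isOpen_halfSpace.mem_nhds hw)).differentiableAt (by simp)
      have dy : DifferentiableAt ℝ heightC w := contDiff_heightC.differentiable (by simp) w
      have dφ := hφ.1.differentiable (by simp) w
      have dc := hc.1.differentiable (by simp) w
      rw [pd_mul l (dW.fun_mul dy) (dc.fun_mul dφ), pd_mul l dW dy, pd_mul l dc dφ, pd_heightC,
        pd_densC l hw, if_pos hl, if_pos hl, pd_conj hφ.1, ha]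
      field_simp
      ring
    · have z1 := hφ.eq_zero hw
      have z2 := (tE.pd l).eq_zero hw
      rw [z2, z1]
      simp
  have hS : ∫ w, densC w * (starRingEnd ℂ (heightC w * pd l φ w - a * φ w) *
      (heightC w * pd l φ w - a * φ w)) = X l - a * (2 * a * B) + a ^ 2 * B := by
    rw [← hD, hX, hB, ← integral_const_mul, ← integral_const_mul,
      ← integral_sub tX.integrable (tD.integrable.const_mul _),
      ← integral_add (show Integrable (fun w => _ - _) _ from
        tX.integrable.sub (tD.integrable.const_mul a)) (tB.integrable.const_mul _)]
    refine integral_congr_ae (ae_of_all _ fun w => ?_)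
    have hca : starRingEnd ℂ a = a := by
      simp only [ha, map_div₀, map_sub, map_natCast, map_one, map_ofNat]
    simp only [map_sub, map_mul, hca, heightC, Complex.conj_ofReal]
    ring
  have hpos := re_integral_densC_mul_normSq_nonneg (n := n)
    (f := fun w => heightC w * pd l φ w - a * φ w)
    fun w hw => by rw [(hφ.pd l).eq_zero hw, hφ.eq_zero hw, mul_zero, mul_zero, sub_zero]
  rw [hS] at hpos
  have hsum : (X l).re ≤ (∑ i, X i).re := by
    rw [Complex.re_sum]
    exact Finset.single_le_sum (fun i _ => hXn i) (Finset.mem_univ l)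
  rw [e1]
  have e2 : X l - a * (2 * a * B) + a ^ 2 * B = X l - a ^ 2 * B := by ring
  rw [e2, Complex.sub_re] at hpos
  rw [Complex.add_re, Complex.neg_re]
  linarith

end Test

end

section

/-! ### The graph of 𝓛_n and its closure -/

section Graph

variable {n : ℕ} [NeZero n]

theorem IsTest.memLp {φ : EuclideanSpace ℝ (Fin n) → ℂ} (hφ : IsTest n φ) :
    MemLp φ 2 (hypVolume n) := by
  rw [memLp_two_iff_integrable_sq_norm hφ.1.continuous.aestronglyMeasurable]
  have hs : tsupport (fun w => ‖φ w‖ ^ 2) ⊆ tsupport φ :=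
    closure_mono fun w hw h => hw (by simp [h])
  exact integrable_of_isTest (hφ.1.continuous.norm.pow 2)
    (hφ.2.1.mono' ((subset_tsupport _).trans hs)) (hs.trans hφ.2.2)

/-- A test function as an element of `L²`. -/
def IsTest.toL2 {φ : EuclideanSpace ℝ (Fin n) → ℂ} (hφ : IsTest n φ) : L2 n := hφ.memLp.toLp φ

theorem IsTest.coeFn_toL2 {φ : EuclideanSpace ℝ (Fin n) → ℂ} (hφ : IsTest n φ) :
    hφ.toL2 =ᵐ[hypVolume n] φ := hφ.memLp.coeFn_toLp

theorem IsTest.mem_lapGraph {φ : EuclideanSpace ℝ (Fin n) → ℂ} (hφ : IsTest n φ) :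
    (hφ.toL2, hφ.hypLap.toL2) ∈ lapGraph n := ⟨φ, hφ, hφ.coeFn_toL2, hφ.hypLap.coeFn_toL2⟩

theorem isTest_zero : IsTest n 0 :=
  ⟨contDiff_const, HasCompactSupport.zero, by simp⟩

omit [NeZero n] in
theorem pd_add (i : Fin n) {φ ψ : EuclideanSpace ℝ (Fin n) → ℂ} (hφ : ContDiff ℝ ∞ φ)
    (hψ : ContDiff ℝ ∞ ψ) : pd i (φ + ψ) = pd i φ + pd i ψ := by
  funext w
  simp only [pd, Pi.add_apply]
  rw [fderiv_add (hφ.differentiable (by simp) w) (hψ.differentiable (by simp) w)]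
  rfl

omit [NeZero n] in
theorem pd_const_mul (i : Fin n) {φ : EuclideanSpace ℝ (Fin n) → ℂ} (hφ : ContDiff ℝ ∞ φ) (c : ℂ) :
    pd i (fun w => c * φ w) = fun w => c * pd i φ w := by
  funext w
  simp only [pd]
  rw [fderiv_const_mul (hφ.differentiable (by simp) w)]
  rfl

theorem hypLap_add {φ ψ : EuclideanSpace ℝ (Fin n) → ℂ} (hφ : IsTest n φ) (hψ : IsTest n ψ) :
    hypLap n (φ + ψ) = hypLap n φ + hypLap n ψ := by
  funext w
  rw [Pi.add_apply, hypLap_eq (hφ.add hψ).1.contDiffAt, hypLap_eq hφ.1.contDiffAt,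
    hypLap_eq hψ.1.contDiffAt]
  simp only [pd_add _ hφ.1 hψ.1, pd_add _ (contDiff_pd _ hφ.1) (contDiff_pd _ hψ.1), Pi.add_apply,
    Finset.sum_add_distrib]
  ring

theorem hypLap_const_mul {φ : EuclideanSpace ℝ (Fin n) → ℂ} (hφ : IsTest n φ) (c : ℂ) :
    hypLap n (fun w => c * φ w) = fun w => c * hypLap n φ w := by
  funext w
  rw [hypLap_eq (hφ.const_mul c).1.contDiffAt, hypLap_eq hφ.1.contDiffAt]
  simp only [pd_const_mul _ hφ.1, pd_const_mul _ (contDiff_pd _ hφ.1), ← Finset.mul_sum]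
  ring

/-- The graph of `𝓛_n` on test functions, as a subspace. -/
def lapSubmodule (n : ℕ) [NeZero n] : Submodule ℂ (L2 n × L2 n) where
  carrier := lapGraph n
  zero_mem' := ⟨0, isTest_zero, Lp.coeFn_zero _ _ _, by
    have e : hypLap n 0 = 0 := by
      funext w
      have := congrFun (hypLap_const_mul (n := n) isTest_zero 0) w
      simp only [zero_mul] at this
      exact this
    rw [e]
    exact Lp.coeFn_zero _ _ _⟩
  add_mem' := by
    rintro p q ⟨φ, hφ, h1, h2⟩ ⟨ψ, hψ, h3, h4⟩
    refine ⟨φ + ψ, hφ.add hψ, (Lp.coeFn_add _ _).trans (h1.add h3), ?_⟩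
    rw [hypLap_add hφ hψ]
    exact (Lp.coeFn_add _ _).trans (h2.add h4)
  smul_mem' := by
    rintro c p ⟨φ, hφ, h1, h2⟩
    refine ⟨fun w => c * φ w, hφ.const_mul c, (Lp.coeFn_smul _ _).trans (h1.const_smul c), ?_⟩
    rw [hypLap_const_mul hφ c]
    exact (Lp.coeFn_smul _ _).trans (h2.const_smul c)

theorem inner_eq_integral {f g : L2 n} {φ ψ : EuclideanSpace ℝ (Fin n) → ℂ}
    (hf : f =ᵐ[hypVolume n] φ) (hg : g =ᵐ[hypVolume n] ψ) :
    inner ℂ f g = ∫ w, starRingEnd ℂ (φ w) * ψ w ∂(hypVolume n) := by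
  rw [MeasureTheory.L2.inner_def]
  refine integral_congr_ae ?_
  filter_upwards [hf, hg] with w h1 h2
  rw [RCLike.inner_apply', h1, h2]

theorem inner_symm_of_mem_lapGraph {p q : L2 n × L2 n} (hp : p ∈ lapGraph n) (hq : q ∈ lapGraph n) :
    inner ℂ p.2 q.1 = inner ℂ p.1 q.2 := by
  obtain ⟨φ, hφ, h1, h2⟩ := hp
  obtain ⟨ψ, hψ, h3, h4⟩ := hq
  rw [inner_eq_integral h2 h3, inner_eq_integral h1 h4]
  simp only [← hypLap_conj hφ]
  rw [integral_mul_hypLap_comm hψ hφ.conj]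
  simp only [mul_comm]

theorem inner_symm_of_mem_closure {p q : L2 n × L2 n} (hp : p ∈ closure (lapGraph n))
    (hq : q ∈ closure (lapGraph n)) : inner ℂ p.2 q.1 = inner ℂ p.1 q.2 := by
  have h1 : ∀ q' ∈ lapGraph n, closure (lapGraph n) ⊆
      {p | inner ℂ p.2 q'.1 = inner ℂ p.1 q'.2} := fun q' hq' =>
    closure_minimal (fun p' hp' => inner_symm_of_mem_lapGraph hp' hq')
      (isClosed_eq (by fun_prop) (by fun_prop))
  have h2 : closure (lapGraph n) ⊆ {q | inner ℂ p.2 q.1 = inner ℂ p.1 q.2} :=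
    closure_minimal (fun q' hq' => h1 q' hq' hp) (isClosed_eq (by fun_prop) (by fun_prop))
  exact h2 hq

theorem re_inner_nonpos_of_mem_closure {p : L2 n × L2 n} (hp : p ∈ closure (lapGraph n)) :
    (inner ℂ p.1 p.2).re ≤ 0 := by
  have h : closure (lapGraph n) ⊆ {p | (inner ℂ p.1 p.2).re ≤ 0} := by
    refine closure_minimal ?_ (isClosed_le (Complex.continuous_re.comp (by fun_prop))
      continuous_const)
    rintro p ⟨φ, hφ, h1, h2⟩
    rw [mem_ofPred_eq, inner_eq_integral h1 h2]
    exact re_integral_conj_mul_hypLap_nonpos hφ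
  exact h hp

theorem hypLap_congr {f g : EuclideanSpace ℝ (Fin n) → ℂ} {w : EuclideanSpace ℝ (Fin n)}
    (h : f =ᶠ[𝓝 w] g) : hypLap n f w = hypLap n g w := by
  rw [hypLap, hypLap, h.fderiv_eq, h.eq_of_nhds, (InnerProductSpace.laplacian_congr_nhds h).eq_of_nhds]

end Graph

/-! ### 𝓛_n on functions of the distance -/

section Radial

variable {n : ℕ} [NeZero n]

/-- The first partial derivatives of `coshDist w₀`. -/
def coshDistGrad (w₀ : EuclideanSpace ℝ (Fin n)) (i : Fin n) (w : EuclideanSpace ℝ (Fin n)) : ℝ :=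
  (w i - w₀ i) / (height w₀ * height w) -
    if i = lastIdx n then ‖w - w₀‖ ^ 2 / (2 * height w₀ * height w ^ 2) else 0

/-- The second partial derivatives of `coshDist w₀`. -/
def coshDistHess (w₀ : EuclideanSpace ℝ (Fin n)) (i : Fin n) (w : EuclideanSpace ℝ (Fin n)) : ℝ :=
  1 / (height w₀ * height w) -
    if i = lastIdx n then 2 * (w i - w₀ i) / (height w₀ * height w ^ 2) -
      ‖w - w₀‖ ^ 2 / (height w₀ * height w ^ 3) else 0

theorem height_line (w : EuclideanSpace ℝ (Fin n)) (i : Fin n) (t : ℝ) :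
    height (w + t • EuclideanSpace.single i 1) = height w + if i = lastIdx n then t else 0 := by
  simp [height, eq_comm]

omit [NeZero n] in
theorem norm_sub_line (w w₀ : EuclideanSpace ℝ (Fin n)) (i : Fin n) (t : ℝ) :
    ‖w + t • EuclideanSpace.single i 1 - w₀‖ ^ 2 = ‖w - w₀‖ ^ 2 + 2 * t * (w i - w₀ i) + t ^ 2 := by
  rw [add_sub_right_comm, norm_add_sq_real, inner_smul_right, norm_smul,
    EuclideanSpace.inner_single_right]
  simp
  ring

theorem hasDerivAt_height_line (w : EuclideanSpace ℝ (Fin n)) (i : Fin n) :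
    HasDerivAt (fun t : ℝ => height (w + t • EuclideanSpace.single i 1))
      (if i = lastIdx n then 1 else 0) 0 := by
  simp only [height_line]
  split_ifs
  · exact (hasDerivAt_id _).const_add _
  · simpa using hasDerivAt_const _ _

omit [NeZero n] in
theorem hasDerivAt_norm_sub_line (w w₀ : EuclideanSpace ℝ (Fin n)) (i : Fin n) :
    HasDerivAt (fun t : ℝ => ‖w + t • EuclideanSpace.single i 1 - w₀‖ ^ 2)
      (2 * (w i - w₀ i)) 0 := by
  simp only [norm_sub_line]
  have h := ((((hasDerivAt_id (0 : ℝ)).const_mul 2).mul_const (w i - w₀ i)).const_add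
    (‖w - w₀‖ ^ 2)).add ((hasDerivAt_id (0 : ℝ)).pow 2)
  exact h.congr_deriv (by simp)

theorem pd_coshDist {w₀ w : EuclideanSpace ℝ (Fin n)} (hw₀ : w₀ ∈ halfSpace n)
    (hw : w ∈ halfSpace n) (i : Fin n) : pd i (coshDist w₀) w = coshDistGrad w₀ i w := by
  have p0 : 0 < height w₀ := hw₀
  have p : 0 < height w := hw
  refine pd_eq_of_hasDerivAt (((contDiffOn_coshDist hw₀).contDiffAt
    (isOpen_halfSpace.mem_nhds hw)).differentiableAt (by simp)) ?_
  have h := ((hasDerivAt_norm_sub_line w w₀ i).div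
    (((hasDerivAt_height_line w i).const_mul (height w₀)).const_mul 2)
    (by simp; exact ⟨p0.ne', p.ne'⟩)).const_add 1
  simp only [zero_smul, add_zero] at h
  have e : (fun t : ℝ => coshDist w₀ (w + t • EuclideanSpace.single i 1)) = fun t : ℝ =>
      1 + ‖w + t • EuclideanSpace.single i 1 - w₀‖ ^ 2 /
        (2 * (height w₀ * height (w + t • EuclideanSpace.single i 1))) := by
    funext t
    rw [coshDist, norm_sub_rev]
  rw [e]
  refine h.congr_deriv ?_
  unfold coshDistGrad
  split_ifs
  · field_simp
  · field_simp
    ring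

theorem pd_coshDistGrad {w₀ w : EuclideanSpace ℝ (Fin n)} (hw₀ : w₀ ∈ halfSpace n)
    (hw : w ∈ halfSpace n) (i : Fin n)
    (hd : DifferentiableAt ℝ (coshDistGrad w₀ i) w) :
    pd i (coshDistGrad w₀ i) w = coshDistHess w₀ i w := by
  have p0 : 0 < height w₀ := hw₀
  have p : 0 < height w := hw
  refine pd_eq_of_hasDerivAt hd ?_
  have hc : HasDerivAt (fun t : ℝ => (w + t • EuclideanSpace.single i (1 : ℝ)) i - w₀ i) 1 0 := by
    have := ((hasDerivAt_id (0 : ℝ)).const_add (w i)).sub_const (w₀ i)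
    refine this.congr_of_eventuallyEq (Eventually.of_forall fun t => ?_)
    simp
  have h1 := hc.div ((hasDerivAt_height_line w i).const_mul (height w₀))
    (by simp; exact ⟨p0.ne', p.ne'⟩)
  have h2 := (hasDerivAt_norm_sub_line w w₀ i).div
    (((hasDerivAt_height_line w i).pow 2).const_mul (2 * height w₀))
    (by simp; exact ⟨p0.ne', p.ne'⟩)
  simp only [zero_smul, add_zero] at h1 h2
  have e : coshDistGrad w₀ i = fun w => (w i - w₀ i) / (height w₀ * height w) -
    if i = lastIdx n then ‖w - w₀‖ ^ 2 / (2 * height w₀ * height w ^ 2) else 0 := rfl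
  rw [e]
  unfold coshDistHess
  split_ifs with hi
  · simp only [hi, if_true] at h1 h2 ⊢
    refine (h1.sub h2).congr_deriv ?_
    simp only [Pi.pow_apply, zero_smul, add_zero]
    field_simp
    ring
  · simp only [hi, if_false, sub_zero] at h1 ⊢
    refine h1.congr_deriv ?_
    field_simp
    ring

/-- In the hyperbolic metric |∇ρ| = 1, so |∇ cosh ρ|² = sinh² ρ. -/
theorem sum_coshDistGrad_sq {w₀ w : EuclideanSpace ℝ (Fin n)} (hw₀ : w₀ ∈ halfSpace n)
    (hw : w ∈ halfSpace n) :
    height w ^ 2 * ∑ i, coshDistGrad w₀ i w ^ 2 = coshDist w₀ w ^ 2 - 1 := by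
  have p0 : 0 < height w₀ := hw₀
  have p : 0 < height w := hw
  have hN : ∑ i, (w i - w₀ i) ^ 2 = ‖w - w₀‖ ^ 2 := by
    rw [EuclideanSpace.norm_sq_eq]
    simp
  have e : ∀ i, coshDistGrad w₀ i w ^ 2 = (w i - w₀ i) ^ 2 / (height w₀ * height w) ^ 2 +
      if i = lastIdx n then
        (‖w - w₀‖ ^ 2 / (2 * height w₀ * height w ^ 2)) ^ 2 -
          2 * ((height w - height w₀) / (height w₀ * height w)) *
            (‖w - w₀‖ ^ 2 / (2 * height w₀ * height w ^ 2)) else 0 := by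
    intro i
    unfold coshDistGrad
    split_ifs with h
    · rw [h]
      change ((height w - height w₀) / _ - _) ^ 2 = (height w - height w₀) ^ 2 / _ + _
      ring
    · simp [div_pow]
  simp only [e]
  rw [Finset.sum_add_distrib, ← Finset.sum_div, hN, Finset.sum_ite_eq', if_pos (Finset.mem_univ _),
    coshDist, norm_sub_rev w₀]
  field_simp
  ring

/-- This is the eigenvalue equation Δ cosh ρ = n cosh ρ for the unshifted hyperbolic Laplacian. -/
theorem sum_coshDistHess {w₀ w : EuclideanSpace ℝ (Fin n)} (hw₀ : w₀ ∈ halfSpace n)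
    (hw : w ∈ halfSpace n) :
    height w ^ 2 * ∑ i, coshDistHess w₀ i w +
      (2 - n) * height w * coshDistGrad w₀ (lastIdx n) w = n * coshDist w₀ w := by
  have p0 : 0 < height w₀ := hw₀
  have p : 0 < height w := hw
  have e : ∀ i, coshDistHess w₀ i w = 1 / (height w₀ * height w) -
      if i = lastIdx n then 2 * (height w - height w₀) / (height w₀ * height w ^ 2) -
      ‖w - w₀‖ ^ 2 / (height w₀ * height w ^ 3) else 0 := by
    intro i
    unfold coshDistHess
    split_ifs with h
    · rw [h]; rfl
    · rfl
  simp only [e]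
  rw [Finset.sum_sub_distrib, Finset.sum_const, Finset.sum_ite_eq', if_pos (Finset.mem_univ _),
    coshDist, norm_sub_rev w₀, coshDistGrad, if_pos rfl]
  change height w ^ 2 * _ + (2 - n) * height w * ((height w - height w₀) / _ - _) = _
  simp only [Finset.card_univ, Fintype.card_fin, nsmul_eq_mul]
  field_simp
  ring

/-- The radial part of `𝓛_n`, in the variable `cosh` of the distance. -/
def radialOp (n : ℕ) (k k₁ k₂ : ℝ → ℝ) (z : ℝ) : ℝ :=
  (z ^ 2 - 1) * k₂ z + n * z * k₁ z + ((n : ℝ) - 1) ^ 2 / 4 * k z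

/-- By the chain rule k'' is multiplied by |∇ cosh ρ|² and k' by Δ cosh ρ, both given by the two
identities above. -/
theorem hypLap_radial {w₀ w : EuclideanSpace ℝ (Fin n)} (hw₀ : w₀ ∈ halfSpace n)
    (hw : w ∈ halfSpace n) {k k₁ k₂ : ℝ → ℝ} (hs : ContDiffOn ℝ ∞ k (Ioi 0))
    (h1 : ∀ z, 0 < z → HasDerivAt k (k₁ z) z) (h2 : ∀ z, 0 < z → HasDerivAt k₁ (k₂ z) z) :
    hypLap n (fun w => (k (coshDist w₀ w) : ℂ)) w = (radialOp n k k₁ k₂ (coshDist w₀ w) : ℝ) := by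
  have hn : ∀ {w}, w ∈ halfSpace n → halfSpace n ∈ 𝓝 w := fun h => isOpen_halfSpace.mem_nhds h
  have hz : ∀ {w}, w ∈ halfSpace n → DifferentiableAt ℝ (coshDist w₀) w := fun h =>
    ((contDiffOn_coshDist hw₀).contDiffAt (hn h)).differentiableAt (by simp)
  have hp := fun {w} (h : w ∈ halfSpace n) => coshDist_pos hw₀ h
  have chain : ∀ {f f' : ℝ → ℝ}, (∀ z, 0 < z → HasDerivAt f (f' z) z) → ∀ {w}, w ∈ halfSpace n →
      HasFDerivAt (fun w => f (coshDist w₀ w)) (f' (coshDist w₀ w) • fderiv ℝ (coshDist w₀) w) w :=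
    fun hf w h => (hf _ (hp h)).comp_hasFDerivAt w (hz h).hasFDerivAt
  have cpd : ∀ {f f' : ℝ → ℝ}, (∀ z, 0 < z → HasDerivAt f (f' z) z) → ∀ {w}, w ∈ halfSpace n →
      ∀ i, pd i (fun w => f (coshDist w₀ w)) w = f' (coshDist w₀ w) * coshDistGrad w₀ i w := by
    intro f f' hf w h i
    rw [← pd_coshDist hw₀ h, pd, (chain hf h).fderiv]
    rfl
  have hgd : ∀ i, DifferentiableAt ℝ (coshDistGrad w₀ i) w := fun i => by
    have e : pd i (coshDist w₀) =ᶠ[𝓝 w] coshDistGrad w₀ i := by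
      filter_upwards [hn hw] with x hx using pd_coshDist hw₀ hx i
    exact (((contDiffOn_pd i isOpen_halfSpace (contDiffOn_coshDist hw₀)).contDiffAt
      (hn hw)).differentiableAt (by simp)).congr_of_eventuallyEq e.symm
  have c1 : ∀ {w}, w ∈ halfSpace n → ∀ i, pd i (fun w => (k (coshDist w₀ w) : ℂ)) w =
      ((k₁ (coshDist w₀ w) * coshDistGrad w₀ i w : ℝ) : ℂ) := fun {w} h i => by
    rw [← cpd h1 h i]
    exact pd_clm_comp i Complex.ofRealCLM (chain h1 h).differentiableAt
  have c2 : ∀ i, pd i (pd i fun w => (k (coshDist w₀ w) : ℂ)) w =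
      ((k₂ (coshDist w₀ w) * coshDistGrad w₀ i w ^ 2 +
        k₁ (coshDist w₀ w) * coshDistHess w₀ i w : ℝ) : ℂ) := by
    intro i
    have e : (pd i fun w => (k (coshDist w₀ w) : ℂ)) =ᶠ[𝓝 w]
        fun w => ((k₁ (coshDist w₀ w) * coshDistGrad w₀ i w : ℝ) : ℂ) := by
      filter_upwards [hn hw] with x hx using c1 hx i
    rw [pd_congr e]
    refine (pd_clm_comp i Complex.ofRealCLM
      ((chain h2 hw).differentiableAt.fun_mul (hgd i))).trans ?_
    rw [pd_mul i (chain h2 hw).differentiableAt (hgd i), cpd h2 hw,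
      pd_coshDistGrad hw₀ hw i (hgd i)]
    simp only [Complex.ofRealCLM_apply]
    congr 1
    ring
  have hcd : ContDiffAt ℝ ∞ (fun w => (k (coshDist w₀ w) : ℂ)) w :=
    Complex.ofRealCLM.contDiff.contDiffAt.comp w ((hs.contDiffAt (Ioi_mem_nhds (hp hw))).comp w
      ((contDiffOn_coshDist hw₀).contDiffAt (hn hw)))
  rw [hypLap_eq hcd, c1 hw]
  simp only [c2]
  rw [← Complex.ofReal_sum, heightC]
  norm_cast
  have s1 := sum_coshDistGrad_sq hw₀ hw
  have s2 := sum_coshDistHess hw₀ hw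
  rw [Finset.sum_add_distrib, ← Finset.mul_sum, ← Finset.mul_sum, radialOp, ← s1]
  push_cast
  have s3 : (n : ℝ) * coshDist w₀ w * k₁ (coshDist w₀ w) = (n * coshDist w₀ w) * k₁ (coshDist w₀ w) :=
    rfl
  rw [s3, ← s2]
  ring

end Radial

end

/-! ### Rapidly decaying radial functions lie in the domain of the closure -/

section

/-- The inequality |1 - η(x)| ≤ x turns the error of the cutoff η(z / j) into z / j: one extra power
of z buys the factor 1 / j. -/
theorem exists_cutoff : ∃ (η : ℝ → ℝ) (M : ℝ), ContDiff ℝ ∞ η ∧ (∀ x, 2 ≤ x → η x = 0) ∧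
    (∀ x, 0 ≤ x → |1 - η x| ≤ x) ∧ 0 ≤ M ∧ (∀ x, |deriv η x| ≤ M) ∧
    ∀ x, |deriv (deriv η) x| ≤ M := by
  let η : ContDiffBump (0 : ℝ) := ⟨1, 2, one_pos, by norm_num⟩
  have h0 : ContDiff ℝ ∞ η := η.contDiff
  have h1 : ContDiff ℝ ∞ (deriv η) := contDiff_infty_iff_deriv.1 h0 |>.2
  have c0 : HasCompactSupport η := η.hasCompactSupport
  obtain ⟨M1, hM1⟩ := h1.continuous.bounded_above_of_compact_support c0.deriv
  obtain ⟨M2, hM2⟩ := (contDiff_infty_iff_deriv.1 h1).2.continuous.bounded_above_of_compact_support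
    c0.deriv.deriv
  refine ⟨η, max M1 M2, h0, fun x hx => η.zero_of_le_dist ?_, fun x hx => ?_,
    (abs_nonneg _).trans ((hM1 0).trans (le_max_left _ _)),
    fun x => (hM1 x).trans (le_max_left _ _), fun x => (hM2 x).trans (le_max_right _ _)⟩
  · rw [dist_zero_right]
    exact hx.trans (le_abs_self x)
  · by_cases h : x ≤ 1
    · rw [η.one_of_mem_closedBall (by simp [η, abs_of_nonneg hx, h]), sub_self, abs_zero]
      exact hx
    · rw [abs_of_nonneg (by linarith [η.le_one (x := x)])]
      linarith [η.nonneg (x := x)]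

variable {n : ℕ} [NeZero n]

theorem norm_le_of_ae_le_decayWeight {f : L2 n} {C : ℝ}
    (h : ∀ᵐ w ∂(hypVolume n), ‖f w‖ ≤ C * decayWeight w ^ (n + 2)) :
    ‖f‖ ≤ C * ‖(memLp_decayWeight_pow (n := n)).toLp _‖ := by
  refine Lp.norm_le_mul_norm_of_ae_le_mul ?_
  filter_upwards [h, (memLp_decayWeight_pow (n := n)).coeFn_toLp, ae_mem_halfSpace] with w h1 h2 h3
  rw [h2, norm_of_nonneg (pow_nonneg (decayWeight_pos h3).le _)]
  exact h1

/-- A smooth function of the distance vanishing near infinity, as a test function. -/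
theorem isTest_radial {w₀ : EuclideanSpace ℝ (Fin n)} (hw₀ : w₀ ∈ halfSpace n) {k : ℝ → ℝ}
    (hs : ContDiffOn ℝ ∞ k (Ioi 0)) {j : ℝ} (hj : 0 < j) (h0 : ∀ z, j ≤ z → k z = 0) :
    IsTest n ((halfSpace n).indicator fun w => (k (coshDist w₀ w) : ℂ)) := by
  have p0 : 0 < height w₀ := hw₀
  -- If cosh of the distance is below j, then y₀² + y² ≤ (2 + 2j) y₀ y. Hence the heights are
  -- comparable up to 2 + 2j, and this also bounds the Euclidean distance.
  set K : Set (EuclideanSpace ℝ (Fin n)) :=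
    {w | height w₀ / (2 + 2 * j) ≤ height w} ∩ Metric.closedBall w₀ ((2 + 2 * j) * height w₀) with hK
  have hKc : IsCompact K :=
    (isCompact_closedBall _ _).inter_left (isClosed_le continuous_const continuous_height)
  have hKs : K ⊆ halfSpace n := fun w hw => (div_pos p0 (by positivity)).trans_le hw.1
  have hz : ∀ w ∉ K, (halfSpace n).indicator (fun w => (k (coshDist w₀ w) : ℂ)) w = 0 := by
    intro w hw
    by_contra hne
    rw [← Ne, ← Function.mem_support, support_indicator] at hne
    obtain ⟨h1, h2⟩ := hne
    have p : 0 < height w := h1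
    have hlt : coshDist w₀ w < j := by
      by_contra h
      exact h2 (by simp [h0 _ (not_lt.1 h)])
    have hN : ‖w₀ - w‖ ^ 2 ≤ 2 * j * (height w₀ * height w) := by
      have : ‖w₀ - w‖ ^ 2 / (2 * (height w₀ * height w)) ≤ j := by
        unfold coshDist at hlt
        linarith
      rw [div_le_iff₀ (by positivity)] at this
      linarith
    have hd := height_sub_sq_le w₀ w
    have hS : height w₀ ^ 2 + height w ^ 2 ≤ (2 + 2 * j) * (height w₀ * height w) := by
      nlinarith
    have ha : height w₀ ≤ (2 + 2 * j) * height w := by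
      nlinarith [sq_nonneg (height w)]
    have hb : height w ≤ (2 + 2 * j) * height w₀ := by
      nlinarith [sq_nonneg (height w₀)]
    refine hw ⟨?_, ?_⟩
    · rw [mem_ofPred_eq, div_le_iff₀ (by positivity), mul_comm]
      exact ha
    · rw [mem_closedBall_iff_norm', ← sq_le_sq₀ (norm_nonneg _) (by positivity)]
      calc ‖w₀ - w‖ ^ 2 ≤ 2 * j * (height w₀ * height w) := hN
        _ ≤ (2 + 2 * j) * (height w₀ * ((2 + 2 * j) * height w₀)) := by
            gcongr
            linarith
        _ = _ := by ring
  have hsupp : tsupport ((halfSpace n).indicator fun w => (k (coshDist w₀ w) : ℂ)) ⊆ K :=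
    closure_minimal (fun w hw => by_contra fun h => hw (hz w h)) hKc.isClosed
  refine ⟨contDiff_of_tsupport isOpen_halfSpace hKc.isClosed hKs ?_ hz,
    HasCompactSupport.of_support_subset_isCompact hKc ((subset_tsupport _).trans hsupp),
    hsupp.trans hKs⟩
  have : ContDiffOn ℝ ∞ (fun w => (k (coshDist w₀ w) : ℂ)) (halfSpace n) :=
    Complex.ofRealCLM.contDiff.comp_contDiffOn (hs.comp (contDiffOn_coshDist hw₀)
      fun w hw => coshDist_pos hw₀ hw)
  exact this.congr fun w hw => indicator_of_mem hw _

/-- The exponent n + 5 = (n + 2) + 3 leaves three powers of z to spend: two for the coefficient z² -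
1 and one for the cutoff error z / j. Terms with a derivative of the cutoff carry 1 / j already. -/
theorem radialOp_cutoff_error {C M j z : ℝ} (hM : 0 ≤ M) (hj : 1 ≤ j)
    (hz : 1 ≤ z) {η₀ η₁ η₂ : ℝ} (e0 : |1 - η₀| ≤ z / j) (e1 : |η₁| ≤ M) (e2 : |η₂| ≤ M)
    {a a₁ a₂ : ℝ}
    (b0 : |a| ≤ C * ((1 + z) ^ (n + 5))⁻¹) (b1 : |a₁| ≤ C * ((1 + z) ^ (n + 5))⁻¹)
    (b2 : |a₂| ≤ C * ((1 + z) ^ (n + 5))⁻¹) :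
    |η₀ * a - a| ≤ C / j * ((1 + z) ^ (n + 2))⁻¹ ∧
    |((z ^ 2 - 1) * (η₂ / j ^ 2 * a + 2 * (η₁ / j) * a₁ + η₀ * a₂) + n * z * (η₁ / j * a + η₀ * a₁) +
        ((n : ℝ) - 1) ^ 2 / 4 * (η₀ * a)) -
      ((z ^ 2 - 1) * a₂ + n * z * a₁ + ((n : ℝ) - 1) ^ 2 / 4 * a)| ≤
      (1 + n + n ^ 2 + M * (3 + n)) * C / j * ((1 + z) ^ (n + 2))⁻¹ := by
  set q := C * ((1 + z) ^ (n + 2))⁻¹ with hq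
  have hj0 : 0 < j := one_pos.trans_le hj
  have conv : ∀ {x : ℝ}, |x| ≤ C * ((1 + z) ^ (n + 5))⁻¹ → z ^ 3 * |x| ≤ q := by
    intro x hx
    calc z ^ 3 * |x| ≤ (1 + z) ^ 3 * (C * ((1 + z) ^ (n + 5))⁻¹) := by
          gcongr
          linarith
      _ = q := by
          rw [hq, show n + 5 = (n + 2) + 3 by ring, pow_add (1 + z) (n + 2) 3]
          field_simp
  have lower : ∀ {x : ℝ}, z ^ 3 * |x| ≤ q → z ^ 2 * |x| ≤ q ∧ z * |x| ≤ q := by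
    intro x hx
    have h2 : z ^ 2 ≤ z ^ 3 := by nlinarith [sq_nonneg z]
    have h1 : z ≤ z ^ 3 := by nlinarith
    exact ⟨(mul_le_mul_of_nonneg_right h2 (abs_nonneg x)).trans hx,
      (mul_le_mul_of_nonneg_right h1 (abs_nonneg x)).trans hx⟩
  have q0 := conv b0
  have q1 := conv b1
  have q2 := conv b2
  obtain ⟨q02, q01⟩ := lower q0
  obtain ⟨q12, q11⟩ := lower q1
  have hn1 : ((n : ℝ) - 1) ^ 2 / 4 ≤ n ^ 2 := by
    have : (1 : ℝ) ≤ n := by exact_mod_cast Nat.one_le_iff_ne_zero.2 (NeZero.ne n)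
    nlinarith
  have hzz : |z ^ 2 - 1| ≤ z ^ 2 := by
    rw [abs_of_nonneg (by nlinarith)]
    linarith
  constructor
  · have e : η₀ * a - a = -((1 - η₀) * a) := by ring
    rw [e, abs_neg, abs_mul]
    calc |1 - η₀| * |a| ≤ z / j * |a| := by gcongr
      _ = z * |a| / j := by ring
      _ ≤ q / j := by gcongr
      _ = _ := by rw [hq]; ring
  · set b := ((n : ℝ) - 1) ^ 2 / 4 with hb
    have hb0 : 0 ≤ b := by positivity
    have e : ((z ^ 2 - 1) * (η₂ / j ^ 2 * a + 2 * (η₁ / j) * a₁ + η₀ * a₂) +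
        n * z * (η₁ / j * a + η₀ * a₁) + b * (η₀ * a)) -
        ((z ^ 2 - 1) * a₂ + n * z * a₁ + b * a) =
        (z ^ 2 - 1) * (η₂ / j ^ 2 * a + 2 * (η₁ / j) * a₁) + n * z * (η₁ / j * a) -
        (1 - η₀) * ((z ^ 2 - 1) * a₂ + n * z * a₁ + b * a) := by ring
    rw [e]
    have t1 : |(z ^ 2 - 1) * (η₂ / j ^ 2 * a + 2 * (η₁ / j) * a₁)| ≤ 3 * M * q / j := by
      have s1 : |η₂ / j ^ 2 * a| ≤ M / j * |a| := by
        rw [abs_mul, abs_div, abs_of_pos (pow_pos hj0 2)]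
        gcongr
        nlinarith
      have s2 : |2 * (η₁ / j) * a₁| ≤ 2 * (M / j) * |a₁| := by
        rw [abs_mul, abs_mul, abs_div, abs_of_pos hj0, abs_two]
        gcongr
      rw [abs_mul]
      calc |z ^ 2 - 1| * |η₂ / j ^ 2 * a + 2 * (η₁ / j) * a₁|
          ≤ z ^ 2 * (M / j * |a| + 2 * (M / j) * |a₁|) := by
            gcongr
            exact (abs_add_le _ _).trans (add_le_add s1 s2)
        _ = M / j * (z ^ 2 * |a|) + 2 * (M / j) * (z ^ 2 * |a₁|) := by ring
        _ ≤ M / j * q + 2 * (M / j) * q := by gcongr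
        _ = _ := by ring
    have t2 : |n * z * (η₁ / j * a)| ≤ n * M * q / j := by
      rw [abs_mul, abs_mul, abs_mul, abs_div, abs_of_pos hj0, Nat.abs_cast, abs_of_pos (by linarith)]
      calc n * z * (|η₁| / j * |a|) ≤ n * z * (M / j * |a|) := by gcongr
        _ = n * (M / j) * (z * |a|) := by ring
        _ ≤ n * (M / j) * q := by gcongr
        _ = _ := by ring
    have t3 : |(1 - η₀) * ((z ^ 2 - 1) * a₂ + n * z * a₁ + b * a)| ≤ (1 + n + n ^ 2) * q / j := by
      rw [abs_mul]
      have s : |(z ^ 2 - 1) * a₂ + n * z * a₁ + b * a| ≤ z ^ 2 * |a₂| + n * z * |a₁| + n ^ 2 * |a| := by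
        refine (abs_add_le _ _).trans (add_le_add ((abs_add_le _ _).trans (add_le_add ?_ ?_)) ?_)
        · rw [abs_mul]; gcongr
        · rw [abs_mul, abs_mul, Nat.abs_cast, abs_of_pos (by linarith)]
        · rw [abs_mul, abs_of_nonneg hb0]; gcongr
      calc |1 - η₀| * |(z ^ 2 - 1) * a₂ + n * z * a₁ + b * a|
          ≤ z / j * (z ^ 2 * |a₂| + n * z * |a₁| + n ^ 2 * |a|) := by gcongr
        _ = (z ^ 3 * |a₂| + n * (z ^ 2 * |a₁|) + n ^ 2 * (z * |a|)) / j := by ring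
        _ ≤ (q + n * q + n ^ 2 * q) / j := by gcongr
        _ = _ := by ring
    calc _ ≤ 3 * M * q / j + n * M * q / j + (1 + n + n ^ 2) * q / j :=
          (abs_sub _ _).trans (add_le_add ((abs_add_le _ _).trans (add_le_add t1 t2)) t3)
      _ = _ := by rw [hq]; ring

/-- The truncations η(z / j) k(z) are test functions. They and their images under 𝓛_n converge in L²
at rate 1 / j, `decayWeight` to the power n + 2 being the square-integrable majorant. -/
theorem mem_closure_lapGraph_of_decay {w₀ : EuclideanSpace ℝ (Fin n)} (hw₀ : w₀ ∈ halfSpace n)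
    {k k₁ k₂ : ℝ → ℝ} (hs : ContDiffOn ℝ ∞ k (Ioi 0))
    (h1 : ∀ z, 0 < z → HasDerivAt k (k₁ z) z) (h2 : ∀ z, 0 < z → HasDerivAt k₁ (k₂ z) z) {C : ℝ}
    (b0 : ∀ z, 0 < z → |k z| ≤ C * ((1 + z) ^ (n + 5))⁻¹)
    (b1 : ∀ z, 0 < z → |k₁ z| ≤ C * ((1 + z) ^ (n + 5))⁻¹)
    (b2 : ∀ z, 0 < z → |k₂ z| ≤ C * ((1 + z) ^ (n + 5))⁻¹) {u g : L2 n}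
    (hu : u =ᵐ[hypVolume n] fun w => (k (coshDist w₀ w) : ℂ))
    (hg : g =ᵐ[hypVolume n] fun w => (radialOp n k k₁ k₂ (coshDist w₀ w) : ℂ)) :
    (u, g) ∈ closure (lapGraph n) := by
  obtain ⟨η, M, ηs, η0, η1, hM, ηM1, ηM2⟩ := exists_cutoff
  have ηd : ∀ x, HasDerivAt η (deriv η x) x := fun x =>
    (ηs.differentiable (by simp) x).hasDerivAt
  have ηd2 : ∀ x, HasDerivAt (deriv η) (deriv (deriv η) x) x := fun x =>
    ((contDiff_infty_iff_deriv.1 ηs).2.differentiable (by simp) x).hasDerivAt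
  set J : ℕ → ℝ := fun m => m + 1 with hJ
  have hJ1 : ∀ m, 1 ≤ J m := fun m => by simp [hJ]
  have hJ0 : ∀ m, 0 < J m := fun m => one_pos.trans_le (hJ1 m)
  have dd : ∀ m z, HasDerivAt (fun z => z / J m) (1 / J m) z := fun m z =>
    (hasDerivAt_id z).div_const _
  set c : ℕ → ℝ → ℝ := fun m z => η (z / J m) * k z with hc
  set c₁ : ℕ → ℝ → ℝ := fun m z => deriv η (z / J m) / J m * k z + η (z / J m) * k₁ z with hc₁
  set c₂ : ℕ → ℝ → ℝ := fun m z => deriv (deriv η) (z / J m) / J m ^ 2 * k z +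
    2 * (deriv η (z / J m) / J m) * k₁ z + η (z / J m) * k₂ z with hc₂
  have dη : ∀ m z, HasDerivAt (fun z => η (z / J m)) (deriv η (z / J m) / J m) z := fun m z =>
    ((ηd _).comp z (dd m z)).congr_deriv (by ring)
  have dη' : ∀ m z, HasDerivAt (fun z => deriv η (z / J m) / J m)
      (deriv (deriv η) (z / J m) / J m ^ 2) z := fun m z =>
    (((ηd2 _).comp z (dd m z)).div_const (J m)).congr_deriv (by field_simp)
  have d1 : ∀ m z, 0 < z → HasDerivAt (c m) (c₁ m z) z := fun m z hz =>
    ((dη m z).mul (h1 z hz))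
  have d2 : ∀ m z, 0 < z → HasDerivAt (c₁ m) (c₂ m z) z := fun m z hz =>
    (((dη' m z).mul (h1 z hz)).add ((dη m z).mul (h2 z hz))).congr_deriv (by simp only [hc₂]; ring)
  have cs : ∀ m, ContDiffOn ℝ ∞ (c m) (Ioi 0) := fun m =>
    (ηs.comp (contDiff_id.div_const _)).contDiffOn.mul hs
  have ht := fun m => isTest_radial hw₀ (cs m) (j := 2 * J m) (mul_pos two_pos (hJ0 m)) fun z hz => by
    simp only [hc]
    rw [η0 _ (by rwa [le_div_iff₀ (hJ0 m)]), zero_mul]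
  have hlap : ∀ m w, w ∈ halfSpace n →
      hypLap n ((halfSpace n).indicator fun w => (c m (coshDist w₀ w) : ℂ)) w =
        (radialOp n (c m) (c₁ m) (c₂ m) (coshDist w₀ w) : ℝ) := by
    intro m w hw
    rw [← hypLap_radial hw₀ hw (cs m) (d1 m) (d2 m)]
    refine hypLap_congr ?_
    filter_upwards [isOpen_halfSpace.mem_nhds hw] with x hx using indicator_of_mem hx _
  set A := (1 + n + n ^ 2 + M * (3 + n)) * C with hA
  set B := (decayConst w₀ ^ (n + 2))⁻¹ with hB
  have hdw := decayConst_pos hw₀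
  have herr := fun m {w} (hw : w ∈ halfSpace n) =>
    radialOp_cutoff_error (n := n) hM (hJ1 m)
      (one_le_coshDist hw₀ hw) (η1 _ (div_nonneg (coshDist_pos hw₀ hw).le (hJ0 m).le)) (ηM1 (coshDist w₀ w / J m))
      (ηM2 (coshDist w₀ w / J m))
      (b0 _ (coshDist_pos hw₀ hw)) (b1 _ (coshDist_pos hw₀ hw)) (b2 _ (coshDist_pos hw₀ hw))
  have hC : 0 ≤ C := by
    have := (abs_nonneg _).trans (b0 1 one_pos)
    exact nonneg_of_mul_nonneg_left this (by positivity)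
  have lim : ∀ (D : ℝ) (v : ℕ → L2 n) (v₀ : L2 n), 0 ≤ D →
      (∀ m, ∀ᵐ w ∂(hypVolume n), ‖v m w - v₀ w‖ ≤ D / J m * ((1 + coshDist w₀ w) ^ (n + 2))⁻¹) →
      Tendsto v atTop (𝓝 v₀) := by
    intro D v v₀ hD h
    rw [tendsto_iff_norm_sub_tendsto_zero]
    have lim0 : Tendsto (fun m => D / J m * B * ‖(memLp_decayWeight_pow (n := n)).toLp _‖) atTop
        (𝓝 0) := by
      have : Tendsto (fun m => D / J m) atTop (𝓝 0) :=
        tendsto_const_nhds.div_atTop (tendsto_atTop_add_const_right _ _ tendsto_natCast_atTop_atTop)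
      simpa using (this.mul_const B).mul_const ‖(memLp_decayWeight_pow (n := n)).toLp _‖
    refine squeeze_zero (fun _ => norm_nonneg _) (fun m => norm_le_of_ae_le_decayWeight ?_) lim0
    filter_upwards [h m, Lp.coeFn_sub (v m) v₀, ae_mem_halfSpace] with w e1 e2 e3
    rw [e2, Pi.sub_apply]
    have := hJ0 m
    refine e1.trans ?_
    rw [mul_assoc]
    gcongr
    exact inv_coshDist_pow_le hw₀ e3 (n + 2)
  refine mem_closure_of_tendsto (f := fun m => ((ht m).toL2, (ht m).hypLap.toL2)) (b := atTop)
    (Tendsto.prodMk_nhds (lim C _ _ hC fun m => ?_) (lim A _ _ (by positivity) fun m => ?_))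
    (Eventually.of_forall fun m => (ht m).mem_lapGraph)
  · filter_upwards [(ht m).coeFn_toL2, hu, ae_mem_halfSpace] with w e1 e2 hw
    rw [e1, e2, indicator_of_mem hw, ← Complex.ofReal_sub, Complex.norm_real, norm_eq_abs]
    exact (herr m hw).1
  · filter_upwards [(ht m).hypLap.coeFn_toL2, hg, ae_mem_halfSpace] with w e1 e2 hw
    rw [e1, e2, hlap m w hw, ← Complex.ofReal_sub, Complex.norm_real, norm_eq_abs]
    exact (herr m hw).2

end

/-! ### The kernel preserves the ground state -/

section

/-- A measurable function agreeing with `radialKernel n t` on `(0, ∞)`. -/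
def measKernel (n : ℕ) (t : ℝ) : ℝ → ℝ := (Ioi (0 : ℝ)).indicator (radialKernel n t)

theorem measKernel_eq {n : ℕ} {t z : ℝ} (hz : 0 < z) : measKernel n t z = radialKernel n t z :=
  indicator_of_mem (mem_Ioi.2 hz) _

open Classical in
theorem measurable_measKernel {n : ℕ} {t : ℝ} (hn : n ≠ 0) (ht : 0 < t) :
    Measurable (measKernel n t) := by
  have : measKernel n t = (Ioi (0 : ℝ)).piecewise (radialKernel n t) 0 :=
    (piecewise_eq_indicator ..).symm
  rw [this]
  exact (contDiffOn_radialKernel hn ht).continuousOn.measurable_piecewise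
    continuous_zero.continuousOn measurableSet_Ioi

/-- Integrating over one horizontal coordinate is the Abel transform after scaling by s, and lowers
the dimension by one. -/
theorem lintegral_radialKernel_line {m : ℕ} {t s c : ℝ} (hm : m ≠ 0) (ht : 0 < t) (hs : 0 < s)
    (hc : 0 < c) (u₀ : ℝ) :
    ∫⁻ u : ℝ, ENNReal.ofReal (radialKernel (m + 1) t (c + (u₀ - u) ^ 2 / (2 * s ^ 2))) =
      ENNReal.ofReal (s * radialKernel m t c) := by
  have e : ∀ u : ℝ, (u₀ - u) ^ 2 / (2 * s ^ 2) = ((u - u₀) / s) ^ 2 / 2 := fun u => by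
    field_simp
    ring
  simp only [e]
  have hi : Integrable fun u : ℝ => radialKernel (m + 1) t (c + ((u - u₀) / s) ^ 2 / 2) :=
    ((integrable_radialKernel_shift m.succ_ne_zero ht hc).comp_div hs.ne').comp_sub_right u₀
  rw [← ofReal_integral_eq_lintegral_ofReal hi (ae_of_all _ fun u =>
    radialKernel_nonneg m.succ_ne_zero ht (by positivity)),
    integral_sub_right_eq_self (fun u => radialKernel (m + 1) t (c + (u / s) ^ 2 / 2)) u₀,
    Measure.integral_comp_div (fun u => radialKernel (m + 1) t (c + u ^ 2 / 2)) s,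
    ← radialKernel_eq_abel hm ht hc, abs_of_pos hs, smul_eq_mul]

theorem lintegral_radialKernel_pi {m : ℕ} {t s : ℝ} (hm : m ≠ 0) (ht : 0 < t) (hs : 0 < s) (d : ℕ)
    (x₀ : Fin d → ℝ) : ∀ {c : ℝ}, 0 < c →
    ∫⁻ x : Fin d → ℝ, ENNReal.ofReal (radialKernel (m + d) t
        (c + (∑ i, (x₀ i - x i) ^ 2) / (2 * s ^ 2))) =
      ENNReal.ofReal (s ^ d * radialKernel m t c) := by
  induction d with
  | zero => intro c _; simp [volume_pi]
  | succ d ih =>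
    intro c hc
    set K := measKernel (m + (d + 1)) t
    have hK : Measurable K := measurable_measKernel (by omega) ht
    have hKe : ∀ {z}, 0 < z → K z = radialKernel (m + (d + 1)) t z := measKernel_eq
    set G : ℝ × (Fin d → ℝ) → ENNReal := fun p => ENNReal.ofReal (K
      (c + ((x₀ 0 - p.1) ^ 2 + ∑ i, (x₀ (Fin.succ i) - p.2 i) ^ 2) / (2 * s ^ 2))) with hG
    have hGm : Measurable G := (hK.comp (by fun_prop)).ennreal_ofReal
    have e : ∀ x : Fin (d + 1) → ℝ, ENNReal.ofReal (radialKernel (m + (d + 1)) t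
        (c + (∑ i, (x₀ i - x i) ^ 2) / (2 * s ^ 2))) =
        G (MeasurableEquiv.piFinSuccAbove (fun _ => ℝ) 0 x) := by
      intro x
      change _ = ENNReal.ofReal (K (c + ((x₀ 0 - x 0) ^ 2 +
        ∑ i, (x₀ (Fin.succ i) - x (Fin.succAbove 0 i)) ^ 2) / (2 * s ^ 2)))
      rw [hKe (by positivity), Fin.sum_univ_succ]
      rfl
    simp only [e]
    rw [(volume_preserving_piFinSuccAbove (fun _ : Fin (d + 1) => ℝ) 0).lintegral_comp
      hGm, Measure.volume_eq_prod, lintegral_prod_symm' _ hGm]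
    have e2 : ∀ y : Fin d → ℝ, ∫⁻ u : ℝ, G (u, y) =
        ENNReal.ofReal s * ENNReal.ofReal (radialKernel (m + d) t
          (c + (∑ i, (x₀ (Fin.succ i) - y i) ^ 2) / (2 * s ^ 2))) := by
      intro y
      rw [← ENNReal.ofReal_mul hs.le, ← lintegral_radialKernel_line (by omega) ht hs (by positivity) (x₀ 0)]
      refine lintegral_congr fun u => ?_
      simp only [hG]
      rw [hKe (by positivity)]
      congr 2
      ring
    simp only [e2]
    rw [lintegral_const_mul' _ _ ENNReal.ofReal_ne_top, ih (fun i => x₀ (Fin.succ i)) hc,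
      ← ENNReal.ofReal_mul hs.le]
    congr 1
    ring

/-- With y = Y e^s the argument of the kernel becomes cosh s and dy / y becomes ds, so what remains
is the total mass of a Gaussian. -/
theorem lintegral_radialKernel_one {t Y : ℝ} (ht : 0 < t) (hY : 0 < Y) :
    ∫⁻ y in Ioi (0 : ℝ), ENNReal.ofReal (y⁻¹ * radialKernel 1 t (1 + (Y - y) ^ 2 / (2 * (Y * y)))) =
      1 := by
  have him : (fun s => Y * exp s) '' univ = Ioi 0 := by
    ext y
    simp only [image_univ, mem_range, mem_Ioi]
    constructor
    · rintro ⟨s, rfl⟩; positivity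
    · intro hy
      exact ⟨log (y / Y), by rw [exp_log (by positivity)]; field_simp⟩
  rw [← him, lintegral_image_eq_lintegral_abs_deriv_mul (f' := fun s => Y * exp s) MeasurableSet.univ
    (fun s _ => ((hasDerivAt_exp s).const_mul Y).hasDerivWithinAt)
    (fun a _ b _ h => by simpa [hY.ne'] using h), Measure.restrict_univ]
  have e : ∀ s : ℝ, ENNReal.ofReal |Y * exp s| * ENNReal.ofReal ((Y * exp s)⁻¹ *
      radialKernel 1 t (1 + (Y - Y * exp s) ^ 2 / (2 * (Y * (Y * exp s))))) =
      ENNReal.ofReal ((√(4 * π * t))⁻¹ * exp (-(1 / (4 * t)) * s ^ 2)) := by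
    intro s
    have hp : 0 < Y * exp s := by positivity
    have e1 : 1 + (Y - Y * exp s) ^ 2 / (2 * (Y * (Y * exp s))) = cosh s := by
      rw [cosh_eq, exp_neg]
      have := exp_pos s
      field_simp
      ring
    rw [abs_of_pos hp, ← ENNReal.ofReal_mul hp.le, e1, radialKernel_one_cosh, mul_inv_cancel_left₀ hp.ne']
    congr 3
    field_simp
  simp only [e]
  have hi : Integrable fun s : ℝ => exp (-(1 / (4 * t)) * s ^ 2) := integrable_exp_neg_mul_sq (by positivity)
  rw [← ofReal_integral_eq_lintegral_ofReal (hi.const_mul _) (ae_of_all _ fun s => by positivity),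
    integral_const_mul, integral_gaussian, ← ENNReal.ofReal_one]
  congr 1
  rw [show π / (1 / (4 * t)) = 4 * π * t by field_simp]
  exact inv_mul_cancel₀ (by positivity)

variable {n : ℕ} [NeZero n]

/-- The positive solution `y^((n-1)/2)` of `𝓛_n h = 0`. -/
def groundState (w : EuclideanSpace ℝ (Fin n)) : ℝ := height w ^ (((n : ℝ) - 1) / 2)

theorem groundState_pos {w : EuclideanSpace ℝ (Fin n)} (hw : w ∈ halfSpace n) :
    0 < groundState w := rpow_pos_of_pos hw _

omit [NeZero n] in
theorem lintegral_hypVolume_succ {d : ℕ} [NeZero (d + 1)] {G : ℝ × (Fin d → ℝ) → ENNReal}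
    (hG : Measurable G) :
    ∫⁻ w, G (w (Fin.last d), fun i => w i.castSucc) ∂(hypVolume (d + 1)) =
      ∫⁻ y in Ioi (0 : ℝ), ENNReal.ofReal ((y ^ (d + 1))⁻¹) * ∫⁻ x, G (y, x) := by
  have hlast : lastIdx (d + 1) = Fin.last d := rfl
  have hmp := (volume_preserving_piFinSuccAbove (fun _ : Fin (d + 1) => ℝ) (Fin.last d)).comp
    (PiLp.volume_preserving_ofLp (Fin (d + 1)))
  have hm : Measurable fun p : ℝ × (Fin d → ℝ) =>
      (Ioi (0 : ℝ)).indicator (fun y => ENNReal.ofReal ((y ^ (d + 1))⁻¹)) p.1 * G p :=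
    (((Measurable.ennreal_ofReal (by fun_prop)).indicator measurableSet_Ioi).comp measurable_fst).mul hG
  have h1 := hmp.lintegral_comp hm
  rw [Measure.volume_eq_prod, lintegral_prod _ hm.aemeasurable] at h1
  have hGm : Measurable fun w : EuclideanSpace ℝ (Fin (d + 1)) =>
      G (w (Fin.last d), fun i => w i.castSucc) := hG.comp (by fun_prop)
  rw [hypVolume_eq, lintegral_withDensity_eq_lintegral_mul _
    (measurable_volDensity (n := d + 1)).ennreal_ofReal hGm,
    ← lintegral_indicator measurableSet_halfSpace]
  rw [← lintegral_indicator measurableSet_Ioi]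
  refine Eq.trans (lintegral_congr fun w => ?_) (h1.trans (lintegral_congr fun y => ?_))
  · have e : MeasurableEquiv.piFinSuccAbove (fun _ : Fin (d + 1) => ℝ) (Fin.last d) w.ofLp =
        (w (Fin.last d), fun i => w i.castSucc) := by
      refine Prod.ext rfl (funext fun i => ?_)
      change w ((Fin.last d).succAbove i) = _
      rw [Fin.succAbove_last]
    rw [Function.comp_apply, e]
    by_cases hw : w ∈ halfSpace (d + 1)
    · have hw' : w (Fin.last d) ∈ Ioi (0 : ℝ) := hw
      rw [indicator_of_mem hw, indicator_of_mem hw']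
      rfl
    · have hw' : w (Fin.last d) ∉ Ioi (0 : ℝ) := hw
      rw [indicator_of_notMem hw, indicator_of_notMem hw', zero_mul]
  · by_cases hy : y ∈ Ioi (0 : ℝ)
    · simp only [indicator_of_mem hy]
      rw [lintegral_const_mul' _ _ ENNReal.ofReal_ne_top]
    · simp only [indicator_of_notMem hy, zero_mul, lintegral_zero]

/-- Tonelli: the n - 1 horizontal integrals reduce the kernel to that of dimension 1 and yield the
factor (Yy)^{(n-1)/2}. Combined with y^{(n-1)/2} y^{-n} it leaves Y^{(n-1)/2} dy / y. -/
theorem lintegral_radialKernel_mul_groundState {t : ℝ} (ht : 0 < t) {w : EuclideanSpace ℝ (Fin n)}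
    (hw : w ∈ halfSpace n) :
    ∫⁻ w', ENNReal.ofReal (radialKernel n t (coshDist w w') * groundState w') ∂(hypVolume n) =
      ENNReal.ofReal (groundState w) := by
  obtain ⟨d, rfl⟩ := Nat.exists_eq_succ_of_ne_zero (NeZero.ne n)
  simp only [Nat.succ_eq_add_one] at *
  set Y := height w with hYdef
  have hY : 0 < Y := hw
  set K := measKernel (d + 1) t
  have hK : Measurable K := measurable_measKernel (by omega) ht
  have hKe : ∀ {z}, 0 < z → K z = radialKernel (d + 1) t z := measKernel_eq
  set a : ℝ := (((d + 1 : ℕ) : ℝ) - 1) / 2 with ha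
  set G : ℝ × (Fin d → ℝ) → ENNReal := fun p => ENNReal.ofReal (K
    (1 + ((Y - p.1) ^ 2 + ∑ i : Fin d, (w i.castSucc - p.2 i) ^ 2) / (2 * (Y * p.1))) * p.1 ^ a) with hG
  have hGm : Measurable G := ((hK.comp (by fun_prop)).mul (by fun_prop)).ennreal_ofReal
  have e : ∀ᵐ w' ∂(hypVolume (d + 1)), ENNReal.ofReal (radialKernel (d + 1) t (coshDist w w') *
      groundState w') = G (w' (Fin.last d), fun i => w' i.castSucc) := by
    filter_upwards [ae_mem_halfSpace] with w' hw'
    have e1 : coshDist w w' = 1 + ((Y - w' (Fin.last d)) ^ 2 +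
        ∑ i : Fin d, (w i.castSucc - w' i.castSucc) ^ 2) / (2 * (Y * w' (Fin.last d))) := by
      rw [coshDist, EuclideanSpace.norm_sq_eq, Fin.sum_univ_castSucc, add_comm (∑ i, _)]
      simp only [PiLp.sub_apply, norm_eq_abs, sq_abs]
      rfl
    simp only [hG, ← e1]
    rw [hKe (coshDist_pos hw hw')]
    rfl
  rw [lintegral_congr_ae e, lintegral_hypVolume_succ hGm]
  have e2 : ∀ y ∈ Ioi (0 : ℝ), ENNReal.ofReal ((y ^ (d + 1))⁻¹) * ∫⁻ x, G (y, x) =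
      ENNReal.ofReal (Y ^ a) *
        ENNReal.ofReal (y⁻¹ * radialKernel 1 t (1 + (Y - y) ^ 2 / (2 * (Y * y)))) := by
    intro y hy
    have hy0 : 0 < y := hy
    have e3 : ∀ x, G (y, x) = ENNReal.ofReal (y ^ a) * ENNReal.ofReal (radialKernel (1 + d) t
        ((1 + (Y - y) ^ 2 / (2 * (Y * y))) +
          (∑ i : Fin d, (w i.castSucc - x i) ^ 2) / (2 * √(Y * y) ^ 2))) := by
      intro x
      rw [← ENNReal.ofReal_mul (by positivity), sq_sqrt (by positivity)]
      simp only [hG]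
      rw [hKe (by positivity), mul_comm, add_comm d 1, add_div, add_assoc]
    simp only [e3]
    rw [lintegral_const_mul' _ _ ENNReal.ofReal_ne_top,
      lintegral_radialKernel_pi one_ne_zero ht (sqrt_pos.2 (mul_pos hY hy0)) d _ (by positivity),
      ← ENNReal.ofReal_mul (by positivity), ← ENNReal.ofReal_mul (by positivity),
      ← ENNReal.ofReal_mul (by positivity)]
    congr 1
    have hsq : √(Y * y) ^ d = Y ^ a * y ^ a := by
      rw [← mul_rpow hY.le hy0.le, sqrt_eq_rpow, ← rpow_natCast, ← rpow_mul (by positivity), ha]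
      congr 1
      push_cast
      ring
    have hyy : y ^ a * y ^ a = y ^ d := by
      rw [← rpow_add hy0, ha, ← rpow_natCast]
      congr 1
      push_cast
      ring
    rw [hsq]
    calc _ = (y ^ (d + 1))⁻¹ * (y ^ a * y ^ a) * (Y ^ a * radialKernel 1 t
          (1 + (Y - y) ^ 2 / (2 * (Y * y)))) := by ring
      _ = _ := by
        rw [hyy, pow_succ]
        field_simp
  rw [setLIntegral_congr_fun measurableSet_Ioi e2, lintegral_const_mul' _ _ ENNReal.ofReal_ne_top,
    lintegral_radialKernel_one ht hY, mul_one]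
  rfl

end

/-! ### The kernel with one argument fixed, as a curve in L² -/

section

section HeatVec

variable {n : ℕ} [NeZero n]

theorem aestronglyMeasurable_radial {w : EuclideanSpace ℝ (Fin n)} (hw : w ∈ halfSpace n) {κ : ℝ → ℝ}
    (hκ : ContinuousOn κ (Ioi 0)) :
    AEStronglyMeasurable (fun w' => (κ (coshDist w w') : ℂ)) (hypVolume n) := by
  have h : ContinuousOn (fun w' => (κ (coshDist w w') : ℂ)) (halfSpace n) :=
    Complex.continuous_ofReal.comp_continuousOn (hκ.comp (contDiffOn_coshDist hw).continuousOn
      fun w' hw' => coshDist_pos hw hw')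
  have := h.aestronglyMeasurable (μ := hypVolume n) measurableSet_halfSpace
  rwa [Measure.restrict_eq_self_of_ae_mem ae_mem_halfSpace] at this

theorem norm_radial_le {w w' : EuclideanSpace ℝ (Fin n)} (hw : w ∈ halfSpace n)
    (hw' : w' ∈ halfSpace n) {κ : ℝ → ℝ} {C : ℝ} (hC : 0 ≤ C)
    (hb : ∀ z, 0 < z → |κ z| ≤ C * ((1 + z) ^ (n + 2))⁻¹) :
    ‖(κ (coshDist w w') : ℂ)‖ ≤ C * (decayConst w ^ (n + 2))⁻¹ * decayWeight w' ^ (n + 2) := by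
  rw [Complex.norm_real, norm_eq_abs, mul_assoc]
  refine (hb _ (coshDist_pos hw hw')).trans ?_
  gcongr
  exact inv_coshDist_pow_le hw hw' _

theorem memLp_radial {w : EuclideanSpace ℝ (Fin n)} (hw : w ∈ halfSpace n) {κ : ℝ → ℝ}
    (hκ : ContinuousOn κ (Ioi 0)) {C : ℝ} (hC : 0 ≤ C)
    (hb : ∀ z, 0 < z → |κ z| ≤ C * ((1 + z) ^ (n + 2))⁻¹) :
    MemLp (fun w' => (κ (coshDist w w') : ℂ)) 2 (hypVolume n) := by
  refine memLp_decayWeight_pow.of_le_mul (c := C * (decayConst w ^ (n + 2))⁻¹)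
    (aestronglyMeasurable_radial hw hκ) ?_
  filter_upwards [ae_mem_halfSpace] with w' hw'
  rw [norm_of_nonneg (pow_nonneg (decayWeight_pos hw').le _)]
  exact norm_radial_le hw hw' hC hb

theorem radialKernel_abs_decay {m : ℕ} (hm : m ≠ 0) (N : ℕ) {a b : ℝ} (ha : 0 < a) :
    ∃ C, 0 ≤ C ∧ ∀ t ∈ Icc a b, ∀ z, 0 < z → |radialKernel m t z| ≤ C * ((1 + z) ^ N)⁻¹ := by
  obtain ⟨C, hC, h⟩ := radialKernel_decay hm N (b := b) ha
  refine ⟨C, hC, fun t ht z hz => ?_⟩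
  rw [abs_of_nonneg (radialKernel_nonneg hm (ha.trans_le ht.1) hz)]
  exact h t ht z hz

theorem continuousOn_radialKernelDot {m : ℕ} (hm : m ≠ 0) {t : ℝ} (ht : 0 < t) :
    ContinuousOn (radialKernelDot m t) (Ioi 0) := by
  have h0 := (contDiffOn_radialKernel hm ht).continuousOn
  have h2 := (contDiffOn_radialKernel (n := m + 2) (by omega) ht).continuousOn
  have h4 := (contDiffOn_radialKernel (n := m + 4) (by omega) ht).continuousOn
  unfold radialKernelDot
  exact (((by fun_prop : ContinuousOn (fun z : ℝ => (2 * π) ^ 2 * (z ^ 2 - 1)) (Ioi 0)).mul h4).sub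
    ((by fun_prop : ContinuousOn (fun z : ℝ => 2 * π * m * z) (Ioi 0)).mul h2)).add
    (continuousOn_const.mul h0)

theorem memLp_radialKernel {t : ℝ} (ht : 0 < t) {w : EuclideanSpace ℝ (Fin n)}
    (hw : w ∈ halfSpace n) :
    MemLp (fun w' => (radialKernel n t (coshDist w w') : ℂ)) 2 (hypVolume n) := by
  obtain ⟨C, hC, h⟩ := radialKernel_abs_decay (NeZero.ne n) (n + 2) (a := t) (b := t) ht
  exact memLp_radial hw (contDiffOn_radialKernel (NeZero.ne n) ht).continuousOn hC
    (h t ⟨le_rfl, le_rfl⟩)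

theorem memLp_radialKernelDot {t : ℝ} (ht : 0 < t) {w : EuclideanSpace ℝ (Fin n)}
    (hw : w ∈ halfSpace n) :
    MemLp (fun w' => (radialKernelDot n t (coshDist w w') : ℂ)) 2 (hypVolume n) := by
  obtain ⟨C, hC, h⟩ := radialKernelDot_decay (NeZero.ne n) (n + 2) (a := t) (b := t) ht
  exact memLp_radial hw (continuousOn_radialKernelDot (NeZero.ne n) ht) hC (h t ⟨le_rfl, le_rfl⟩)

open Classical in
/-- The heat kernel with one argument fixed, as an element of `L²`. -/
def heatVec (t : ℝ) (w : EuclideanSpace ℝ (Fin n)) : L2 n :=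
  if h : MemLp (fun w' => (radialKernel n t (coshDist w w') : ℂ)) 2 (hypVolume n) then h.toLp _ else 0

open Classical in
/-- The time derivative of `heatVec`. -/
def heatVecDot (t : ℝ) (w : EuclideanSpace ℝ (Fin n)) : L2 n :=
  if h : MemLp (fun w' => (radialKernelDot n t (coshDist w w') : ℂ)) 2 (hypVolume n) then h.toLp _
  else 0

theorem coeFn_heatVec {t : ℝ} (ht : 0 < t) {w : EuclideanSpace ℝ (Fin n)} (hw : w ∈ halfSpace n) :
    heatVec t w =ᵐ[hypVolume n] fun w' => (radialKernel n t (coshDist w w') : ℂ) := by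
  rw [heatVec, dif_pos (memLp_radialKernel ht hw)]
  exact (memLp_radialKernel ht hw).coeFn_toLp

theorem coeFn_heatVecDot {t : ℝ} (ht : 0 < t) {w : EuclideanSpace ℝ (Fin n)}
    (hw : w ∈ halfSpace n) :
    heatVecDot t w =ᵐ[hypVolume n] fun w' => (radialKernelDot n t (coshDist w w') : ℂ) := by
  rw [heatVecDot, dif_pos (memLp_radialKernelDot ht hw)]
  exact (memLp_radialKernelDot ht hw).coeFn_toLp

/-- The kernel and its first two z-derivatives are kernels of dimensions n, n + 2, n + 4, all of
rapid decay; the radial heat equation identifies the image under 𝓛_n with the time derivative. -/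
theorem heatVec_mem_closure {t : ℝ} (ht : 0 < t) {w : EuclideanSpace ℝ (Fin n)}
    (hw : w ∈ halfSpace n) : (heatVec t w, heatVecDot t w) ∈ closure (lapGraph n) := by
  have hn := NeZero.ne n
  obtain ⟨C0, hC0, h0⟩ := radialKernel_abs_decay hn (n + 5) (a := t) (b := t) ht
  obtain ⟨C2, hC2, h2⟩ := radialKernel_abs_decay (m := n + 2) (by omega) (n + 5) (a := t) (b := t) ht
  obtain ⟨C4, hC4, h4⟩ := radialKernel_abs_decay (m := n + 4) (by omega) (n + 5) (a := t) (b := t) ht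
  have hmem : t ∈ Icc t t := ⟨le_rfl, le_rfl⟩
  refine mem_closure_lapGraph_of_decay hw (contDiffOn_radialKernel hn ht)
    (k₁ := fun z => -(2 * π) * radialKernel (n + 2) t z)
    (k₂ := fun z => -(2 * π) * (-(2 * π) * radialKernel (n + 4) t z))
    (fun z hz => hasDerivAt_radialKernel hn ht hz)
    (fun z hz => (hasDerivAt_radialKernel (n := n + 2) (by omega) ht hz).const_mul _)
    (C := C0 + 2 * π * C2 + 2 * π * (2 * π * C4)) ?_ ?_ ?_ (coeFn_heatVec ht hw) ?_
  · intro z hz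
    refine (h0 t hmem z hz).trans ?_
    gcongr
    have : 0 ≤ 2 * π * C2 + 2 * π * (2 * π * C4) := by positivity
    linarith
  · intro z hz
    rw [abs_mul, abs_neg, abs_of_pos two_pi_pos]
    calc 2 * π * |radialKernel (n + 2) t z| ≤ 2 * π * (C2 * ((1 + z) ^ (n + 5))⁻¹) := by
          gcongr
          exact h2 t hmem z hz
      _ = 2 * π * C2 * ((1 + z) ^ (n + 5))⁻¹ := by ring
      _ ≤ _ := by
          gcongr
          have : 0 ≤ C0 + 2 * π * (2 * π * C4) := by positivity
          linarith
  · intro z hz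
    rw [abs_mul, abs_mul, abs_neg, abs_of_pos two_pi_pos]
    calc 2 * π * (2 * π * |radialKernel (n + 4) t z|)
        ≤ 2 * π * (2 * π * (C4 * ((1 + z) ^ (n + 5))⁻¹)) := by
          gcongr
          exact h4 t hmem z hz
      _ = 2 * π * (2 * π * C4) * ((1 + z) ^ (n + 5))⁻¹ := by ring
      _ ≤ _ := by
          gcongr
          have : 0 ≤ C0 + 2 * π * C2 := by positivity
          linarith
  · refine (coeFn_heatVecDot ht hw).trans (Eventually.of_forall fun w' => ?_)
    simp only [radialOp, radialKernelDot]
    congr 1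
    ring

theorem radialKernel_lipschitz {m : ℕ} (hm : m ≠ 0) (N : ℕ) {a b : ℝ} (ha : 0 < a) :
    ∃ C, 0 ≤ C ∧ ∀ s ∈ Icc a b, ∀ t ∈ Icc a b, ∀ z, 0 < z →
      |radialKernel m s z - radialKernel m t z| ≤ C * |s - t| * ((1 + z) ^ N)⁻¹ := by
  obtain ⟨C, hC, h⟩ := radialKernelDot_decay hm N (b := b) ha
  refine ⟨C, hC, fun s hs t ht z hz => ?_⟩
  have := (convex_Icc a b).norm_image_sub_le_of_norm_hasDerivWithin_le
    (f := fun t => radialKernel m t z) (f' := fun t => radialKernelDot m t z)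
    (C := C * ((1 + z) ^ N)⁻¹)
    (fun r hr => (heat_radialKernel hm (ha.trans_le hr.1) hz).hasDerivWithinAt)
    (fun r hr => h r hr z hz) ht hs
  rw [norm_eq_abs, norm_eq_abs] at this
  linarith

theorem continuousAt_heatVec {t : ℝ} (ht : 0 < t) {w : EuclideanSpace ℝ (Fin n)}
    (hw : w ∈ halfSpace n) : ContinuousAt (fun s => heatVec s w) t := by
  obtain ⟨C, hC, h⟩ := radialKernel_lipschitz (NeZero.ne n) (n + 2) (a := t / 2) (b := 2 * t)
    (by positivity)
  have hmem : t ∈ Icc (t / 2) (2 * t) := ⟨by linarith, by linarith⟩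
  rw [ContinuousAt, tendsto_iff_norm_sub_tendsto_zero]
  set D := C * (decayConst w ^ (n + 2))⁻¹ * ‖(memLp_decayWeight_pow (n := n)).toLp _‖
  have lim : Tendsto (fun s => |s - t| * D) (𝓝 t) (𝓝 0) := by
    have : Continuous fun s => |s - t| * D := by fun_prop
    simpa using this.tendsto t
  refine squeeze_zero' (Eventually.of_forall fun _ => norm_nonneg _) ?_ lim
  filter_upwards [Icc_mem_nhds (show t / 2 < t by linarith) (show t < 2 * t by linarith)] with s hs
  have hs0 : 0 < s := by linarith [hs.1]
  refine (norm_le_of_ae_le_decayWeight (C := C * |s - t| * (decayConst w ^ (n + 2))⁻¹) ?_).trans_eq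
    (by simp only [D]; ring)
  filter_upwards [Lp.coeFn_sub (heatVec s w) (heatVec t w), coeFn_heatVec hs0 hw,
    coeFn_heatVec ht hw, ae_mem_halfSpace] with w' e1 e2 e3 hw'
  rw [e1, Pi.sub_apply, e2, e3, ← Complex.ofReal_sub]
  exact norm_radial_le (κ := fun z => radialKernel n s z - radialKernel n t z) hw hw'
    (by positivity) fun z hz => h s hs t hmem z hz

theorem inner_heatVec {t : ℝ} (ht : 0 < t) {w : EuclideanSpace ℝ (Fin n)} (hw : w ∈ halfSpace n)
    (f : L2 n) : inner ℂ (heatVec t w) f =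
      ∫ w', (radialKernel n t (coshDist w w') : ℂ) * f w' ∂(hypVolume n) := by
  rw [inner_eq_integral (coeFn_heatVec ht hw) (ae_eq_refl _)]
  simp only [Complex.conj_ofReal]

theorem inner_heatVecDot {t : ℝ} (ht : 0 < t) {w : EuclideanSpace ℝ (Fin n)} (hw : w ∈ halfSpace n)
    (f : L2 n) : inner ℂ (heatVecDot t w) f =
      ∫ w', (radialKernelDot n t (coshDist w w') : ℂ) * f w' ∂(hypVolume n) := by
  rw [inner_eq_integral (coeFn_heatVecDot ht hw) (ae_eq_refl _)]
  simp only [Complex.conj_ofReal]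

theorem hasDerivAt_inner_heatVec {t : ℝ} (ht : 0 < t) {w : EuclideanSpace ℝ (Fin n)}
    (hw : w ∈ halfSpace n) (f : L2 n) :
    HasDerivAt (fun s => inner ℂ (heatVec s w) f) (inner ℂ (heatVecDot t w) f) t := by
  have hn := NeZero.ne n
  obtain ⟨C, hC, h⟩ := radialKernelDot_decay hn (n + 2) (a := t / 2) (b := 2 * t) (by positivity)
  have hnhds : Icc (t / 2) (2 * t) ∈ 𝓝 t :=
    Icc_mem_nhds (show t / 2 < t by linarith) (show t < 2 * t by linarith)
  have hpos : ∀ s ∈ Icc (t / 2) (2 * t), 0 < s := fun s hs => by linarith [hs.1]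
  have hf := Lp.memLp f
  have hmeas : ∀ s ∈ Icc (t / 2) (2 * t), AEStronglyMeasurable
      (fun w' => (radialKernel n s (coshDist w w') : ℂ) * f w') (hypVolume n) := fun s hs =>
    (memLp_radialKernel (hpos s hs) hw).1.mul hf.1
  have hB : Integrable (fun w' => C * (decayConst w ^ (n + 2))⁻¹ * (decayWeight w' ^ (n + 2) * ‖f w'‖))
      (hypVolume n) := (memLp_decayWeight_pow.integrable_mul hf.norm).const_mul _
  have key := hasDerivAt_integral_of_dominated_loc_of_deriv_le (μ := hypVolume n)
    (F := fun s w' => (radialKernel n s (coshDist w w') : ℂ) * f w')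
    (F' := fun s w' => (radialKernelDot n s (coshDist w w') : ℂ) * f w') hnhds
    (eventually_of_mem hnhds hmeas) ((memLp_radialKernel ht hw).integrable_mul hf)
    ((memLp_radialKernelDot ht hw).1.mul hf.1) ?_ hB ?_
  · rw [inner_heatVecDot ht hw]
    refine key.2.congr_of_eventuallyEq ?_
    filter_upwards [hnhds] with s hs
    exact inner_heatVec (hpos s hs) hw f
  · filter_upwards [ae_mem_halfSpace] with w' hw' s hs
    rw [norm_mul, ← mul_assoc]
    gcongr
    exact norm_radial_le hw hw' hC (h s hs)
  · filter_upwards [ae_mem_halfSpace] with w' hw' s hs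
    exact (heat_radialKernel hn (hpos s hs) (coshDist_pos hw hw')).ofReal_comp.mul_const _

/-- Since the time derivative of the kernel is its image under 𝓛_n, the symmetry of the closed
operator moves 𝓛_n onto u. -/
theorem hasDerivAt_inner_heatVec_of_mem {t : ℝ} (ht : 0 < t) {w : EuclideanSpace ℝ (Fin n)}
    (hw : w ∈ halfSpace n) {u g : L2 n} (h : (u, g) ∈ closure (lapGraph n)) :
    HasDerivAt (fun s => inner ℂ (heatVec s w) u) (inner ℂ (heatVec t w) g) t := by
  have := hasDerivAt_inner_heatVec ht hw u
  rwa [inner_symm_of_mem_closure (heatVec_mem_closure ht hw) h] at this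

end HeatVec

/-- The product rule for an inner product whose first factor is only weakly differentiable. -/
theorem hasDerivAt_inner_of_weak {H : Type*} [NormedAddCommGroup H] [InnerProductSpace ℂ H]
    {a b : ℝ → H} {b' : H} {d : ℂ} {t : ℝ} (ha : ContinuousAt a t)
    (hd : HasDerivAt (fun s => inner ℂ (a s) (b t)) d t) (hb : HasDerivAt b b' t) :
    HasDerivAt (fun s => inner ℂ (a s) (b s)) (d + inner ℂ (a t) b') t := by
  -- The increment of b vanishes at t, so the difference quotient is ⟨a(s), slope of b⟩, and only
  -- continuity of a is needed.
  have h1 : HasDerivAt (fun s => inner ℂ (a s) (b s - b t)) (inner ℂ (a t) b') t := by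
    rw [hasDerivAt_iff_tendsto_slope]
    have h2 := (ha.tendsto.mono_left (nhdsWithin_le_nhds (s := {t}ᶜ))).inner (𝕜 := ℂ)
      hb.tendsto_slope
    refine h2.congr fun s => ?_
    rw [slope_def_module, slope_def_module, sub_self, inner_zero_right, sub_zero,
      ← Complex.coe_smul, inner_smul_right, Complex.real_smul]
  refine (hd.add h1).congr_of_eventuallyEq (Eventually.of_forall fun s => ?_)
  simp

end

/-! ### The kernel operator on test functions: weighted bounds and initial values -/

section

section HeatTest

variable {n : ℕ} [NeZero n]

theorem measurable_coshDist : Measurable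
    (fun p : EuclideanSpace ℝ (Fin n) × EuclideanSpace ℝ (Fin n) => coshDist p.1 p.2) := by
  unfold coshDist
  have h : Measurable (height : EuclideanSpace ℝ (Fin n) → ℝ) := continuous_height.measurable
  fun_prop

theorem measKernel_nonneg {t : ℝ} (ht : 0 < t) (z : ℝ) : 0 ≤ measKernel n t z :=
  indicator_nonneg (fun _ hz => radialKernel_nonneg (NeZero.ne n) ht hz) z

@[fun_prop]
theorem measurable_groundState : Measurable (groundState : EuclideanSpace ℝ (Fin n) → ℝ) :=
  continuous_height.measurable.pow_const _

theorem contDiffOn_groundState :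
    ContDiffOn ℝ ∞ (groundState : EuclideanSpace ℝ (Fin n) → ℝ) (halfSpace n) :=
  contDiff_height.contDiffOn.rpow_const_of_ne fun _ hw => (mem_halfSpace.1 hw).ne'

theorem IsTest.div_groundState {ψ : EuclideanSpace ℝ (Fin n) → ℂ} (hψ : IsTest n ψ) :
    IsTest n (fun w => ((groundState w)⁻¹ : ℂ) * ψ w) :=
  hψ.contDiffOn_mul ((Complex.ofRealCLM.contDiff.comp_contDiffOn contDiffOn_groundState).inv
    fun _ hw => Complex.ofReal_ne_zero.2 (groundState_pos hw).ne')

theorem IsTest.norm_le_groundState {ψ : EuclideanSpace ℝ (Fin n) → ℂ} (hψ : IsTest n ψ) :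
    ∃ C, 0 ≤ C ∧ ∀ w ∈ halfSpace n, ‖ψ w‖ ≤ C * groundState w := by
  obtain ⟨C, hC⟩ := hψ.div_groundState.1.continuous.bounded_above_of_compact_support
    hψ.div_groundState.2.1
  refine ⟨C, (norm_nonneg _).trans (hC 0), fun w hw => ?_⟩
  have h := groundState_pos hw
  have := hC w
  rw [norm_mul, norm_inv, Complex.norm_real, norm_of_nonneg h.le, inv_mul_le_iff₀ h] at this
  linarith

theorem integrable_radialKernel_mul_groundState {t : ℝ} (ht : 0 < t)
    {w : EuclideanSpace ℝ (Fin n)} (hw : w ∈ halfSpace n) :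
    Integrable (fun w' => measKernel n t (coshDist w w') * groundState w') (hypVolume n) ∧
      ∫ w', measKernel n t (coshDist w w') * groundState w' ∂(hypVolume n) = groundState w := by
  have hm : Measurable fun w' => measKernel n t (coshDist w w') * groundState w' :=
    ((measurable_measKernel (NeZero.ne n) ht).comp
      (measurable_coshDist.comp measurable_prodMk_left)).mul measurable_groundState
  have h0 : ∀ᵐ w' ∂(hypVolume n), 0 ≤ measKernel n t (coshDist w w') * groundState w' := by
    filter_upwards [ae_mem_halfSpace] with w' hw'
    exact mul_nonneg (measKernel_nonneg ht _) (groundState_pos hw').le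
  have e : ∫⁻ w', ENNReal.ofReal (measKernel n t (coshDist w w') * groundState w') ∂(hypVolume n) =
      ENNReal.ofReal (groundState w) := by
    rw [← lintegral_radialKernel_mul_groundState ht hw]
    refine lintegral_congr_ae ?_
    filter_upwards [ae_mem_halfSpace] with w' hw'
    rw [measKernel_eq (coshDist_pos hw hw')]
  constructor
  · refine ⟨hm.aestronglyMeasurable, ?_⟩
    rw [hasFiniteIntegral_iff_ofReal h0, e]
    exact ENNReal.ofReal_lt_top
  · rw [integral_eq_lintegral_of_nonneg_ae h0 hm.aestronglyMeasurable, e,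
      ENNReal.toReal_ofReal (groundState_pos hw).le]

/-- The heat kernel applied to a function. -/
def heatTest (t : ℝ) (ψ : EuclideanSpace ℝ (Fin n) → ℂ) (w : EuclideanSpace ℝ (Fin n)) : ℂ :=
  ∫ w', (measKernel n t (coshDist w w') : ℂ) * ψ w' ∂(hypVolume n)

theorem measurable_measKernel_coshDist {t : ℝ} (ht : 0 < t) : Measurable
    (fun p : EuclideanSpace ℝ (Fin n) × EuclideanSpace ℝ (Fin n) =>
      measKernel n t (coshDist p.1 p.2)) :=
  (measurable_measKernel (NeZero.ne n) ht).comp measurable_coshDist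

theorem stronglyMeasurable_heatTest {t : ℝ} (ht : 0 < t) {ψ : EuclideanSpace ℝ (Fin n) → ℂ}
    (hψ : Measurable ψ) : StronglyMeasurable (heatTest t ψ) := by
  have : Measurable fun p : EuclideanSpace ℝ (Fin n) × EuclideanSpace ℝ (Fin n) =>
      (measKernel n t (coshDist p.1 p.2) : ℂ) * ψ p.2 :=
    (Complex.measurable_ofReal.comp (measurable_measKernel_coshDist ht)).mul (hψ.comp measurable_snd)
  exact this.stronglyMeasurable.integral_prod_right

theorem heatTest_eq_inner {t : ℝ} (ht : 0 < t) {w : EuclideanSpace ℝ (Fin n)} (hw : w ∈ halfSpace n)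
    {f : L2 n} {ψ : EuclideanSpace ℝ (Fin n) → ℂ} (hf : f =ᵐ[hypVolume n] ψ) :
    heatTest t ψ w = inner ℂ (heatVec t w) f := by
  rw [inner_heatVec ht hw]
  refine integral_congr_ae ?_
  filter_upwards [hf, ae_mem_halfSpace] with w' e hw'
  rw [e, measKernel_eq (coshDist_pos hw hw')]

/-- A positive kernel that preserves h contracts the sup norm relative to h. -/
theorem norm_heatTest_le {t : ℝ} (ht : 0 < t) {w : EuclideanSpace ℝ (Fin n)} (hw : w ∈ halfSpace n)
    {ψ : EuclideanSpace ℝ (Fin n) → ℂ} {C : ℝ} (hψ : ∀ w ∈ halfSpace n, ‖ψ w‖ ≤ C * groundState w) :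
    ‖heatTest t ψ w‖ ≤ C * groundState w := by
  obtain ⟨hi, he⟩ := integrable_radialKernel_mul_groundState ht hw
  rw [← he, ← integral_const_mul]
  refine norm_integral_le_of_norm_le (hi.const_mul C) ?_
  filter_upwards [ae_mem_halfSpace] with w' hw'
  have hk := measKernel_nonneg (n := n) ht (coshDist w w')
  rw [norm_mul, Complex.norm_real, norm_of_nonneg hk]
  calc measKernel n t (coshDist w w') * ‖ψ w'‖
      ≤ measKernel n t (coshDist w w') * (C * groundState w') := by gcongr; exact hψ w' hw'
    _ = _ := by ring

theorem hasDerivAt_heatTest {t : ℝ} (ht : 0 < t) {w : EuclideanSpace ℝ (Fin n)}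
    (hw : w ∈ halfSpace n) {ψ : EuclideanSpace ℝ (Fin n) → ℂ} (hψ : IsTest n ψ) :
    HasDerivAt (fun t => heatTest t ψ w) (heatTest t (hypLap n ψ) w) t := by
  have := hasDerivAt_inner_heatVec_of_mem ht hw (subset_closure hψ.mem_lapGraph)
  rw [heatTest_eq_inner ht hw hψ.hypLap.coeFn_toL2]
  refine this.congr_of_eventuallyEq ?_
  filter_upwards [Ioi_mem_nhds ht] with s hs
  exact heatTest_eq_inner hs hw hψ.coeFn_toL2

theorem norm_heatTest_sub_le {ψ : EuclideanSpace ℝ (Fin n) → ℂ} (hψ : IsTest n ψ) {C : ℝ}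
    (hC : ∀ w ∈ halfSpace n, ‖hypLap n ψ w‖ ≤ C * groundState w) {s t : ℝ} (hs : 0 < s) (ht : 0 < t)
    {w : EuclideanSpace ℝ (Fin n)} (hw : w ∈ halfSpace n) :
    ‖heatTest t ψ w - heatTest s ψ w‖ ≤ C * groundState w * |t - s| :=
  (convex_Ioi (0 : ℝ)).norm_image_sub_le_of_norm_hasDerivWithin_le
    (fun _ hr => (hasDerivAt_heatTest hr hw hψ).hasDerivWithinAt)
    (fun _ hr => norm_heatTest_le hr hw hC) hs ht

theorem height_le_coshDist_mul {w w' : EuclideanSpace ℝ (Fin n)} (hw : w ∈ halfSpace n)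
    (hw' : w' ∈ halfSpace n) : height w' ≤ 2 * coshDist w w' * height w := by
  have p : 0 < height w := hw
  have p' : 0 < height w' := hw'
  have h := height_sub_sq_le w w'
  have e : coshDist w w' * (2 * (height w * height w')) = 2 * (height w * height w') + ‖w - w'‖ ^ 2 := by
    unfold coshDist
    field_simp
  have : height w' * height w' ≤ (2 * coshDist w w' * height w) * height w' := by
    nlinarith [sq_nonneg (height w)]
  exact le_of_mul_le_mul_right this p'

/-- Heights satisfy y' ≤ 2 y cosh ρ, so h grows at most polynomially in cosh ρ; the exponent (n-1)/2
is enlarged to n for convenience. -/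
theorem groundState_le {w w' : EuclideanSpace ℝ (Fin n)} (hw : w ∈ halfSpace n)
    (hw' : w' ∈ halfSpace n) :
    groundState w' ≤ groundState w * (2 ^ n * (1 + coshDist w w') ^ n) := by
  have p : 0 < height w := hw
  have p' : 0 < height w' := hw'
  have hz := one_le_coshDist hw hw'
  have hn : (1 : ℝ) ≤ n := by exact_mod_cast Nat.one_le_iff_ne_zero.2 (NeZero.ne n)
  calc groundState w' ≤ (2 * coshDist w w' * height w) ^ (((n : ℝ) - 1) / 2) :=
        rpow_le_rpow p'.le (height_le_coshDist_mul hw hw') (by linarith)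
    _ = (2 * coshDist w w') ^ (((n : ℝ) - 1) / 2) * groundState w := by
        rw [mul_rpow (by linarith) p.le]; rfl
    _ ≤ (2 * coshDist w w') ^ (n : ℝ) * groundState w := by
        have := (groundState_pos hw).le
        gcongr
        · linarith
        · linarith
    _ ≤ (2 * (1 + coshDist w w')) ^ n * groundState w := by
        have := (groundState_pos hw).le
        rw [rpow_natCast]
        gcongr
        linarith
    _ = _ := by rw [mul_pow]; ring

theorem exists_coshDist_ge {w : EuclideanSpace ℝ (Fin n)} (hw : w ∈ halfSpace n) {r : ℝ}
    (hr : 0 < r) : ∃ δ > 0, ∀ w' ∈ halfSpace n, r ≤ ‖w - w'‖ → 1 + δ ≤ coshDist w w' := by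
  have p : 0 < height w := hw
  -- As y' ≤ y + x with x = |w - w'|, the excess of cosh over 1 is at least x² / (2y(y + x)), which
  -- increases with x; its value at x = r is taken.
  refine ⟨r ^ 2 / (2 * (height w * (height w + r))), by positivity, fun w' hw' h => ?_⟩
  have p' : 0 < height w' := hw'
  have hx : height w' ≤ height w + ‖w - w'‖ := by
    have := abs_le_of_sq_le_sq' (height_sub_sq_le w w') (norm_nonneg _)
    linarith [this.1]
  unfold coshDist
  gcongr 1 + ?_
  set x := ‖w - w'‖
  rw [div_le_div_iff₀ (by positivity) (by positivity)]
  have h1 : r ^ 2 * (height w + x) ≤ x ^ 2 * (height w + r) := by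
    have : r ^ 2 ≤ x ^ 2 := by gcongr
    have h2 : r ^ 2 * x ≤ x ^ 2 * r := by nlinarith [mul_pos hr (hr.trans_le h)]
    nlinarith
  calc r ^ 2 * (2 * (height w * height w')) ≤ r ^ 2 * (2 * (height w * (height w + x))) := by gcongr
    _ = 2 * height w * (r ^ 2 * (height w + x)) := by ring
    _ ≤ 2 * height w * (x ^ 2 * (height w + r)) := by gcongr
    _ = _ := by ring

/-- Writing ψ = hφ, invariance of h gives P_tψ(w) - ψ(w) = ∫ K h(w') (φ(w') - φ(w)). Near w
continuity of φ suffices; away from w the kernel is uniformly small. -/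
theorem tendsto_heatTest {ψ : EuclideanSpace ℝ (Fin n) → ℂ} (hψ : IsTest n ψ)
    {w : EuclideanSpace ℝ (Fin n)} (hw : w ∈ halfSpace n) :
    Tendsto (fun t => heatTest t ψ w) (𝓝[>] 0) (𝓝 (ψ w)) := by
  set φ : EuclideanSpace ℝ (Fin n) → ℂ := fun w => ((groundState w)⁻¹ : ℂ) * ψ w with hφ
  have φt : IsTest n φ := hψ.div_groundState
  obtain ⟨C, hC⟩ := φt.1.continuous.bounded_above_of_compact_support φt.2.1
  have hC0 : 0 ≤ C := (norm_nonneg _).trans (hC 0)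
  have eψ : ∀ {w}, w ∈ halfSpace n → ψ w = groundState w * φ w := fun {w} hw => by
    have : (groundState w : ℂ) ≠ 0 := Complex.ofReal_ne_zero.2 (groundState_pos hw).ne'
    rw [hφ]
    field_simp
  have hg := groundState_pos hw
  have hdw := decayConst_pos hw
  set I := ∫ w', decayWeight w' ^ (n + 2) ∂(hypVolume n) with hI
  set D := 2 * C * (groundState w * 2 ^ n) * (decayConst w ^ (n + 2))⁻¹ with hD
  rw [tendsto_iff_norm_sub_tendsto_zero, Metric.tendsto_nhds]
  intro η hη
  set e := η / (2 * groundState w) with he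
  have he0 : 0 < e := by positivity
  obtain ⟨r, hr, hclose⟩ := Metric.continuousAt_iff.1 (φt.1.continuous.continuousAt (x := w)) e he0
  obtain ⟨δ, hδ, hfar⟩ := exists_coshDist_ge hw hr
  -- Of the 2n + 2 powers of decay, n pay for the growth of h and n + 2 for integrability.
  obtain ⟨ε, hε, hk⟩ := radialKernel_off_diagonal n (2 * n + 2) hδ
  have lim : Tendsto (fun t => D * |ε t| * I) (𝓝[>] 0) (𝓝 0) := by
    simpa using ((hε.abs).const_mul D).mul_const I
  filter_upwards [lim.eventually (gt_mem_nhds (half_pos hη)), self_mem_nhdsWithin,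
    Ioc_mem_nhdsGT one_pos] with t h1 ht0 ht1
  have ht : 0 < t := ht0
  obtain ⟨hi, hint⟩ := integrable_radialKernel_mul_groundState ht hw
  have hiψ : Integrable (fun w' => (measKernel n t (coshDist w w') : ℂ) * ψ w') (hypVolume n) := by
    have h := (memLp_radialKernel ht hw).integrable_mul hψ.memLp
    refine h.congr ?_
    filter_upwards [ae_mem_halfSpace] with w' hw'
    rw [Pi.mul_apply, measKernel_eq (coshDist_pos hw hw')]
  have eq : heatTest t ψ w - ψ w = ∫ w', ((measKernel n t (coshDist w w') : ℂ) * ψ w' -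
      φ w * ((measKernel n t (coshDist w w') * groundState w' : ℝ) : ℂ)) ∂(hypVolume n) := by
    have hi' : Integrable (fun w' => ((measKernel n t (coshDist w w') * groundState w' : ℝ) : ℂ))
        (hypVolume n) := hi.ofReal
    rw [integral_sub hiψ (hi'.const_mul _), integral_const_mul, integral_complex_ofReal, hint,
      eψ hw, mul_comm (φ w)]
    rfl
  have hdecay := integrable_decayWeight_pow (n := n)
  have bound : ‖heatTest t ψ w - ψ w‖ ≤ e * groundState w + D * |ε t| * I := by
    rw [eq, ← hint, ← integral_const_mul, hI, ← integral_const_mul,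
      ← integral_add (hi.const_mul e) (hdecay.const_mul _)]
    refine norm_integral_le_of_norm_le ((hi.const_mul e).add (hdecay.const_mul _)) ?_
    filter_upwards [ae_mem_halfSpace] with w' hw'
    have hg' := groundState_pos hw'
    have hk0 := measKernel_nonneg (n := n) ht (coshDist w w')
    have hd' := decayWeight_pos hw'
    have e1 : (measKernel n t (coshDist w w') : ℂ) * ψ w' -
        φ w * ((measKernel n t (coshDist w w') * groundState w' : ℝ) : ℂ) =
        ((measKernel n t (coshDist w w') * groundState w' : ℝ) : ℂ) * (φ w' - φ w) := by
      rw [eψ hw']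
      push_cast
      ring
    rw [e1, norm_mul, Complex.norm_real, norm_of_nonneg (by positivity)]
    by_cases hcl : ‖w - w'‖ < r
    · have h2 : ‖φ w' - φ w‖ ≤ e := by
        rw [← dist_eq_norm]
        exact (hclose (by rwa [dist_eq_norm, norm_sub_rev])).le
      have h3 : 0 ≤ D * |ε t| * decayWeight w' ^ (n + 2) := by positivity
      have h4 := mul_le_mul_of_nonneg_left h2 (mul_nonneg hk0 hg'.le)
      linarith
    · have hz := hfar w' hw' (not_lt.1 hcl)
      have hz0 := coshDist_pos hw hw'
      have h2 : ‖φ w' - φ w‖ ≤ 2 * C := (norm_sub_le _ _).trans (by linarith [hC w, hC w'])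
      have h5 : measKernel n t (coshDist w w') ≤ |ε t| * ((1 + coshDist w w') ^ (2 * n + 2))⁻¹ := by
        rw [measKernel_eq hz0]
        refine (hk t ht1 _ hz).trans ?_
        gcongr
        exact le_abs_self _
      have h6 : measKernel n t (coshDist w w') * groundState w' * ‖φ w' - φ w‖ ≤
          D * |ε t| * decayWeight w' ^ (n + 2) := by
        calc measKernel n t (coshDist w w') * groundState w' * ‖φ w' - φ w‖
            ≤ |ε t| * ((1 + coshDist w w') ^ (2 * n + 2))⁻¹ *
              (groundState w * (2 ^ n * (1 + coshDist w w') ^ n)) * (2 * C) := by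
              gcongr
              exact groundState_le hw hw'
          _ = |ε t| * (groundState w * 2 ^ n) * (2 * C) * ((1 + coshDist w w') ^ (n + 2))⁻¹ := by
              rw [show 2 * n + 2 = n + (n + 2) by ring, pow_add (1 + coshDist w w') n (n + 2)]
              field_simp
          _ ≤ |ε t| * (groundState w * 2 ^ n) * (2 * C) *
              ((decayConst w ^ (n + 2))⁻¹ * decayWeight w' ^ (n + 2)) := by
              gcongr
              exact inv_coshDist_pow_le hw hw' _
          _ = _ := by rw [hD]; ring
      have h7 : 0 ≤ e * (measKernel n t (coshDist w w') * groundState w') := by positivity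
      linarith
  rw [dist_zero_right, norm_norm]
  have : e * groundState w = η / 2 := by rw [he]; field_simp
  linarith

/-- The time derivative of P_tψ is P_t 𝓛_nψ, bounded by C h uniformly in t; the mean value
inequality on (s, t) is taken to the limit s → 0. -/
theorem norm_heatTest_sub_self_le {ψ : EuclideanSpace ℝ (Fin n) → ℂ} (hψ : IsTest n ψ) {C : ℝ}
    (hC : ∀ w ∈ halfSpace n, ‖hypLap n ψ w‖ ≤ C * groundState w) {t : ℝ} (ht : 0 < t)
    {w : EuclideanSpace ℝ (Fin n)} (hw : w ∈ halfSpace n) :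
    ‖heatTest t ψ w - ψ w‖ ≤ C * t * groundState w := by
  have lim := ((tendsto_const_nhds (x := heatTest t ψ w)).sub (tendsto_heatTest hψ hw)).norm
  have hg := groundState_pos hw
  have hC0 : 0 ≤ C * groundState w := (norm_nonneg _).trans (hC w hw)
  refine le_of_tendsto lim ?_
  filter_upwards [Ioo_mem_nhdsGT ht] with s hs
  refine (norm_heatTest_sub_le hψ hC hs.1 ht hw).trans ?_
  rw [abs_of_pos (by linarith [hs.2])]
  nlinarith [hs.1, hs.2]

theorem IsTest.integrable_norm_mul_groundState {ψ : EuclideanSpace ℝ (Fin n) → ℂ}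
    (hψ : IsTest n ψ) : Integrable (fun w => ‖ψ w‖ * groundState w) (hypVolume n) := by
  have h : IsTest n (fun w => (groundState w : ℂ) * ψ w) :=
    hψ.contDiffOn_mul (Complex.ofRealCLM.contDiff.comp_contDiffOn contDiffOn_groundState)
  refine (integrable_of_isTest h.1.continuous h.2.1 h.2.2).norm.congr ?_
  filter_upwards [ae_mem_halfSpace] with w hw
  rw [norm_mul, Complex.norm_real, norm_of_nonneg (groundState_pos hw).le, mul_comm]

/-- The kernel is symmetric, so by Tonelli invariance of h also gives contraction on L¹(h dμ). -/
theorem integrable_heatTest_mul_groundState {ψ : EuclideanSpace ℝ (Fin n) → ℂ} (hψ : IsTest n ψ)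
    {t : ℝ} (ht : 0 < t) :
    Integrable (fun w => ‖heatTest t ψ w‖ * groundState w) (hypVolume n) ∧
      ∫ w, ‖heatTest t ψ w‖ * groundState w ∂(hypVolume n) ≤
        ∫ w, ‖ψ w‖ * groundState w ∂(hypVolume n) := by
  have hψm : Measurable ψ := hψ.1.continuous.measurable
  have hm := (stronglyMeasurable_heatTest ht hψm).measurable
  have hK := measurable_measKernel_coshDist (n := n) ht
  have hnn : ∀ F : EuclideanSpace ℝ (Fin n) → ℂ,
      ∀ᵐ w ∂(hypVolume n), 0 ≤ ‖F w‖ * groundState w := fun F => by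
    filter_upwards [ae_mem_halfSpace] with w hw
    exact mul_nonneg (norm_nonneg _) (groundState_pos hw).le
  have hmeas : AEStronglyMeasurable (fun w => ‖heatTest t ψ w‖ * groundState w) (hypVolume n) :=
    (hm.norm.mul measurable_groundState).aestronglyMeasurable
  have key : ∫⁻ w, ENNReal.ofReal (‖heatTest t ψ w‖ * groundState w) ∂(hypVolume n) ≤
      ∫⁻ w, ENNReal.ofReal (‖ψ w‖ * groundState w) ∂(hypVolume n) := by
    calc ∫⁻ w, ENNReal.ofReal (‖heatTest t ψ w‖ * groundState w) ∂(hypVolume n)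
        ≤ ∫⁻ w, ∫⁻ w', ENNReal.ofReal (measKernel n t (coshDist w w') * ‖ψ w'‖ * groundState w)
            ∂(hypVolume n) ∂(hypVolume n) := by
          refine lintegral_mono_ae ?_
          filter_upwards [ae_mem_halfSpace] with w hw
          have hg := (groundState_pos hw).le
          have e : ∀ w', ENNReal.ofReal (measKernel n t (coshDist w w') * ‖ψ w'‖ * groundState w) =
              ‖(measKernel n t (coshDist w w') : ℂ) * ψ w'‖ₑ * ENNReal.ofReal (groundState w) := by
            intro w'
            rw [ENNReal.ofReal_mul' hg, ← ofReal_norm, norm_mul, Complex.norm_real,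
              norm_of_nonneg (measKernel_nonneg ht _)]
          simp only [e]
          rw [lintegral_mul_const' _ _ ENNReal.ofReal_ne_top, ENNReal.ofReal_mul' hg]
          gcongr
          rw [ofReal_norm]
          exact enorm_integral_le_lintegral_enorm _
      _ = ∫⁻ w', ∫⁻ w, ENNReal.ofReal (measKernel n t (coshDist w w') * ‖ψ w'‖ * groundState w)
            ∂(hypVolume n) ∂(hypVolume n) := by
          refine lintegral_lintegral_swap (Measurable.aemeasurable ?_)
          exact ((hK.mul (hψm.norm.comp measurable_snd)).mul
            (measurable_groundState.comp measurable_fst)).ennreal_ofReal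
      _ = _ := by
          refine lintegral_congr_ae ?_
          filter_upwards [ae_mem_halfSpace] with w' hw'
          rw [ENNReal.ofReal_mul (norm_nonneg _), ← lintegral_radialKernel_mul_groundState ht hw',
            ← lintegral_const_mul' _ _ ENNReal.ofReal_ne_top]
          refine lintegral_congr_ae ?_
          filter_upwards [ae_mem_halfSpace] with w hw
          rw [← ENNReal.ofReal_mul (norm_nonneg _), coshDist_comm w',
            measKernel_eq (coshDist_pos hw hw')]
          congr 1
          ring
  have hfin := hψ.integrable_norm_mul_groundState
  have hlt := (hasFiniteIntegral_iff_ofReal (hnn ψ)).1 hfin.2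
  refine ⟨⟨hmeas, (hasFiniteIntegral_iff_ofReal (hnn _)).2 (key.trans_lt hlt)⟩, ?_⟩
  rw [integral_eq_lintegral_of_nonneg_ae (hnn _) hmeas,
    integral_eq_lintegral_of_nonneg_ae (hnn ψ) hfin.1]
  exact ENNReal.toReal_mono hlt.ne key

/-- Interpolation between the two weighted norms: |F|² ≤ A h |F|. It supplies L² bounds for P_tψ
without prior knowledge of boundedness on L². -/
theorem memLp_of_le_groundState {F : EuclideanSpace ℝ (Fin n) → ℂ}
    (hF : AEStronglyMeasurable F (hypVolume n)) {A : ℝ}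
    (hA : ∀ w ∈ halfSpace n, ‖F w‖ ≤ A * groundState w)
    (hi : Integrable (fun w => ‖F w‖ * groundState w) (hypVolume n)) :
    MemLp F 2 (hypVolume n) ∧ ∀ g : L2 n, g =ᵐ[hypVolume n] F →
      ‖g‖ ^ 2 ≤ A * ∫ w, ‖F w‖ * groundState w ∂(hypVolume n) := by
  have hle : ∀ᵐ w ∂(hypVolume n), ‖F w‖ ^ 2 ≤ A * (‖F w‖ * groundState w) := by
    filter_upwards [ae_mem_halfSpace] with w hw
    nlinarith [hA w hw, norm_nonneg (F w)]
  have hsq : Integrable (fun w => ‖F w‖ ^ 2) (hypVolume n) :=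
    (hi.const_mul A).mono' (hF.norm.pow 2) (hle.mono fun w h => by
      rwa [norm_of_nonneg (by positivity)])
  refine ⟨(memLp_two_iff_integrable_sq_norm hF).2 hsq, fun g hg => ?_⟩
  rw [← integral_const_mul]
  have e : ‖g‖ ^ 2 = ∫ w, ‖F w‖ ^ 2 ∂(hypVolume n) := by
    have h1 := inner_self_eq_norm_sq_to_K (𝕜 := ℂ) g
    rw [inner_eq_integral hg hg] at h1
    have h2 : ∀ w, starRingEnd ℂ (F w) * F w = ((‖F w‖ ^ 2 : ℝ) : ℂ) := fun w => by
      rw [Complex.conj_mul']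
      push_cast
      rfl
    simp only [h2, integral_complex_ofReal] at h1
    refine Complex.ofReal_injective (Eq.trans ?_ h1.symm)
    exact Complex.ofReal_pow _ _
  rw [e]
  exact integral_mono_ae hsq (hi.const_mul A) hle

end HeatTest

end

/-! ### Essential self-adjointness and identification of the semigroup -/

section

section HeatTestL2

variable {n : ℕ} [NeZero n]

theorem memLp_heatTest {ψ : EuclideanSpace ℝ (Fin n) → ℂ} (hψ : IsTest n ψ) {t : ℝ} (ht : 0 < t) :
    MemLp (heatTest t ψ) 2 (hypVolume n) := by
  obtain ⟨C, -, hC⟩ := hψ.norm_le_groundState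
  exact (memLp_of_le_groundState
    (stronglyMeasurable_heatTest ht hψ.1.continuous.measurable).aestronglyMeasurable
    (fun w hw => norm_heatTest_le ht hw hC) (integrable_heatTest_mul_groundState hψ ht).1).1

open Classical in
/-- `heatTest` as an element of `L²`. -/
def heatTestL2 (t : ℝ) (ψ : EuclideanSpace ℝ (Fin n) → ℂ) : L2 n :=
  if h : MemLp (heatTest t ψ) 2 (hypVolume n) then h.toLp _ else 0

theorem coeFn_heatTestL2 {ψ : EuclideanSpace ℝ (Fin n) → ℂ} (hψ : IsTest n ψ) {t : ℝ} (ht : 0 < t) :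
    heatTestL2 t ψ =ᵐ[hypVolume n] heatTest t ψ := by
  rw [heatTestL2, dif_pos (memLp_heatTest hψ ht)]
  exact (memLp_heatTest hψ ht).coeFn_toLp

theorem exists_norm_heatTestL2_le {ψ : EuclideanSpace ℝ (Fin n) → ℂ} (hψ : IsTest n ψ) :
    ∃ B, ∀ t, 0 < t → ‖heatTestL2 t ψ‖ ≤ B := by
  obtain ⟨C, hC0, hC⟩ := hψ.norm_le_groundState
  refine ⟨√(C * ∫ w, ‖ψ w‖ * groundState w ∂(hypVolume n)), fun t ht => le_sqrt_of_sq_le ?_⟩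
  have hi := integrable_heatTest_mul_groundState hψ ht
  refine ((memLp_of_le_groundState
    (stronglyMeasurable_heatTest ht hψ.1.continuous.measurable).aestronglyMeasurable
    (fun w hw => norm_heatTest_le ht hw hC) hi.1).2 _ (coeFn_heatTestL2 hψ ht)).trans ?_
  exact mul_le_mul_of_nonneg_left hi.2 hC0

/-- The difference is O(t) relative to h and bounded in L¹(h dμ), so its squared L² norm is O(t). -/
theorem tendsto_heatTestL2 {ψ : EuclideanSpace ℝ (Fin n) → ℂ} (hψ : IsTest n ψ) :
    Tendsto (fun t => heatTestL2 t ψ) (𝓝[>] 0) (𝓝 hψ.toL2) := by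
  obtain ⟨C, hC0, hC⟩ := hψ.hypLap.norm_le_groundState
  set M := ∫ w, ‖ψ w‖ * groundState w ∂(hypVolume n) with hM
  have hiψ := hψ.integrable_norm_mul_groundState
  rw [tendsto_iff_norm_sub_tendsto_zero]
  have lim : Tendsto (fun t => √(C * t * (M + M))) (𝓝[>] 0) (𝓝 0) := by
    have : Continuous fun t => √(C * t * (M + M)) := by fun_prop
    simpa using (this.tendsto 0).mono_left nhdsWithin_le_nhds
  refine squeeze_zero' (Eventually.of_forall fun _ => norm_nonneg _) ?_ lim
  filter_upwards [self_mem_nhdsWithin] with t ht0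
  have ht : 0 < t := ht0
  refine le_sqrt_of_sq_le ?_
  have hi := integrable_heatTest_mul_groundState hψ ht
  have hmeas : AEStronglyMeasurable (fun w => heatTest t ψ w - ψ w) (hypVolume n) :=
    (memLp_heatTest hψ ht).1.sub hψ.memLp.1
  have hle : ∀ᵐ w ∂(hypVolume n), ‖heatTest t ψ w - ψ w‖ * groundState w ≤
      ‖heatTest t ψ w‖ * groundState w + ‖ψ w‖ * groundState w := by
    filter_upwards [ae_mem_halfSpace] with w hw
    rw [← add_mul]
    have := (groundState_pos hw).le
    gcongr
    exact norm_sub_le _ _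
  have hi2 : Integrable (fun w => ‖heatTest t ψ w - ψ w‖ * groundState w) (hypVolume n) := by
    refine (hi.1.add hiψ).mono' (hmeas.norm.mul measurable_groundState.aestronglyMeasurable) ?_
    filter_upwards [hle, ae_mem_halfSpace] with w h hw
    rwa [norm_of_nonneg (mul_nonneg (norm_nonneg _) (groundState_pos hw).le)]
  have hae : ⇑(heatTestL2 t ψ - hψ.toL2) =ᵐ[hypVolume n] fun w => heatTest t ψ w - ψ w :=
    (Lp.coeFn_sub _ _).trans ((coeFn_heatTestL2 hψ ht).sub hψ.coeFn_toL2)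
  refine ((memLp_of_le_groundState hmeas
    (fun w hw => norm_heatTest_sub_self_le hψ hC ht hw) hi2).2 _ hae).trans ?_
  gcongr
  refine (integral_mono_ae hi2 (hi.1.add hiψ) hle).trans ?_
  rw [integral_add' hi.1 hiψ]
  gcongr
  exact hi.2

theorem eq_zero_of_inner_test {v : L2 n} (h : ∀ ψ, ∀ hψ : IsTest n ψ, inner ℂ hψ.toL2 v = 0) :
    v = 0 := by
  have hv := Lp.memLp v
  have key := isOpen_halfSpace.ae_eq_zero_of_integral_contDiff_smul_eq_zero
    (locallyIntegrableOn_of_memLp hv) fun g hg hc hs => by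
      have ht : IsTest n fun w => (g w : ℂ) := by
        have hsub : tsupport (fun w => (g w : ℂ)) ⊆ tsupport g :=
          closure_mono fun w hw h => hw (by simp [h])
        exact ⟨Complex.ofRealCLM.contDiff.comp hg,
          hc.mono' ((subset_tsupport _).trans hsub), hsub.trans hs⟩
      have := h _ ht
      rw [inner_eq_integral ht.coeFn_toL2 (ae_eq_refl _)] at this
      simpa only [Complex.conj_ofReal, Complex.real_smul] using this
  refine Lp.ext ?_
  filter_upwards [key, ae_mem_halfSpace, Lp.coeFn_zero ℂ 2 (hypVolume n)] with w h1 h2 h3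
  rw [h1 h2, h3]
  rfl

theorem contDiff_decayConst : ContDiff ℝ ∞ (decayConst : EuclideanSpace ℝ (Fin n) → ℝ) := by
  unfold decayConst
  refine contDiff_height.div (contDiff_const.mul (((contDiff_const.mul (contDiff_height.pow 2)).add
    contDiff_const).add (contDiff_const.mul (contDiff_id.norm_sq ℝ)))) fun w => ?_
  positivity

/-- Fubini and the symmetry of the kernel: pairings with P_tψ are averages over w of pairings with
K_t(w, ·), which transfers identities proved for each w. -/
theorem inner_heatTestL2 {ψ : EuclideanSpace ℝ (Fin n) → ℂ} (hψ : IsTest n ψ) {t : ℝ} (ht : 0 < t)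
    (f : L2 n) : inner ℂ (heatTestL2 t ψ) f =
      ∫ w, starRingEnd ℂ (ψ w) * inner ℂ (heatVec t w) f ∂(hypVolume n) := by
  have hn := NeZero.ne n
  have hf := Lp.memLp f
  set G : EuclideanSpace ℝ (Fin n) → EuclideanSpace ℝ (Fin n) → ℂ := fun w w' =>
    starRingEnd ℂ (ψ w) * ((measKernel n t (coshDist w w') : ℂ) * f w') with hG
  obtain ⟨C, hC, hdec⟩ := radialKernel_abs_decay hn (n + 2) (a := t) (b := t) ht
  have hGm : AEStronglyMeasurable (Function.uncurry G) ((hypVolume n).prod (hypVolume n)) := by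
    have hψm : Measurable ψ := hψ.1.continuous.measurable
    have h1 : Measurable fun p : EuclideanSpace ℝ (Fin n) × EuclideanSpace ℝ (Fin n) =>
        starRingEnd ℂ (ψ p.1) := Complex.continuous_conj.measurable.comp (hψm.comp measurable_fst)
    have h2 : Measurable fun p : EuclideanSpace ℝ (Fin n) × EuclideanSpace ℝ (Fin n) =>
        (measKernel n t (coshDist p.1 p.2) : ℂ) :=
      Complex.measurable_ofReal.comp (measurable_measKernel_coshDist ht)
    exact h1.aestronglyMeasurable.mul (h2.aestronglyMeasurable.mul hf.1.comp_snd)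
  have hGi : Integrable (Function.uncurry G) ((hypVolume n).prod (hypVolume n)) := by
    have t1 : IsTest n fun w => (((C * (decayConst w ^ (n + 2))⁻¹ : ℝ)) : ℂ) * ψ w := by
      refine hψ.contDiffOn_mul (Complex.ofRealCLM.contDiff.comp_contDiffOn (contDiffOn_const.mul
        ((contDiff_decayConst.pow _).contDiffOn.inv fun w hw => ?_)))
      exact pow_ne_zero _ (decayConst_pos hw).ne'
    have i1 := (integrable_of_isTest t1.1.continuous t1.2.1 t1.2.2).norm
    have i2 := memLp_decayWeight_pow.integrable_mul hf.norm
    refine (i1.mul_prod i2).mono' hGm ?_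
    filter_upwards [Measure.quasiMeasurePreserving_fst.ae ae_mem_halfSpace,
      Measure.quasiMeasurePreserving_snd.ae ae_mem_halfSpace] with p h1 h2
    have hd := decayConst_pos h1
    simp only [Function.uncurry, hG, Pi.mul_apply]
    rw [norm_mul, norm_mul, norm_mul, RCLike.norm_conj, measKernel_eq (coshDist_pos h1 h2),
      Complex.norm_real, Complex.norm_real, norm_of_nonneg (by positivity : 0 ≤ C * _), norm_eq_abs]
    calc ‖ψ p.1‖ * (|radialKernel n t (coshDist p.1 p.2)| * ‖f p.2‖)
        ≤ ‖ψ p.1‖ * (C * ((decayConst p.1 ^ (n + 2))⁻¹ * decayWeight p.2 ^ (n + 2)) * ‖f p.2‖) := by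
          gcongr
          refine (hdec t ⟨le_rfl, le_rfl⟩ _ (coshDist_pos h1 h2)).trans ?_
          gcongr
          exact inv_coshDist_pow_le h1 h2 _
      _ = _ := by ring
  calc inner ℂ (heatTestL2 t ψ) f = ∫ w', starRingEnd ℂ (heatTest t ψ w') * f w' ∂(hypVolume n) :=
        inner_eq_integral (coeFn_heatTestL2 hψ ht) (ae_eq_refl _)
    _ = ∫ w', ∫ w, G w w' ∂(hypVolume n) ∂(hypVolume n) := by
        refine integral_congr_ae ?_
        filter_upwards [ae_mem_halfSpace] with w' hw'
        rw [heatTest, ← integral_conj, ← integral_mul_const]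
        refine integral_congr_ae (ae_of_all _ fun w => ?_)
        simp only [hG, map_mul, Complex.conj_ofReal]
        rw [coshDist_comm w']
        ring
    _ = ∫ w, ∫ w', G w w' ∂(hypVolume n) ∂(hypVolume n) := (integral_integral_swap hGi).symm
    _ = _ := by
        refine integral_congr_ae ?_
        filter_upwards [ae_mem_halfSpace] with w hw
        rw [← heatTest_eq_inner ht hw (ae_eq_refl _), heatTest, ← integral_const_mul]

/-- A vector v orthogonal to the range of 1 - 𝓛_n solves 𝓛_n v = v weakly, so its pairings with
K_t(w, ·) grow like e^t. Averaged over a test function they must stay bounded, so they vanish, and t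
→ 0 recovers v. -/
theorem eq_zero_of_inner_range {v : L2 n}
    (hv : ∀ p ∈ closure (lapGraph n), inner ℂ v (p.1 - p.2) = 0) : v = 0 := by
  have key : ∀ w ∈ halfSpace n, ∀ s, 0 < s → ∀ t, 0 < t →
      inner ℂ (heatVec t w) v = exp (t - s) * inner ℂ (heatVec s w) v := by
    intro w hw s hs t ht
    have hd : ∀ r ∈ Ioi (0 : ℝ), HasDerivAt (fun r => (exp (-r) : ℂ) * inner ℂ (heatVec r w) v) 0 r := by
      intro r hr
      have h1 := hasDerivAt_inner_heatVec hr hw v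
      have e : inner ℂ (heatVecDot r w) v = inner ℂ (heatVec r w) v := by
        have := hv _ (heatVec_mem_closure hr hw)
        rw [inner_sub_right, sub_eq_zero] at this
        rw [← inner_conj_symm, ← this, inner_conj_symm]
      rw [e] at h1
      have h2 : HasDerivAt (fun r : ℝ => ((exp (-r) : ℝ) : ℂ)) ((-exp (-r) : ℝ) : ℂ) r := by
        have := ((hasDerivAt_neg r).exp).ofReal_comp
        exact this.congr_deriv (by simp)
      refine (h2.mul h1).congr_deriv ?_
      push_cast
      ring
    have hc := isOpen_Ioi.is_const_of_deriv_eq_zero isPreconnected_Ioi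
      (fun r hr => (hd r hr).differentiableAt.differentiableWithinAt) (fun r hr => (hd r hr).deriv)
      (mem_Ioi.2 ht) (mem_Ioi.2 hs)
    have e1 : ((exp (t - s) : ℝ) : ℂ) = exp t * exp (-s) := by
      rw [← Complex.ofReal_mul, ← exp_add, sub_eq_add_neg]
    have e2 : ((exp t : ℝ) : ℂ) * exp (-t) = 1 := by
      rw [← Complex.ofReal_mul, ← exp_add, add_neg_cancel, exp_zero, Complex.ofReal_one]
    calc inner ℂ (heatVec t w) v = exp t * exp (-t) * inner ℂ (heatVec t w) v := by rw [e2, one_mul]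
      _ = exp (t - s) * inner ℂ (heatVec s w) v := by rw [mul_assoc, hc, e1, mul_assoc]
  refine eq_zero_of_inner_test fun ψ hψ => ?_
  obtain ⟨B, hB⟩ := exists_norm_heatTestL2_le hψ
  have hb : ∀ s, 0 < s → ∀ t, 0 < t →
      inner ℂ (heatTestL2 t ψ) v = exp (t - s) * inner ℂ (heatTestL2 s ψ) v := by
    intro s hs t ht
    rw [inner_heatTestL2 hψ ht, inner_heatTestL2 hψ hs, ← integral_const_mul]
    refine integral_congr_ae ?_
    filter_upwards [ae_mem_halfSpace] with w hw
    rw [key w hw s hs t ht]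
    ring
  have hz : ∀ s, 0 < s → inner ℂ (heatTestL2 s ψ) v = 0 := by
    intro s hs
    -- Boundedness at large t is transported back to the fixed time s with the factor e^{s-t}.
    have hle : ∀ t, 0 < t → ‖inner ℂ (heatTestL2 s ψ) v‖ ≤ exp (-t) * (exp s * (B * ‖v‖)) := by
      intro t ht
      have h1 : ‖inner ℂ (heatTestL2 t ψ) v‖ ≤ B * ‖v‖ :=
        (norm_inner_le_norm _ _).trans (by gcongr; exact hB t ht)
      rw [hb s hs t ht, norm_mul, Complex.norm_real, norm_of_nonneg (exp_pos _).le] at h1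
      calc ‖inner ℂ (heatTestL2 s ψ) v‖
          = exp (-t) * exp s * (exp (t - s) * ‖inner ℂ (heatTestL2 s ψ) v‖) := by
            rw [← mul_assoc, ← exp_add, ← exp_add]
            simp
        _ ≤ exp (-t) * exp s * (B * ‖v‖) := by gcongr
        _ = _ := by ring
    have lim : Tendsto (fun t => exp (-t) * (exp s * (B * ‖v‖))) atTop (𝓝 0) := by
      simpa using (tendsto_exp_neg_atTop_nhds_zero).mul_const (exp s * (B * ‖v‖))
    have := ge_of_tendsto lim (by filter_upwards [eventually_gt_atTop 0] with t ht using hle t ht)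
    exact norm_le_zero_iff.1 this
  have l1 := (tendsto_heatTestL2 hψ).inner (𝕜 := ℂ) (tendsto_const_nhds (x := v))
  have l2 : Tendsto (fun t => inner ℂ (heatTestL2 t ψ) v) (𝓝[>] 0) (𝓝 0) := by
    refine tendsto_const_nhds.congr' ?_
    filter_upwards [self_mem_nhdsWithin] with t ht using (hz t ht).symm
  exact tendsto_nhds_unique l1 l2

/-- The defining property determines R pointwise, so the chosen resolvent inherits positivity from
the one just constructed. -/
theorem isResolvent_resolvent : IsResolvent n (resolvent n) ∧ (resolvent n).IsPositive ∧
    (1 - resolvent n).IsPositive := by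
  obtain ⟨R, h1, h2, h3⟩ := exists_resolvent_of_dense (lapSubmodule n).topologicalClosure
    (Submodule.isClosed_topologicalClosure _)
    (fun p hp q hq => inner_symm_of_mem_closure hp hq)
    (fun p hp => re_inner_nonpos_of_mem_closure hp)
    (fun v hv => eq_zero_of_inner_range hv)
  have hR : IsResolvent n R := h1
  have hex : ∃ R, IsResolvent n R := ⟨R, hR⟩
  have hr : IsResolvent n (resolvent n) := by
    rw [resolvent, dif_pos hex]
    exact hex.choose_spec
  have e : resolvent n = R := ContinuousLinearMap.ext fun f => (hr f (R f)).2 ((hR f (R f)).1 rfl)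
  rw [e]
  exact ⟨hR, h2, h3⟩

theorem spectrum_resolvent : spectrum ℝ (resolvent n) ⊆ Icc 0 1 :=
  spectrum_subset_Icc isResolvent_resolvent.2.1 isResolvent_resolvent.2.2

theorem isSelfAdjoint_resolvent : IsSelfAdjoint (resolvent n) :=
  isResolvent_resolvent.2.1.isSelfAdjoint

/-- The range contains every test function ψ, as the image of ψ - 𝓛_nψ. -/
theorem denseRange_resolvent : DenseRange (resolvent n) := by
  have : (LinearMap.range (resolvent n).toLinearMap).topologicalClosure = ⊤ := by
    rw [Submodule.topologicalClosure_eq_top_iff, Submodule.eq_bot_iff]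
    intro v hv
    refine eq_zero_of_inner_test fun ψ hψ => ?_
    refine (Submodule.mem_orthogonal _ v).1 hv _ ⟨hψ.toL2 - hψ.hypLap.toL2, ?_⟩
    refine (isResolvent_resolvent.1 _ _).2 ?_
    rw [sub_sub_cancel]
    exact subset_closure hψ.mem_lapGraph
  have h2 := Submodule.dense_iff_topologicalClosure_eq_top.2 this
  exact h2

/-- The heat semigroup at a test function is given by the radial kernel. -/
theorem heatSemigroup_test {τ : ℝ} (hτ : 0 < τ) {φ : EuclideanSpace ℝ (Fin n) → ℂ}
    (hφ : IsTest n φ) : heatSemigroup n τ hφ.toL2 = heatTestL2 τ φ := by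
  set f := hφ.toL2 with hf
  have hs := spectrum_resolvent (n := n)
  have hR := isSelfAdjoint_resolvent (n := n)
  have hder : ∀ t, 0 < t → HasDerivAt (fun t => heatSemigroup n t f) (calculusDeriv (resolvent n) t f) t :=
    fun t ht => 
      ((ContinuousLinearMap.apply ℂ (L2 n) f).restrictScalars ℝ).hasFDerivAt.comp_hasDerivAt t
        (hasDerivAt_calculus_exp hs ht)
  have hmem : ∀ t, 0 < t →
      (heatSemigroup n t f, calculusDeriv (resolvent n) t f) ∈ closure (lapGraph n) := by
    intro t ht
    have h1 := congrArg (fun A : L2 n →L[ℂ] L2 n => A f) (resolvent_mul_calculus hR hs ht)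
    have h2 := (isResolvent_resolvent.1 _ _).1 h1
    have e : heatSemigroup n t f - (heatSemigroup n t f - calculusDeriv (resolvent n) t f) =
      calculusDeriv (resolvent n) t f := sub_sub_cancel _ _
    rw [← e]
    exact h2
  have hflip : ∀ t < τ, HasDerivAt (fun t => heatSemigroup n (τ - t) f)
      (-calculusDeriv (resolvent n) (τ - t) f) t := fun t ht => by
    have := (hder (τ - t) (by linarith)).scomp t ((hasDerivAt_id t).const_sub τ)
    exact this.congr_deriv (by simp)
  -- The derivative in t vanishes: that of K_t produces ⟨K_t, 𝓛_n e^{(τ-t)𝓛_n} f⟩ by symmetry, and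
  -- that of the semigroup produces its negative. The constant is found by letting t → τ.
  have key : ∀ w ∈ halfSpace n, ∀ t ∈ Ioo 0 τ,
      inner ℂ (heatVec t w) (heatSemigroup n (τ - t) f) = inner ℂ (heatVec τ w) f := by
    intro w hw t ht
    have hd : ∀ r ∈ Ioo 0 τ,
        HasDerivAt (fun r => inner ℂ (heatVec r w) (heatSemigroup n (τ - r) f)) 0 r := by
      intro r hr
      have h1 := hasDerivAt_inner_of_weak (continuousAt_heatVec hr.1 hw)
        (hasDerivAt_inner_heatVec_of_mem hr.1 hw (hmem (τ - r) (by linarith [hr.2]))) (hflip r hr.2)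
      rwa [inner_neg_right, add_neg_cancel] at h1
    have hc := fun s (hs : s ∈ Ioo 0 τ) => isOpen_Ioo.is_const_of_deriv_eq_zero isPreconnected_Ioo
      (fun r hr => (hd r hr).differentiableAt.differentiableWithinAt) (fun r hr => (hd r hr).deriv)
      hs ht
    have l1 : Tendsto (fun s => heatVec s w) (𝓝[<] τ) (𝓝 (heatVec τ w)) :=
      (continuousAt_heatVec hτ hw).tendsto.mono_left nhdsWithin_le_nhds
    have l2 : Tendsto (fun s => heatSemigroup n (τ - s) f) (𝓝[<] τ) (𝓝 f) := by
      refine (tendsto_calculus_exp hR hs denseRange_resolvent f).comp ?_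
      refine tendsto_nhdsWithin_iff.2 ⟨?_, ?_⟩
      · have : Continuous fun s : ℝ => τ - s := by fun_prop
        simpa using (this.tendsto τ).mono_left nhdsWithin_le_nhds
      · filter_upwards [self_mem_nhdsWithin] with s hs using mem_Ioi.2 (sub_pos.2 (mem_Iio.1 hs))
    refine tendsto_nhds_unique ?_ (l1.inner (𝕜 := ℂ) l2)
    refine tendsto_const_nhds.congr' ?_
    filter_upwards [Ioo_mem_nhdsLT hτ] with s hs using (hc s hs).symm
  rw [← sub_eq_zero]
  refine eq_zero_of_inner_test fun ψ hψ => ?_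
  rw [inner_sub_right, sub_eq_zero]
  have e1 : inner ℂ hψ.toL2 (heatTestL2 τ φ) =
      ∫ w, starRingEnd ℂ (ψ w) * inner ℂ (heatVec τ w) f ∂(hypVolume n) := by
    rw [inner_eq_integral hψ.coeFn_toL2 (coeFn_heatTestL2 hφ hτ)]
    refine integral_congr_ae ?_
    filter_upwards [ae_mem_halfSpace] with w hw
    rw [heatTest_eq_inner hτ hw hφ.coeFn_toL2]
  -- The limit t → 0 is not taken for K_t(w, ·) at a fixed w but after averaging against ψ, where
  -- P_tψ → ψ in L² is known.
  have e2 : ∀ t ∈ Ioo 0 τ, inner ℂ (heatTestL2 t ψ) (heatSemigroup n (τ - t) f) =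
      inner ℂ hψ.toL2 (heatTestL2 τ φ) := by
    intro t ht
    rw [e1, inner_heatTestL2 hψ ht.1]
    refine integral_congr_ae ?_
    filter_upwards [ae_mem_halfSpace] with w hw
    rw [key w hw t ht]
  have l2 : Tendsto (fun t => heatSemigroup n (τ - t) f) (𝓝[>] 0) (𝓝 (heatSemigroup n τ f)) := by
    have := (hflip 0 hτ).continuousAt.tendsto
    rw [sub_zero] at this
    exact this.mono_left nhdsWithin_le_nhds
  refine tendsto_nhds_unique ((tendsto_heatTestL2 hψ).inner (𝕜 := ℂ) l2) ?_
  refine tendsto_const_nhds.congr' ?_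
  filter_upwards [Ioo_mem_nhdsGT hτ] with t ht using (e2 t ht).symm

end HeatTestL2

end

/-! ### Uniqueness of the kernel and the relations (i), (ii), (iii) -/

section

section HeatKernel

variable {n : ℕ} [NeZero n]

theorem isHeatKernel_radialKernel {t : ℝ} (ht : 0 < t) :
    IsHeatKernel n t fun ρ => radialKernel n t (cosh ρ) := by
  refine ⟨(contDiffOn_radialKernel (NeZero.ne n) ht).continuousOn.comp continuous_cosh.continuousOn
    fun ρ _ => cosh_pos ρ, fun φ f hφ hf => ?_⟩
  have e : f = hφ.toL2 := Lp.ext (hf.trans hφ.coeFn_toL2.symm)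
  rw [e, heatSemigroup_test ht hφ]
  refine (coeFn_heatTestL2 hφ ht).trans ?_
  filter_upwards [ae_mem_halfSpace] with w hw
  refine integral_congr_ae ?_
  filter_upwards [ae_mem_halfSpace] with w' hw'
  rw [cosh_hypDist hw hw', measKernel_eq (coshDist_pos hw hw')]

theorem hypVolume_pos_of_isOpen {s : Set (EuclideanSpace ℝ (Fin n))} (hs : IsOpen s)
    (hne : s.Nonempty) (hsub : s ⊆ halfSpace n) : 0 < hypVolume n s := by
  rw [pos_iff_ne_zero]
  intro h
  have hac : volume.restrict (halfSpace n) ≪ hypVolume n := by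
    rw [hypVolume_eq]
    refine withDensity_absolutelyContinuous' measurable_volDensity.ennreal_ofReal.aemeasurable ?_
    filter_upwards [ae_restrict_mem measurableSet_halfSpace] with w hw
    have p : 0 < height w := hw
    rw [Ne, ENNReal.ofReal_eq_zero, not_le]
    unfold volDensity
    positivity
  have h2 := hac h
  rw [Measure.restrict_apply hs.measurableSet, inter_eq_left.2 hsub] at h2
  exact (hs.measure_pos volume hne).ne' h2

theorem continuousOn_hypDist : ContinuousOn
    (fun p : EuclideanSpace ℝ (Fin n) × EuclideanSpace ℝ (Fin n) => hypDist p.1 p.2)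
    (halfSpace n ×ˢ halfSpace n) := by
  have hh : Continuous (height : EuclideanSpace ℝ (Fin n) → ℝ) := continuous_height
  have h : ContinuousOn (fun p : EuclideanSpace ℝ (Fin n) × EuclideanSpace ℝ (Fin n) =>
      ‖p.1 - p.2‖ / (2 * √(height p.1 * height p.2))) (halfSpace n ×ˢ halfSpace n) := by
    refine ContinuousOn.div (by fun_prop) (by fun_prop) ?_
    rintro p ⟨h1, h2⟩
    have p1 : 0 < height p.1 := h1
    have p2 : 0 < height p.2 := h2
    positivity
  exact continuousOn_const.mul (continuous_arsinh.comp_continuousOn h)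

theorem continuousOn_hypDist_right {w : EuclideanSpace ℝ (Fin n)} (hw : w ∈ halfSpace n) :
    ContinuousOn (hypDist w) (halfSpace n) :=
  ContinuousOn.comp (f := fun w' => (w, w')) continuousOn_hypDist
    (continuous_const.prodMk continuous_id).continuousOn fun _ hw' => ⟨hw, hw'⟩

/-- Two points on the vertical axis at heights 1 and e^ρ will do in every dimension, including n =
1. Every ρ ≥ 0 being a distance is what makes the kernel unique on all of [0, ∞). -/
theorem exists_hypDist_eq {ρ : ℝ} (hρ : 0 ≤ ρ) :
    ∃ w ∈ halfSpace n, ∃ w' ∈ halfSpace n, hypDist w w' = ρ := by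
  set e : ℝ → EuclideanSpace ℝ (Fin n) := fun c => EuclideanSpace.single (lastIdx n) c with he
  have hy : ∀ c, height (e c) = c := fun c => by simp [e, height]
  have h1 : e 1 ∈ halfSpace n := by rw [mem_halfSpace, hy]; exact one_pos
  have h2 : e (exp ρ) ∈ halfSpace n := by rw [mem_halfSpace, hy]; exact exp_pos ρ
  refine ⟨_, h1, _, h2, ?_⟩
  have hc := cosh_hypDist h1 h2
  have hN : ‖e 1 - e (exp ρ)‖ ^ 2 = (1 - exp ρ) ^ 2 := by
    have : e 1 - e (exp ρ) = e (1 - exp ρ) := by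
      simp only [he]
      ext i
      by_cases h : i = lastIdx n <;> simp [h]
    rw [this, he, PiLp.norm_single, norm_eq_abs, sq_abs]
  rw [coshDist, hN, hy, hy] at hc
  have hr : 1 + (1 - exp ρ) ^ 2 / (2 * (1 * exp ρ)) = cosh ρ := by
    rw [cosh_eq, exp_neg]
    have := exp_pos ρ
    field_simp
    ring
  rw [hr] at hc
  exact cosh_strictMonoOn.injOn (hypDist_nonneg _ _) hρ hc

/-- If two kernels differ at ρ, their difference keeps its sign for w, w' near two points at
distance ρ. A bump function in w' then separates the two integrals for every w in an open set of
positive measure. -/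
theorem IsHeatKernel.eqOn {t : ℝ} {k k' : ℝ → ℝ} (hk : IsHeatKernel n t k)
    (hk' : IsHeatKernel n t k') : EqOn k k' (Ici 0) := by
  intro ρ hρ
  by_contra hne
  obtain ⟨w₀, hw₀, w₁, hw₁, hd⟩ := exists_hypDist_eq (n := n) hρ
  -- Multiplying by the value of the difference at ρ makes κ positive at ρ whatever the sign of the
  -- difference.
  set κ : ℝ → ℝ := fun r => (k ρ - k' ρ) * (k r - k' r) with hκ
  have hκc : ContinuousOn κ (Ici 0) := continuousOn_const.mul (hk.1.sub hk'.1)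
  have hΦ : ContinuousOn
      (fun p : EuclideanSpace ℝ (Fin n) × EuclideanSpace ℝ (Fin n) => κ (hypDist p.1 p.2))
      (halfSpace n ×ˢ halfSpace n) :=
    hκc.comp continuousOn_hypDist fun p _ => hypDist_nonneg _ _
  have hopen := isOpen_halfSpace (n := n)
  have hnhds : halfSpace n ×ˢ halfSpace n ∈ 𝓝 (w₀, w₁) := (hopen.prod hopen).mem_nhds ⟨hw₀, hw₁⟩
  have hpos : 0 < κ (hypDist w₀ w₁) := by
    rw [hd]
    exact mul_self_pos.2 (sub_ne_zero.2 hne)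
  have hev : {p : EuclideanSpace ℝ (Fin n) × EuclideanSpace ℝ (Fin n) |
      0 < κ (hypDist p.1 p.2)} ∩ halfSpace n ×ˢ halfSpace n ∈ 𝓝 (w₀, w₁) :=
    inter_mem ((hΦ.continuousAt hnhds).eventually (lt_mem_nhds hpos)) hnhds
  obtain ⟨U, V, hU, hwU, hV, hwV, hUV⟩ := mem_nhds_prod_iff'.1 hev
  obtain ⟨g, hgs, hgc, hg, hg01, hg1⟩ := exists_contDiff_tsupport_subset (n := ⊤) (hV.mem_nhds hwV)
  have hUs : U ⊆ halfSpace n := fun w hw => (hUV (mk_mem_prod hw hwV)).2.1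
  have hVs : V ⊆ halfSpace n := fun w hw => (hUV (mk_mem_prod hwU hw)).2.2
  have hgt : IsTest n fun w => (g w : ℂ) := by
    have hsub : tsupport (fun w => (g w : ℂ)) ⊆ tsupport g :=
      closure_mono fun w hw h => hw (by simp [h])
    exact ⟨Complex.ofRealCLM.contDiff.comp hg, hgc.mono' ((subset_tsupport _).trans hsub),
      hsub.trans (hgs.trans hVs)⟩
  have hcont : ∀ {q : ℝ → ℝ}, ContinuousOn q (Ici 0) → ∀ w ∈ halfSpace n,
      Continuous (fun w' => q (hypDist w w') * g w') ∧
        Integrable (fun w' => q (hypDist w w') * g w') (hypVolume n) := by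
    intro q hq w hw
    have hsub : tsupport (fun w' => q (hypDist w w') * g w') ⊆ tsupport g := tsupport_mul_subset_right
    have hc : ContinuousOn (fun w' => q (hypDist w w') * g w') (halfSpace n) := by
      exact ContinuousOn.mul (hq.comp (continuousOn_hypDist_right hw) fun w' _ => hypDist_nonneg _ _)
        hg.continuous.continuousOn
    have hcc := hc.continuous_of_tsupport_subset hopen (hsub.trans (hgs.trans hVs))
    exact ⟨hcc, integrable_of_isTest hcc (hgc.mono' ((subset_tsupport _).trans hsub))
      (hsub.trans (hgs.trans hVs))⟩
  have hae : ∀ᵐ w ∂(hypVolume n), w ∉ U := by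
    filter_upwards [ae_mem_halfSpace, (hk.2 _ _ hgt hgt.coeFn_toL2).symm.trans
      (hk'.2 _ _ hgt hgt.coeFn_toL2)] with w hw heq hwU
    simp only [← Complex.ofReal_mul, integral_complex_ofReal, Complex.ofReal_inj] at heq
    have h1 := (hcont hk.1 w hw).2
    have h2 := (hcont hk'.1 w hw).2
    obtain ⟨hc, hi⟩ := hcont hκc w hw
    have hzero : ∫ w', κ (hypDist w w') * g w' ∂(hypVolume n) = 0 := by
      have : ∀ w', κ (hypDist w w') * g w' = (k ρ - k' ρ) *
          (k (hypDist w w') * g w' - k' (hypDist w w') * g w') := fun w' => by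
        simp only [hκ]; ring
      simp only [this]
      rw [integral_const_mul, integral_sub h1 h2, heq, sub_self, mul_zero]
    have hnn : 0 ≤ fun w' => κ (hypDist w w') * g w' := by
      intro w'
      by_cases hw' : w' ∈ V
      · exact mul_nonneg (hUV (mk_mem_prod hwU hw')).1.le (hg01 (mem_range_self w')).1
      · have : g w' = 0 := image_eq_zero_of_notMem_tsupport fun h => hw' (hgs h)
        simp [this]
    have hsupp : Function.support (fun w' => κ (hypDist w w') * g w') ⊆ halfSpace n := by
      intro w' hw'
      refine hVs (hgs (subset_tsupport _ fun h => hw' ?_))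
      simp [h]
    have hmem : w₁ ∈ Function.support (fun w' => κ (hypDist w w') * g w') := by
      rw [Function.mem_support, hg1, mul_one]
      exact (hUV (mk_mem_prod hwU hwV)).1.ne'
    have := (integral_pos_iff_support_of_nonneg hnn hi).2
      (hypVolume_pos_of_isOpen hc.isOpen_support ⟨_, hmem⟩ hsupp)
    exact this.ne' hzero
  have h0 : hypVolume n U = 0 := by
    rw [ae_iff] at hae
    simpa using hae
  exact (hypVolume_pos_of_isOpen hU ⟨_, hwU⟩ hUs).ne' h0

theorem isHeatKernel_heatKernel {t : ℝ} (ht : 0 < t) : IsHeatKernel n t (heatKernel n t) := by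
  have h : ∃ k, IsHeatKernel n t k := ⟨_, isHeatKernel_radialKernel ht⟩
  rw [heatKernel, dif_pos h]
  exact h.choose_spec

theorem heatKernel_eq {t ρ : ℝ} (ht : 0 < t) (hρ : 0 ≤ ρ) :
    heatKernel n t ρ = radialKernel n t (cosh ρ) :=
  (isHeatKernel_heatKernel ht).eqOn (isHeatKernel_radialKernel ht) hρ

theorem hasDerivAt_heatKernel {t ρ : ℝ} (ht : 0 < t) (hρ : 0 < ρ) :
    HasDerivAt (heatKernel n t) (-(2 * π) * heatKernel (n + 2) t ρ * sinh ρ) ρ := by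
  rw [heatKernel_eq ht hρ.le]
  refine ((hasDerivAt_radialKernel (NeZero.ne n) ht (cosh_pos ρ)).comp ρ
    (hasDerivAt_cosh ρ)).congr_of_eventuallyEq ?_
  filter_upwards [Ioi_mem_nhds hρ] with s hs using heatKernel_eq ht (mem_Ioi.1 hs).le

theorem hasLaplace_heatSemigroup :
    HasLaplace (fun u : ℝ => (((√u)⁻¹ : ℝ) : ℂ) • heatSemigroup n (1 / (4 * u)))
      (fun p : ℝ => ((√π / √p : ℝ) : ℂ) • poissonSemigroup n (√p)) :=
  hasLaplace_calculus isSelfAdjoint_resolvent spectrum_resolvent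

theorem heatSemigroup_eq_inverseLaplace {t : ℝ} (ht : 0 < t) :
    heatSemigroup n t = (((4 * t) ^ (-(1 / 2) : ℝ) : ℝ) : ℂ) •
      inverseLaplace (fun p : ℝ => ((√π / √p : ℝ) : ℂ) • poissonSemigroup n (√p)) (1 / (4 * t)) := by
  rw [(hasLaplace_heatSemigroup (n := n)).inverseLaplace.2 (mem_Ioi.2 (by positivity)), smul_smul,
    ← Complex.ofReal_mul]
  have e1 : 1 / (4 * (1 / (4 * t))) = t := by field_simp
  -- At u = 1 / (4t) the weight u^{-1/2} is (4t)^{1/2}, cancelled by the prefactor.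
  have e2 : (4 * t) ^ (-(1 / 2) : ℝ) * (√(1 / (4 * t)))⁻¹ = 1 := by
    rw [one_div (4 * t), sqrt_inv, inv_inv, sqrt_eq_rpow, ← rpow_add (by positivity)]
    norm_num
  rw [e1, e2, Complex.ofReal_one, one_smul]

/-- The change of variable x = √(2(cosh ρ - cosh r)) maps (r, ∞) onto (0, ∞) with x dx = sinh ρ dρ,
and the square root in the integrand is x / 2. The result is the half-line form of the Abel
transform. -/
theorem integral_heatKernel_succ {t r : ℝ} (ht : 0 < t) (hr : 0 ≤ r) :
    IntegrableOn (fun ρ => heatKernel (n + 1) t ρ / √(cosh (ρ / 2) ^ 2 - cosh (r / 2) ^ 2) * sinh ρ)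
        (Ioi r) ∧
      ∫ ρ in Ioi r, heatKernel (n + 1) t ρ / √(cosh (ρ / 2) ^ 2 - cosh (r / 2) ^ 2) * sinh ρ =
        heatKernel n t r := by
  set u : ℝ → ℝ := fun ρ => √(2 * (cosh ρ - cosh r)) with hu
  -- The factor 2 comes from the denominator x / 2 and is also what evenness needs to pass from the
  -- half line to the line.
  set F : ℝ → ℝ := fun x => 2 * radialKernel (n + 1) t (cosh r + x ^ 2 / 2) with hF
  have hlt : ∀ ρ ∈ Ioi r, cosh r < cosh ρ := fun ρ hρ =>
    cosh_strictMonoOn hr (hr.trans (mem_Ioi.1 hρ).le) hρ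
  have hupos : ∀ ρ ∈ Ioi r, 0 < u ρ := fun ρ hρ => sqrt_pos.2 (by linarith [hlt ρ hρ])
  have husq : ∀ ρ ∈ Ioi r, u ρ ^ 2 = 2 * (cosh ρ - cosh r) := fun ρ hρ =>
    sq_sqrt (by linarith [hlt ρ hρ])
  have hder : ∀ ρ ∈ Ioi r, HasDerivWithinAt u (sinh ρ / u ρ) (Ioi r) ρ := by
    intro ρ hρ
    have hne : 2 * (cosh ρ - cosh r) ≠ 0 := (by linarith [hlt ρ hρ] : 0 < 2 * (cosh ρ - cosh r)).ne'
    have h := (((hasDerivAt_cosh ρ).sub_const (cosh r)).const_mul 2).sqrt hne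
    refine (h.congr_deriv ?_).hasDerivWithinAt
    rw [mul_div_mul_left _ _ two_ne_zero]
  have hinj : InjOn u (Ioi r) := by
    intro a ha b hb hab
    have h := husq a ha
    rw [hab, husq b hb] at h
    exact cosh_strictMonoOn.injOn (hr.trans (mem_Ioi.1 ha).le) (hr.trans (mem_Ioi.1 hb).le)
      (by linarith)
  have himage : u '' Ioi r = Ioi 0 := by
    refine Subset.antisymm (image_subset_iff.2 hupos) fun x hx => ?_
    have hx0 : 0 < x := hx
    have h1 : 1 ≤ cosh r + x ^ 2 / 2 := by nlinarith [one_le_cosh r, sq_nonneg x]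
    have hc : cosh (arcosh (cosh r + x ^ 2 / 2)) = cosh r + x ^ 2 / 2 := cosh_arcosh h1
    refine ⟨arcosh (cosh r + x ^ 2 / 2), ?_, ?_⟩
    · refine (cosh_strictMonoOn.lt_iff_lt hr (arcosh_nonneg h1)).1 ?_
      rw [hc]
      have : 0 < x ^ 2 := by positivity
      linarith
    · simp only [hu]
      rw [hc, show 2 * (cosh r + x ^ 2 / 2 - cosh r) = x ^ 2 by ring, sqrt_sq hx0.le]
  have hint : ∀ ρ ∈ Ioi r, |sinh ρ / u ρ| • F (u ρ) =
      heatKernel (n + 1) t ρ / √(cosh (ρ / 2) ^ 2 - cosh (r / 2) ^ 2) * sinh ρ := by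
    intro ρ hρ
    have hρ0 : 0 < ρ := hr.trans_lt hρ
    have hup := hupos ρ hρ
    have hs : √(cosh (ρ / 2) ^ 2 - cosh (r / 2) ^ 2) = u ρ / 2 := by
      have h2 : ∀ x : ℝ, cosh x = 2 * cosh (x / 2) ^ 2 - 1 := fun x => by
        have := cosh_two_mul (x / 2)
        rw [mul_div_cancel₀ x two_ne_zero, sinh_sq] at this
        linarith
      rw [sqrt_eq_iff_mul_self_eq_of_pos (by positivity)]
      have := husq ρ hρ
      rw [h2 ρ, h2 r] at this
      nlinarith
    have he : cosh r + u ρ ^ 2 / 2 = cosh ρ := by rw [husq ρ hρ]; ring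
    have hsinh : 0 < sinh ρ := sinh_pos_iff.2 hρ0
    rw [abs_of_pos (div_pos hsinh hup), hs, heatKernel_eq ht hρ0.le, smul_eq_mul]
    simp only [hF, he]
    field_simp
  have hFi : Integrable F :=
    (integrable_radialKernel_shift (NeZero.ne (n + 1)) ht (cosh_pos r)).const_mul 2
  constructor
  · have := (integrableOn_image_iff_integrableOn_abs_deriv_smul measurableSet_Ioi hder hinj F).1
      hFi.integrableOn
    exact this.congr_fun hint measurableSet_Ioi
  · rw [← setIntegral_congr_fun measurableSet_Ioi hint,
      ← integral_image_eq_integral_abs_deriv_smul measurableSet_Ioi hder hinj, himage,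
      heatKernel_eq ht hr, radialKernel_eq_abel (NeZero.ne n) ht (cosh_pos r), integral_const_mul]
    have := integral_comp_abs (f := fun x => radialKernel (n + 1) t (cosh r + x ^ 2 / 2))
    simp only [sq_abs] at this
    exact this.symm

end HeatKernel

end

end HypHeat

end

theorem mainTheorem6 (n : ℕ) [NeZero n] :
    -- the closure of `𝓛_n` on test functions is self-adjoint and nonpositive
    (HypHeat.IsResolvent n (HypHeat.resolvent n) ∧
      (HypHeat.resolvent n).IsPositive ∧ (1 - HypHeat.resolvent n).IsPositive) ∧
    -- the heat kernel exists
    (∀ t : ℝ, 0 < t → HypHeat.IsHeatKernel n t (HypHeat.heatKernel n t)) ∧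
    -- (i), the Laplace variable being `p = y²`
    (HypHeat.HasLaplace
        (HypHeat.inverseLaplace
          (fun p : ℝ => ((√Real.pi / √p : ℝ) : ℂ) • HypHeat.poissonSemigroup n (√p)))
        (fun p : ℝ => ((√Real.pi / √p : ℝ) : ℂ) • HypHeat.poissonSemigroup n (√p)) ∧
      ∀ t : ℝ, 0 < t →
        HypHeat.heatSemigroup n t =
          (((4 * t) ^ (-(1 / 2) : ℝ) : ℝ) : ℂ) •
            HypHeat.inverseLaplace
              (fun p : ℝ => ((√Real.pi / √p : ℝ) : ℂ) • HypHeat.poissonSemigroup n (√p))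
              (1 / (4 * t))) ∧
    -- (ii)
    (∀ t ρ : ℝ, 0 < t → 0 < ρ →
      DifferentiableAt ℝ (HypHeat.heatKernel n t) ρ ∧
      -(1 / (2 * Real.pi * Real.sinh ρ)) * deriv (HypHeat.heatKernel n t) ρ =
        HypHeat.heatKernel (n + 2) t ρ) ∧
    -- (iii)
    (∀ t r : ℝ, 0 < t → 0 ≤ r →
      IntegrableOn
        (fun ρ => HypHeat.heatKernel (n + 1) t ρ /
          √(Real.cosh (ρ / 2) ^ 2 - Real.cosh (r / 2) ^ 2) * Real.sinh ρ) (Ioi r) ∧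
      ∫ ρ in Ioi r, HypHeat.heatKernel (n + 1) t ρ /
          √(Real.cosh (ρ / 2) ^ 2 - Real.cosh (r / 2) ^ 2) * Real.sinh ρ =
        HypHeat.heatKernel n t r) := by
  refine ⟨HypHeat.isResolvent_resolvent, fun t ht => HypHeat.isHeatKernel_heatKernel ht,
    ⟨(HypHeat.hasLaplace_heatSemigroup (n := n)).inverseLaplace.1,
      fun t ht => HypHeat.heatSemigroup_eq_inverseLaplace ht⟩, fun t ρ ht hρ => ?_,
    fun t r ht hr => HypHeat.integral_heatKernel_succ ht hr⟩
  have h := HypHeat.hasDerivAt_heatKernel (n := n) ht hρ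
  refine ⟨h.differentiableAt, ?_⟩
  rw [h.deriv]
  have := (Real.sinh_pos_iff.2 hρ).ne'
  have := Real.pi_ne_zero
  field_simp
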